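/- Let $M$ be an oriented closed smooth three-manifold and $\phi$ a smooth Anosov flow on $M$, that is, $TM=E^s\oplus\mathbb{R}X\oplus E^u$ is a $d\phi$-invariant splitting into continuous line bundles, $X$ generates $\phi$, and for some Riemannian metric and some $A,B>0$ one has $\|d\phi_t|_{E^s}\|\le Ae^{-Bt}$ for $t\ge 0$ and $\|d\phi_t|_{E^u}\|\le Ae^{-B|t|}$ for $t\le 0$. Let $\gamma$ be a periodic orbit of $\phi$ whose stable and unstable leaves are orientable (equivalently, $E^s|_\gamma$ and $E^u|_\gamma$ are orientable). Let $\pi\colon M_\gamma\to M$ be the blow-up of $M$ along $\gamma$, which replaces $\gamma$ by its unit normal bundle $\mathbb{T}_\gamma=\pi^{-1}(\gamma)$ (the set of rays of $TM|_\gamma/T\gamma$), and let $\phi_\gamma$ be the lifted flow on $M_\gamma$, which acts on $\mathbb{T}_\gamma$ through $d\phi_t$. A parallel $\lambda_\gamma$ is one of the closed orbits of $\phi_\gamma$ in $\mathbb{T}_\gamma$ formed by the rays in the stable or unstable direction, oriented by the flow. A meridian $\mu_\gamma$ is a fibre of $\pi\colon\mathbb{T}_\gamma\to\gamma$, oriented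 so that the flow direction followed by the orientation of the normal planes of $\gamma$ is the orientation of $M$. For a closed curve $\gamma^*$ in $\mathbb{T}_\gamma$, the multiplicity $\mathrm{mult}(\gamma^*;\phi)$ is the mapping degree of $\pi\colon\gamma^*\to\gamma$, where $\gamma$ is oriented by the flow, and the linking number $\mathrm{link}(\gamma^*;\phi)$ is the unique integer with $$[\gamma^*]=\mathrm{mult}(\gamma^*;\phi)\,[\lambda_\gamma]+\mathrm{link}(\gamma^*;\phi)\,[\mu_\gamma]\quad\text{in } H_1(\mathbb{T}_\gamma;\mathbb{Z}).$$ Let $k\in\mathbb{Z}$. Choose a foliation of $\mathbb{T}_\gamma$ by circles that are transverse to $\phi_\gamma$ and represent, suitably oriented, the class $k[\lambda_\gamma]+[\mu_\gamma]$. Let $\pi_{\gamma,k}\colon M_\gamma\to M_{\gamma,k}$ be the quotient map which collapses each leaf to a point, and let $\phi_{\gamma,k}$ be a flow obtained by Fried–Goodman surgery of coefficient $k$ along $\gamma$, that is, a continuous flow on $M_{\gamma,k}$ which lifts through $\pi_{\gamma,k}$ to a continuous flow on $M_\gamma$ with the same oriented orbits as $\phi_\gamma$. Let $\gamma_k=\pi_{\gamma,k}(\mathbb{T}_\gamma)$,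 a periodic orbit of $\phi_{\gamma,k}$. Define $\mathrm{mult}(\gamma^*;\phi_{\gamma,k})$ and $\mathrm{link}(\gamma^*;\phi_{\gamma,k})$ in the same way from $\pi_{\gamma,k}\colon\mathbb{T}_\gamma\to\gamma_k$: the multiplicity is the degree of $\pi_{\gamma,k}\colon\gamma^*\to\gamma_k$, the parallels are the closed orbits in $\mathbb{T}_\gamma$ of the lift of $\phi_{\gamma,k}$, and the meridians are the fibres of $\pi_{\gamma,k}|_{\mathbb{T}_\gamma}$, oriented so as to cross the flow in the same direction as $\mu_\gamma$, that is, by the orientation of $M$ carried over to $M_{\gamma,k}$. Then for every closed curve $\gamma^*$ in $\mathbb{T}_\gamma$ all four integers are well defined, and $$\mathrm{mult}(\gamma^*;\phi_{\gamma,k})=\mathrm{mult}(\gamma^*;\phi)-k\cdot\mathrm{link}(\gamma^*;\phi),\qquad \mathrm{link}(\gamma^*;\phi_{\gamma,k})=\mathrm{link}(\gamma^*;\phi).$$ -/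

import Mathlib

open Set Filter Topology
open scoped Manifold ContDiff Bundle

noncomputable section

namespace FriedSurgery

/-! ### First singular homology -/

/-- Integral singular `n`-chains of `X`. -/
abbrev SingularChain (n : ℕ) (X : Type*) [TopologicalSpace X] : Type _ :=
  C(stdSimplex ℝ (Fin (n + 1)), X) →₀ ℤ

/-- The `i`-th face of a singular simplex. -/
def face {X : Type*} [TopologicalSpace X] {n : ℕ} (i : Fin (n + 2))
    (σ : C(stdSimplex ℝ (Fin (n + 2)), X)) : C(stdSimplex ℝ (Fin (n + 1)), X) :=
  σ.comp ⟨stdSimplex.map i.succAbove, stdSimplex.continuous_map _⟩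

/-- The singular boundary operator `∂ σ = ∑ i, (-1) ^ i • (i-th face of σ)`. -/
def boundaryMap (n : ℕ) (X : Type*) [TopologicalSpace X] :
    SingularChain (n + 1) X →ₗ[ℤ] SingularChain n X :=
  Finsupp.linearCombination ℤ fun σ : C(stdSimplex ℝ (Fin (n + 2)), X) =>
    ∑ i : Fin (n + 2), ((-1 : ℤ) ^ (i : ℕ)) • Finsupp.single (face i σ) (1 : ℤ)

/-- First singular homology group `H₁(X; ℤ)`: one-cycles modulo boundaries of two-chains. -/
abbrev H1 (X : Type*) [TopologicalSpace X] : Type _ :=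
  LinearMap.ker (boundaryMap 0 X) ⧸
    (LinearMap.range (boundaryMap 1 X)).comap (LinearMap.ker (boundaryMap 0 X)).subtype

/-- A closed curve, as a singular one-simplex running once around the circle. -/
def loopSimplex {X : Type*} [TopologicalSpace X] (c : C(UnitAddCircle, X)) :
    C(stdSimplex ℝ (Fin 2), X) :=
  c.comp ⟨fun x => ((x.1 1 : ℝ) : UnitAddCircle),
    (AddCircle.continuous_mk' (1 : ℝ)).comp ((continuous_apply 1).comp continuous_subtype_val)⟩

theorem boundaryMap_loopSimplex {X : Type*} [TopologicalSpace X] (c : C(UnitAddCircle, X)) :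
    boundaryMap 0 X (Finsupp.single (loopSimplex c) 1) = 0 := by
  have key : face (n := 0) 0 (loopSimplex c) = face (n := 0) 1 (loopSimplex c) := by
    ext x
    have hx : x = stdSimplex.vertex (S := ℝ) (0 : Fin 1) := Subsingleton.elim _ _
    subst hx
    have e0 : stdSimplex.map (S := ℝ) (0 : Fin 2).succAbove (stdSimplex.vertex (0 : Fin 1))
        = stdSimplex.vertex 1 := by
      rw [stdSimplex.map_vertex]; rfl
    have e1 : stdSimplex.map (S := ℝ) (1 : Fin 2).succAbove (stdSimplex.vertex (0 : Fin 1))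
        = stdSimplex.vertex 0 := by
      rw [stdSimplex.map_vertex]; rfl
    change c (((stdSimplex.map (S := ℝ) (0 : Fin 2).succAbove
        (stdSimplex.vertex (0 : Fin 1))).1 1 : ℝ) : UnitAddCircle)
      = c (((stdSimplex.map (S := ℝ) (1 : Fin 2).succAbove
        (stdSimplex.vertex (0 : Fin 1))).1 1 : ℝ) : UnitAddCircle)
    rw [e0, e1]
    congr 1
    simp
  simp [boundaryMap, Fin.sum_univ_two, key]

/-- The homology class of a closed curve. -/
def loopClass {X : Type*} [TopologicalSpace X] (c : C(UnitAddCircle, X)) : H1 X :=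
  Submodule.Quotient.mk ⟨Finsupp.single (loopSimplex c) 1, boundaryMap_loopSimplex c⟩

/-! ### Continuous flows, periodic orbits, degrees -/

/-- `P` is the minimal period of the periodic, non-stationary point `p`. -/
def IsMinimalPeriod {N : Type*} [TopologicalSpace N] (ψ : Flow ℝ N) (p : N) (P : ℝ) : Prop :=
  0 < P ∧ ψ P p = p ∧ ∀ t, 0 < t → t < P → ψ t p ≠ p

/-- The map `f` from the circle takes values in a periodic orbit of `ψ`, and `m` is its mapping
degree onto this orbit, oriented by the flow: `f` lifts to `θ` through the parametrization
`t ↦ ψ t p` of the orbit, and the lift moves by `m` periods along the circle. -/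
def IsDegree {N : Type*} [TopologicalSpace N] (ψ : Flow ℝ N) (f : UnitAddCircle → N) (m : ℤ) :
    Prop :=
  ∃ (p : N) (P : ℝ), IsMinimalPeriod ψ p P ∧
    ∃ θ : ℝ → ℝ, Continuous θ ∧ (∀ s : ℝ, f (s : UnitAddCircle) = ψ (θ s) p) ∧
      ∀ s : ℝ, θ (s + 1) = θ s + m * P

/-! ### Smooth flows and Anosov flows on three-manifolds -/

section Manifold

/-- A smooth flow on a three-manifold. -/
structure SmoothFlow (M : Type*) [TopologicalSpace M]
    [ChartedSpace (EuclideanSpace ℝ (Fin 3)) M] extends Flow ℝ M where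
  smooth : ContMDiff ((𝓘(ℝ, ℝ)).prod (𝓡 3)) (𝓡 3) ∞ (fun z : ℝ × M => toFun z.1 z.2)

variable {M : Type*} [TopologicalSpace M] [ChartedSpace (EuclideanSpace ℝ (Fin 3)) M]
  [IsManifold (𝓡 3) ∞ M]

/-- The differential `dφ_t : T_x M → T_{φ_t x} M`. -/
def SmoothFlow.diff (φ : SmoothFlow M) (t : ℝ) (x : M) :
    TangentSpace (𝓡 3) x →L[ℝ] TangentSpace (𝓡 3) (φ.toFlow t x) :=
  mfderiv (𝓡 3) (𝓡 3) (φ.toFlow t) x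

/-- The vector field generating the flow: the velocity at time `0` of `t ↦ φ_t x`
(a tangent vector at `φ_0 x = x`). -/
def SmoothFlow.velocity (φ : SmoothFlow M) (x : M) : TangentSpace (𝓡 3) x :=
  (mfderiv 𝓘(ℝ, ℝ) (𝓡 3) (fun t : ℝ => φ.toFlow t x) 0 : ℝ →L[ℝ] EuclideanSpace ℝ (Fin 3)) 1

/-- An orientation of `M`: a choice of orientation of every tangent space which is locally
given by a continuous frame. -/
def IsOrientation (o : ∀ x : M, Orientation ℝ (TangentSpace (𝓡 3) x) (Fin 3)) : Prop :=
  ∀ x₀ : M, ∃ U ∈ 𝓝 x₀, ∃ e : Fin 3 → ∀ x : M, TangentSpace (𝓡 3) x,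
    (∀ i, ContinuousOn (fun x => (⟨x, e i x⟩ : TangentBundle (𝓡 3) M)) U) ∧
    ∀ x ∈ U, ∃ b : Module.Basis (Fin 3) ℝ (TangentSpace (𝓡 3) x),
      (∀ i, b i = e i x) ∧ b.orientation = o x

/-- A continuous line subbundle of `TM`. -/
def IsLineBundle (L : ∀ x : M, Submodule ℝ (TangentSpace (𝓡 3) x)) : Prop :=
  ∀ x₀ : M, ∃ U ∈ 𝓝 x₀, ∃ s : ∀ x : M, TangentSpace (𝓡 3) x,
    ContinuousOn (fun x => (⟨x, s x⟩ : TangentBundle (𝓡 3) M)) U ∧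
    ∀ x ∈ U, s x ≠ 0 ∧ L x = Submodule.span ℝ {s x}

/-- The restriction of the line bundle `L` to the set `γ` is orientable: it has a continuous
nowhere vanishing section over `γ`. -/
def OrientableAlong (L : ∀ x : M, Submodule ℝ (TangentSpace (𝓡 3) x)) (γ : Set M) : Prop :=
  ∃ s : ∀ x : M, TangentSpace (𝓡 3) x,
    ContinuousOn (fun x => (⟨x, s x⟩ : TangentBundle (𝓡 3) M)) γ ∧
    ∀ x ∈ γ, s x ≠ 0 ∧ s x ∈ L x

/-- `φ` is an Anosov flow with stable bundle `Es` and unstable bundle `Eu`. -/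
structure IsAnosov (φ : SmoothFlow M) (Es Eu : ∀ x : M, Submodule ℝ (TangentSpace (𝓡 3) x)) :
    Prop where
  lineBundle_stable : IsLineBundle Es
  lineBundle_unstable : IsLineBundle Eu
  velocity_ne_zero : ∀ x, φ.velocity x ≠ 0
  splitting : ∀ x, DirectSum.IsInternal ![Es x, Submodule.span ℝ {φ.velocity x}, Eu x]
  invariant_stable : ∀ t x, (Es x).map (φ.diff t x : _ →ₗ[ℝ] _) = Es (φ.toFlow t x)
  invariant_unstable : ∀ t x, (Eu x).map (φ.diff t x : _ →ₗ[ℝ] _) = Eu (φ.toFlow t x)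
  hyperbolic : ∃ (g : Bundle.ContMDiffRiemannianMetric (𝓡 3) ∞ (EuclideanSpace ℝ (Fin 3))
      (fun x : M => TangentSpace (𝓡 3) x)) (A B : ℝ), 0 < A ∧ 0 < B ∧
    (∀ x, ∀ v ∈ Es x, ∀ t : ℝ, 0 ≤ t →
      √(g.inner _ (φ.diff t x v) (φ.diff t x v)) ≤ A * Real.exp (-(B * t)) * √(g.inner x v v)) ∧
    (∀ x, ∀ v ∈ Eu x, ∀ t : ℝ, t ≤ 0 →
      √(g.inner _ (φ.diff t x v) (φ.diff t x v)) ≤ A * Real.exp (-(B * |t|)) * √(g.inner x v v))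

/-! ### The unit normal bundle of an orbit -/

/-- Tangent vectors of `M` at points of the orbit of `p` that are not tangent to the orbit. -/
abbrev NormalVector (φ : SmoothFlow M) (p : M) : Type _ :=
  {v : TangentBundle (𝓡 3) M // v.proj ∈ φ.toFlow.orbit p ∧
    v.snd ∉ Submodule.span ℝ {φ.velocity v.proj}}

/-- Two vectors `a`, `b` at the same point of the orbit define the same ray of the normal bundle
if `a - r b` is tangent to the orbit for some `r > 0`. -/
def RayRel (φ : SmoothFlow M) (p : M) (v w : NormalVector φ p) : Prop :=
  ∃ (q : M) (a b : TangentSpace (𝓡 3) q) (r : ℝ), v.1 = ⟨q, a⟩ ∧ w.1 = ⟨q, b⟩ ∧ 0 < r ∧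
    a - r • b ∈ Submodule.span ℝ {φ.velocity q}

theorem rayRel_equivalence (φ : SmoothFlow M) (p : M) : Equivalence (RayRel φ p) where
  refl v := ⟨v.1.proj, v.1.snd, v.1.snd, 1, rfl, rfl, one_pos, by simp⟩
  symm := by
    rintro v w ⟨q, a, b, r, hv, hw, hr, h⟩
    refine ⟨q, b, a, r⁻¹, hw, hv, inv_pos.2 hr, ?_⟩
    have := Submodule.smul_mem _ (-r⁻¹) h
    rwa [smul_sub, smul_smul, neg_smul, neg_mul, inv_mul_cancel₀ hr.ne', neg_smul, one_smul,
      sub_neg_eq_add, neg_add_eq_sub] at this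
  trans := by
    rintro u v w ⟨q, a, b, r, hu, hv, hr, h⟩ ⟨q', b', c, r', hv', hw, hr', h'⟩
    obtain ⟨rfl, hb⟩ := Bundle.TotalSpace.mk.inj (hv.symm.trans hv')
    obtain rfl := eq_of_heq hb
    refine ⟨q, a, c, r * r', hu, hw, mul_pos hr hr', ?_⟩
    have := Submodule.add_mem _ h (Submodule.smul_mem _ r h')
    rwa [smul_sub, smul_smul, sub_add_sub_cancel] at this

instance raySetoid (φ : SmoothFlow M) (p : M) : Setoid (NormalVector φ p) :=
  ⟨RayRel φ p, rayRel_equivalence φ p⟩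

/-- The boundary torus: the unit normal bundle of the orbit of `p`, that is, the set of rays of
its normal bundle, with the quotient topology. -/
def BoundaryTorus (φ : SmoothFlow M) (p : M) : Type _ := Quotient (raySetoid φ p)

instance (φ : SmoothFlow M) (p : M) : TopologicalSpace (BoundaryTorus φ p) :=
  inferInstanceAs (TopologicalSpace (Quotient (raySetoid φ p)))

/-- The ray spanned by the normal vector `v`. -/
def ray {φ : SmoothFlow M} {p : M} (v : NormalVector φ p) : BoundaryTorus φ p :=
  Quotient.mk (raySetoid φ p) v

/-- The bundle projection of the boundary torus onto the orbit. -/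
def BoundaryTorus.base {φ : SmoothFlow M} {p : M} : BoundaryTorus φ p → M :=
  Quotient.lift (fun v => v.1.proj) (by
    rintro v w ⟨q, a, b, r, hv, hw, -, -⟩
    simp only [hv, hw])

/-! ### The action of the flow on rays -/

theorem SmoothFlow.mdifferentiable (φ : SmoothFlow M) (t : ℝ) :
    MDifferentiable (𝓡 3) (𝓡 3) (φ.toFlow t) := by
  have h : ContMDiff (𝓡 3) (𝓡 3) ∞ (φ.toFlow t) :=
    φ.smooth.comp (contMDiff_const.prodMk contMDiff_id)
  exact h.mdifferentiable (by simp)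

theorem SmoothFlow.mdifferentiable_time (φ : SmoothFlow M) (x : M) :
    MDifferentiable 𝓘(ℝ, ℝ) (𝓡 3) (fun t : ℝ => φ.toFlow t x) := by
  have h : ContMDiff 𝓘(ℝ, ℝ) (𝓡 3) ∞ (fun t : ℝ => φ.toFlow t x) :=
    φ.smooth.comp (contMDiff_id.prodMk contMDiff_const)
  exact h.mdifferentiable (by simp)

theorem SmoothFlow.diff_velocity (φ : SmoothFlow M) (t : ℝ) (x : M) :
    φ.diff t x (φ.velocity x) = φ.velocity (φ.toFlow t x) := by
  have h1 := (φ.mdifferentiable_time x 0).hasMFDerivAt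
  have h2 := (φ.mdifferentiable t (φ.toFlow 0 x)).hasMFDerivAt
  have h3 := h2.comp (0 : ℝ) h1
  have h4 := (φ.mdifferentiable_time (φ.toFlow t x) 0).hasMFDerivAt
  have e : (φ.toFlow t ∘ fun s : ℝ => φ.toFlow s x) = fun s : ℝ => φ.toFlow s (φ.toFlow t x) := by
    funext s
    simp only [Function.comp, ← φ.toFlow.map_add, add_comm]
  rw [e] at h3
  have h5 := hasMFDerivAt_unique h3 h4
  have h6 : ∀ y : M, y = φ.toFlow 0 x →
      (mfderiv (𝓡 3) (𝓡 3) (φ.toFlow t) y :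
          EuclideanSpace ℝ (Fin 3) →L[ℝ] EuclideanSpace ℝ (Fin 3)) (φ.velocity x) =
        (φ.velocity (φ.toFlow t x) : EuclideanSpace ℝ (Fin 3)) := by
    rintro y rfl
    exact congrArg (fun L : ℝ →L[ℝ] EuclideanSpace ℝ (Fin 3) => L 1) h5
  exact h6 x (φ.toFlow.map_zero_apply x).symm

theorem SmoothFlow.diff_neg_diff (φ : SmoothFlow M) (t : ℝ) (x : M)
    (v : TangentSpace (𝓡 3) x) :
    (φ.diff (-t) (φ.toFlow t x) (φ.diff t x v) : EuclideanSpace ℝ (Fin 3)) = v := by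
  have h1 := (φ.mdifferentiable t x).hasMFDerivAt
  have h2 := (φ.mdifferentiable (-t) (φ.toFlow t x)).hasMFDerivAt
  have h3 := h2.comp x h1
  have e : (φ.toFlow (-t) ∘ φ.toFlow t) = id := by
    funext y
    simp [Function.comp, ← φ.toFlow.map_add]
  rw [e] at h3
  have h5 := hasMFDerivAt_unique h3 (hasMFDerivAt_id x)
  exact congrArg (fun L : EuclideanSpace ℝ (Fin 3) →L[ℝ] EuclideanSpace ℝ (Fin 3) =>
    L (v : EuclideanSpace ℝ (Fin 3))) h5

theorem SmoothFlow.diff_mem_span (φ : SmoothFlow M) (t : ℝ) (x : M) (v : TangentSpace (𝓡 3) x)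
    (h : v ∈ Submodule.span ℝ {φ.velocity x}) :
    φ.diff t x v ∈ Submodule.span ℝ {φ.velocity (φ.toFlow t x)} := by
  obtain ⟨a, rfl⟩ := Submodule.mem_span_singleton.1 h
  rw [map_smul, φ.diff_velocity]
  exact Submodule.smul_mem _ _ (Submodule.mem_span_singleton_self _)

theorem SmoothFlow.diff_notMem_span (φ : SmoothFlow M) (t : ℝ) (x : M) (v : TangentSpace (𝓡 3) x)
    (h : v ∉ Submodule.span ℝ {φ.velocity x}) :
    φ.diff t x v ∉ Submodule.span ℝ {φ.velocity (φ.toFlow t x)} := by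
  intro h'
  obtain ⟨a, ha⟩ := Submodule.mem_span_singleton.1 h'
  apply h
  rw [← φ.diff_velocity, ← map_smul] at ha
  have := congrArg (φ.diff (-t) (φ.toFlow t x)) ha
  have e1 := φ.diff_neg_diff t x (a • φ.velocity x)
  have e2 := φ.diff_neg_diff t x v
  have e3 : a • φ.velocity x = v := e1.symm.trans (Eq.trans this e2)
  rw [← e3]
  exact Submodule.smul_mem _ _ (Submodule.mem_span_singleton_self _)

/-- The action of `dφ_t` on vectors normal to the orbit of `p`. -/
def normalFlow (φ : SmoothFlow M) (p : M) (t : ℝ) (v : NormalVector φ p) : NormalVector φ p :=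
  ⟨⟨φ.toFlow t v.1.proj, φ.diff t v.1.proj v.1.snd⟩,
    φ.toFlow.mem_orbit_of_mem_orbit t v.2.1, φ.diff_notMem_span t _ _ v.2.2⟩

/-- The action of `dφ_t` on the boundary torus. -/
def rayFlow (φ : SmoothFlow M) (p : M) (t : ℝ) : BoundaryTorus φ p → BoundaryTorus φ p :=
  Quotient.map (normalFlow φ p t) (by
    rintro ⟨v, hv1⟩ ⟨w, hw1⟩ ⟨q, a, b, r, hv, hw, hr, h⟩
    simp only at hv hw
    subst hv hw
    refine ⟨φ.toFlow t q, φ.diff t q a, φ.diff t q b, r, rfl, rfl, hr, ?_⟩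
    have := φ.diff_mem_span t q _ h
    rwa [map_sub, map_smul] at this)

/-! ### The blow-up along an orbit -/

/-- The blow-up `M_γ` of `M` along the orbit `γ` of `p`: every point of `γ` is replaced by the
circle of rays normal to `γ` at this point. -/
inductive Blowup (φ : SmoothFlow M) (p : M) : Type _
  | interior (x : M) (hx : x ∉ φ.toFlow.orbit p) : Blowup φ p
  | boundary (r : BoundaryTorus φ p) : Blowup φ p

/-- The blow-down projection `M_γ → M`. -/
def Blowup.blowDown {φ : SmoothFlow M} {p : M} : Blowup φ p → M
  | .interior x _ => x
  | .boundary r => r.base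

/-- For `f` vanishing on the orbit: the points off the orbit where `f` is positive, together with
the rays along which the derivative of `f` is positive. -/
def Blowup.positiveSet (φ : SmoothFlow M) (p : M) (f : M → ℝ) : Set (Blowup φ p) :=
  {y | (∃ x hx, y = .interior x hx ∧ 0 < f x) ∨
    ∃ v : NormalVector φ p, y = .boundary (ray v) ∧
      (0 : ℝ) < (mfderiv (𝓡 3) 𝓘(ℝ, ℝ) f v.1.proj : EuclideanSpace ℝ (Fin 3) →L[ℝ] ℝ) v.1.snd}

/-- The topology of the blow-up: the coarsest topology for which the blow-down projection is
continuous and for which `positiveSet f` is open for every smooth function `f` vanishing on the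
orbit. In local coordinates `(z, x, y)` with the orbit equal to `{x = y = 0}`, this is the topology
of polar coordinates: the functions `f` give the open half-planes `a x + b y > 0`, hence the open
sectors of directions. -/
instance (φ : SmoothFlow M) (p : M) : TopologicalSpace (Blowup φ p) :=
  TopologicalSpace.generateFrom
    ({V | ∃ U : Set M, IsOpen U ∧ V = Blowup.blowDown ⁻¹' U} ∪
      {V | ∃ f : M → ℝ, ContMDiff (𝓡 3) 𝓘(ℝ, ℝ) ∞ f ∧ (∀ x ∈ φ.toFlow.orbit p, f x = 0) ∧
        V = Blowup.positiveSet φ p f})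

/-- The lift `φ_γ` of the flow to the blow-up: `φ_t` off the orbit, and the action of `dφ_t` on
rays in the boundary torus. -/
def blowupFlow (φ : SmoothFlow M) (p : M) (t : ℝ) : Blowup φ p → Blowup φ p
  | .interior x hx => .interior (φ.toFlow t x) (fun h => hx (by
      have := φ.toFlow.mem_orbit_of_mem_orbit (-t) h
      rwa [← φ.toFlow.map_add, neg_add_cancel, φ.toFlow.map_zero_apply] at this))
  | .boundary r => .boundary (rayFlow φ p t r)

/-! ### Curves in the boundary torus -/

/-- The ray `r'` is obtained from the ray `r`, in the same normal plane, by a rotation of angle in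
`(0, π)`, for the orientation of the normal plane such that the flow direction followed by a
positive basis of the normal plane is a positive basis of the tangent space of `M`. -/
def PositivelyOriented (o : ∀ x : M, Orientation ℝ (TangentSpace (𝓡 3) x) (Fin 3))
    {φ : SmoothFlow M} {p : M} (r r' : BoundaryTorus φ p) : Prop :=
  ∃ v w : NormalVector φ p, r = ray v ∧ r' = ray w ∧
    ∃ (q : M) (a a' : TangentSpace (𝓡 3) q), v.1 = ⟨q, a⟩ ∧ w.1 = ⟨q, a'⟩ ∧
      ∃ b : Module.Basis (Fin 3) ℝ (TangentSpace (𝓡 3) q),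
        b 0 = φ.velocity q ∧ b 1 = a ∧ b 2 = a' ∧ b.orientation = o q

/-- The closed curve `c` in the boundary torus is everywhere (topologically) transverse to the
flow, and crosses it in the positive direction: sliding nearby points of the curve along the flow
for a short time into the normal plane at `c s₀`, the points after `c s₀` come after `c s₀` and
the points before `c s₀` come before `c s₀`, for the orientation of the normal plane. -/
def CrossesPositively (o : ∀ x : M, Orientation ℝ (TangentSpace (𝓡 3) x) (Fin 3))
    {φ : SmoothFlow M} {p : M} (c : C(UnitAddCircle, BoundaryTorus φ p)) : Prop :=
  ∀ s₀ δ : ℝ, 0 < δ →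
    (∀ᶠ s : ℝ in 𝓝[>] s₀, ∃ t : ℝ, |t| < δ ∧
      PositivelyOriented o (c (s₀ : UnitAddCircle)) (rayFlow φ p t (c (s : UnitAddCircle)))) ∧
    (∀ᶠ s : ℝ in 𝓝[<] s₀, ∃ t : ℝ, |t| < δ ∧
      PositivelyOriented o (rayFlow φ p t (c (s : UnitAddCircle))) (c (s₀ : UnitAddCircle)))

/-- The closed curve `c` traversed backwards. -/
def reverseCurve {X : Type*} [TopologicalSpace X] (c : C(UnitAddCircle, X)) :
    C(UnitAddCircle, X) :=
  c.comp ⟨fun s => -s, continuous_neg⟩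

/-- The closed curve `c` in the boundary torus runs exactly once along a closed orbit of
`F : ℝ → M_γ → M_γ`, in the direction of time. -/
def IsClosedOrbit {φ : SmoothFlow M} {p : M} (F : ℝ → Blowup φ p → Blowup φ p)
    (c : C(UnitAddCircle, BoundaryTorus φ p)) : Prop :=
  Function.Injective c ∧ ∃ (y : Blowup φ p) (τ : ℝ → ℝ), Continuous τ ∧ StrictMono τ ∧
    ∀ s : ℝ, Blowup.boundary (c (s : UnitAddCircle)) = F (τ s) y

/-- The parallels of the boundary torus of an Anosov flow: the closed orbits of the lifted flow
given by the rays in the stable or unstable direction. -/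
def IsParallel (φ : SmoothFlow M) (Es Eu : ∀ x : M, Submodule ℝ (TangentSpace (𝓡 3) x)) (p : M)
    (c : C(UnitAddCircle, BoundaryTorus φ p)) : Prop :=
  IsClosedOrbit (blowupFlow φ p) c ∧
    ∀ s, ∃ v : NormalVector φ p, c s = ray v ∧ (v.1.snd ∈ Es v.1.proj ∨ v.1.snd ∈ Eu v.1.proj)

/-- The meridians of the boundary torus, for a map `q` which blows the torus down to an orbit: the
simple closed curves running once along a fibre of `q`, in the positive direction. -/
def IsMeridian (o : ∀ x : M, Orientation ℝ (TangentSpace (𝓡 3) x) (Fin 3))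
    {φ : SmoothFlow M} {p : M} {N : Type*} (q : Blowup φ p → N)
    (c : C(UnitAddCircle, BoundaryTorus φ p)) : Prop :=
  Function.Injective c ∧ range c = {r | q (.boundary r) = q (.boundary (c 0))} ∧
    CrossesPositively o c

/-- The homology class of `c` is `a` times a parallel plus `b` times a meridian. -/
def HasCoordinates {X : Type*} [TopologicalSpace X] (Parallel Meridian : C(UnitAddCircle, X) → Prop)
    (c : C(UnitAddCircle, X)) (a b : ℤ) : Prop :=
  ∃ l m : C(UnitAddCircle, X), Parallel l ∧ Meridian m ∧
    loopClass c = a • loopClass l + b • loopClass m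

/-- The multiplicity of `c`, for the blow-down `q` of the boundary torus to an orbit of `ψ`. -/
def IsMultiplicity {φ : SmoothFlow M} {p : M} {N : Type*} [TopologicalSpace N]
    (q : Blowup φ p → N) (ψ : Flow ℝ N) (c : C(UnitAddCircle, BoundaryTorus φ p)) (m : ℤ) : Prop :=
  IsDegree ψ (fun s => q (.boundary (c s))) m

/-- The linking number of `c`: the coefficient `l` in
`[c] = (multiplicity of c) [parallel] + l [meridian]`. -/
def IsLinkingNumber (o : ∀ x : M, Orientation ℝ (TangentSpace (𝓡 3) x) (Fin 3))
    {φ : SmoothFlow M} {p : M} {N : Type*} [TopologicalSpace N]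
    (q : Blowup φ p → N) (ψ : Flow ℝ N)
    (Parallel : C(UnitAddCircle, BoundaryTorus φ p) → Prop)
    (c : C(UnitAddCircle, BoundaryTorus φ p)) (l : ℤ) : Prop :=
  ∃ m : ℤ, IsMultiplicity q ψ c m ∧ HasCoordinates Parallel (IsMeridian o q) c m l

/-! ### Fried surgery -/

/-- The classes of the equivalence relation `leaf` are the leaves of a foliation of the surface `X`
by circles. -/
structure IsCircleFoliation {X : Type*} [TopologicalSpace X] (leaf : Setoid X) : Prop where
  chart : ∀ x, ∃ e : OpenPartialHomeomorph X (ℝ × ℝ), x ∈ e.source ∧ e.target = univ ∧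
    ∀ y ∈ e.source, ∀ z ∈ e.source, (e y).2 = (e z).2 → leaf y z
  circle : ∀ x, ∃ c : C(UnitAddCircle, X), Function.Injective c ∧ range c = {y | leaf y x}

/-- The foliation of the boundary torus used for a Fried surgery of coefficient `k`: a foliation by
circles whose leaves, suitably parametrized, are transverse to the flow (in one direction or the
other) and represent `k [parallel] + [meridian]`. -/
structure IsSurgeryFoliation (o : ∀ x : M, Orientation ℝ (TangentSpace (𝓡 3) x) (Fin 3))
    (φ : SmoothFlow M) (Es Eu : ∀ x : M, Submodule ℝ (TangentSpace (𝓡 3) x)) (p : M) (k : ℤ)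
    (leaf : Setoid (BoundaryTorus φ p)) : Prop where
  foliation : IsCircleFoliation leaf
  leaf_curve : ∀ x, ∃ c : C(UnitAddCircle, BoundaryTorus φ p), Function.Injective c ∧
    range c = {r | leaf r x} ∧
    (CrossesPositively o c ∨ CrossesPositively o (reverseCurve c)) ∧
    HasCoordinates (IsParallel φ Es Eu p) (IsMeridian o (Blowup.blowDown (φ := φ) (p := p))) c k 1

/-- The relation on the blow-up which collapses every leaf of the boundary torus to a point. -/
def collapse {φ : SmoothFlow M} {p : M} (leaf : Setoid (BoundaryTorus φ p)) :
    Setoid (Blowup φ p) where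
  r x y := x = y ∨ ∃ r s, x = .boundary r ∧ y = .boundary s ∧ leaf r s
  iseqv :=
    { refl := fun _ => Or.inl rfl
      symm := by
        rintro x y (rfl | ⟨r, s, rfl, rfl, h⟩)
        · exact Or.inl rfl
        · exact Or.inr ⟨s, r, rfl, rfl, leaf.symm h⟩
      trans := by
        rintro x y z (rfl | ⟨r, s, rfl, rfl, h⟩) (rfl | ⟨r', s', h1, rfl, h'⟩)
        · exact Or.inl rfl
        · exact Or.inr ⟨r', s', h1, rfl, h'⟩
        · exact Or.inr ⟨r, s, rfl, rfl, h⟩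
        · cases h1
          exact Or.inr ⟨r, s', rfl, rfl, leaf.trans h h'⟩ }

/-- The surgered space `M_{γ,k}`: the blow-up with every leaf of the boundary torus collapsed to a
point, with the quotient topology. -/
abbrev Surgered {φ : SmoothFlow M} {p : M} (leaf : Setoid (BoundaryTorus φ p)) : Type _ :=
  Quotient (collapse leaf)

/-- The projection `π_{γ,k} : M_γ → M_{γ,k}`. -/
def surgeryProj {φ : SmoothFlow M} {p : M} (leaf : Setoid (BoundaryTorus φ p)) :
    Blowup φ p → Surgered leaf :=
  Quotient.mk (collapse leaf)

/-- The flow `φ'` on `M_{γ,k}` is a blow-down of the lifted flow `φ_γ`, and `Ψ` is its lift to the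
blow-up: `Ψ` has the same orbits as `φ_γ`, with the same orientation, and `π_{γ,k}` maps `Ψ` to
`φ'`. (No flow with the parametrization of `φ_γ` itself descends to `M_{γ,k}` when `k ≠ 0`.) -/
structure IsSurgeryFlow {φ : SmoothFlow M} {p : M} (leaf : Setoid (BoundaryTorus φ p))
    (Ψ : Flow ℝ (Blowup φ p)) (φ' : Flow ℝ (Surgered leaf)) : Prop where
  reparametrization : ∀ y, ∃ τ : ℝ ≃o ℝ, τ 0 = 0 ∧ ∀ t, Ψ (τ t) y = blowupFlow φ p t y
  semiconj : ∀ t y, surgeryProj leaf (Ψ t y) = φ' t (surgeryProj leaf y)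

end Manifold

end FriedSurgery

end

noncomputable section

namespace FriedSurgery

/-! ### Lifts to the universal cover of the circle -/

/-! The boundary torus has coordinates `H` on `UnitAddCircle × UnitAddCircle` in which the first
coordinate is the position along γ and the flow is (x, u) ↦ (x + t, W_t u), where W is a
one-parameter group of circle homeomorphisms fixing the stable direction 0. Each closed curve has a
bidegree (a, b), which determines its homology class, and relations between classes of loops are
relations between bidegrees (`loopClass_eq_iff`). Meridians of φ have bidegree (0, 1). Closed orbits
have bidegree (1, 0), since a periodic point of an increasing map of the line is fixed
(`hasBidegree_of_isClosedOrbit`). So mult = a and link = b for φ.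

Surgery keeps the oriented orbits, hence the class of the parallels, and replaces the meridian by a
leaf of bidegree (k, 1). From (a, b) = (a − kb)(1, 0) + b(k, 1) the linking number is still b. It
remains to see that a − kb is the degree over the new orbit (`surgery_isMultiplicity`). In the
universal cover, straightened so that flow lines are v = const, a leaf lifts to disjoint graphs x =
g_n(v), n ∈ ℤ, which every flow line meets in order (`IsLeafGraph`). One period of the new flow
leads from g_n to g_{n+1}. The deck transformation (k, 1) preserves each graph and (1, 0) raises the
index by one, so (a, b) carries g_n to g_{n+a−kb} (`shift_apply_deck`): one turn along the curve
takes a − kb periods.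

The coordinates come from a frame at p made of the velocity and a stable and an unstable eigenvector
of the differential of the return map (`exists_adaptedFrame`). Orientability makes the eigenvalues
μ, ν positive, so the holonomy on directions is that of diag(1, r) with r = ν/μ. It lies in the
one-parameter group diag(1, r^t), and undoing it gradually along the orbit makes the coordinates
periodic (`torusChart`). -/

theorem coe_eq_coe_iff_exists {x y : ℝ} :
    (x : UnitAddCircle) = (y : UnitAddCircle) ↔ ∃ n : ℤ, x = y + n := by
  rw [QuotientAddGroup.eq_iff_sub_mem, AddSubgroup.mem_zmultiples_iff]
  refine exists_congr fun n => ?_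
  rw [zsmul_eq_mul, mul_one, eq_comm, sub_eq_iff_eq_add']

/-- A continuous real function on a connected space with integer values is constant. -/
theorem eq_of_forall_exists_int {A : Type*} [TopologicalSpace A] [PreconnectedSpace A] {f : A → ℝ}
    (hf : Continuous f) (h : ∀ a, ∃ n : ℤ, f a = n) (a b : A) : f a = f b := by
  have hd : IsDiscrete (range ((↑) : ℤ → ℝ)) := ⟨
    (Int.isClosedEmbedding_coe_real.isEmbedding.toHomeomorph).symm.isEmbedding.discreteTopology⟩
  exact isPreconnected_univ.constant_of_mapsTo hd hf.continuousOn
    (fun a _ => (h a).imp fun n hn => hn.symm) (mem_univ a) (mem_univ b)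

/-- A contraction of `A` makes `f` the end of a homotopy that starts at a constant map; the homotopy
lifts through the covering of the circle. -/
theorem exists_circle_lift {A : Type*} [TopologicalSpace A] [ContractibleSpace A]
    (f : C(A, UnitAddCircle)) : ∃ F : C(A, ℝ), ∀ a, (F a : UnitAddCircle) = f a := by
  obtain ⟨a₀, ⟨H⟩⟩ := id_nullhomotopic A
  obtain ⟨x₀, hx₀⟩ := QuotientAddGroup.mk_surjective (f a₀)
  have cov := AddCircle.isCoveringMap_coe (1 : ℝ)
  let K : C(unitInterval × A, UnitAddCircle) := f.comp (H.symm : C(unitInterval × A, A))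
  have hK : ∀ a, K (0, a) = ((ContinuousMap.const A x₀ a : ℝ) : UnitAddCircle) := by
    intro a
    have : H.symm (0, a) = a₀ := by simp
    change f (H.symm (0, a)) = _
    rw [this]
    exact hx₀.symm
  refine ⟨(cov.liftHomotopy K (ContinuousMap.const A x₀) hK).comp
    ((ContinuousMap.const A 1).prodMk (ContinuousMap.id A)), fun a => ?_⟩
  have := congrFun (cov.liftHomotopy_lifts K (ContinuousMap.const A x₀) hK) (1, a)
  refine this.trans ?_
  change f (H.symm (1, a)) = f a
  simp

/-- Two lifts differ by an integer, which cannot vary on a connected space. This is why variations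
and degrees do not depend on the chosen lift. -/
theorem sub_eq_sub_of_circle_lift {A : Type*} [TopologicalSpace A] [PreconnectedSpace A]
    {F G : A → ℝ} (hF : Continuous F) (hG : Continuous G)
    (h : ∀ a, (F a : UnitAddCircle) = G a) (a b : A) : F a - F b = G a - G b := by
  have := eq_of_forall_exists_int (hF.sub hG) (fun a => by
    obtain ⟨n, hn⟩ := coe_eq_coe_iff_exists.1 (h a)
    exact ⟨n, by simp [hn]⟩) a b
  simp only [Pi.sub_apply] at this
  linarith

/-- A self-map of the circle, given as a function, has a lift that moves by `d`. -/
def IsWinding (f : UnitAddCircle → UnitAddCircle) (d : ℤ) : Prop :=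
  ∃ F : ℝ → ℝ, Continuous F ∧ (∀ s : ℝ, (F s : UnitAddCircle) = f s) ∧ ∀ s, F (s + 1) = F s + d

theorem exists_int_of_circle_lift {f : UnitAddCircle → UnitAddCircle} {F : ℝ → ℝ}
    (hF : Continuous F) (h : ∀ s : ℝ, (F s : UnitAddCircle) = f s) :
    ∃ d : ℤ, ∀ s, F (s + 1) = F s + d := by
  have h' : ∀ s : ℝ, ((F (s + 1) : ℝ) : UnitAddCircle) = (F s : ℝ) := fun s => by
    rw [h, h]
    congr 1
    exact AddCircle.coe_add_period 1 s
  obtain ⟨d, hd⟩ := coe_eq_coe_iff_exists.1 (h' 0)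
  refine ⟨d, fun s => ?_⟩
  have := sub_eq_sub_of_circle_lift (hF.comp (continuous_add_const 1)) hF h' s 0
  simp only [Function.comp] at this
  linarith

theorem exists_isWinding (f : C(UnitAddCircle, UnitAddCircle)) : ∃ d, IsWinding f d := by
  obtain ⟨F, hF⟩ := exists_circle_lift (f.comp ⟨_, AddCircle.continuous_mk' (1 : ℝ)⟩)
  obtain ⟨d, hd⟩ := exists_int_of_circle_lift (f := f) F.continuous hF
  exact ⟨d, F, F.continuous, hF, hd⟩

/-! ### Winding numbers on homology -/

instance contractibleSpace_stdSimplex (n : ℕ) : ContractibleSpace (stdSimplex ℝ (Fin (n + 1))) :=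
  (convex_stdSimplex ℝ (Fin (n + 1))).contractibleSpace ⟨_, single_mem_stdSimplex ℝ 0⟩

section Winding

variable {X : Type*} [TopologicalSpace X]

/-- The variation along a singular `1`-simplex of a lift of the circle-valued map `f`. -/
def variation (f : C(X, UnitAddCircle)) (σ : C(stdSimplex ℝ (Fin 2), X)) : ℝ :=
  (exists_circle_lift (f.comp σ)).choose (stdSimplex.vertex 1) -
    (exists_circle_lift (f.comp σ)).choose (stdSimplex.vertex 0)

theorem variation_eq (f : C(X, UnitAddCircle)) (σ : C(stdSimplex ℝ (Fin 2), X))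
    {G : stdSimplex ℝ (Fin 2) → ℝ} (hG : Continuous G)
    (h : ∀ a, (G a : UnitAddCircle) = f (σ a)) :
    variation f σ = G (stdSimplex.vertex 1) - G (stdSimplex.vertex 0) :=
  sub_eq_sub_of_circle_lift (ContinuousMap.continuous _) hG (fun a =>
    ((exists_circle_lift (f.comp σ)).choose_spec a).trans (h a).symm) _ _

/-- The cocycle measuring the variation of a circle-valued map. -/
def variationMap (f : C(X, UnitAddCircle)) : SingularChain 1 X →ₗ[ℤ] ℝ :=
  Finsupp.linearCombination ℤ (variation f)

theorem variationMap_single (f : C(X, UnitAddCircle)) (σ : C(stdSimplex ℝ (Fin 2), X)) :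
    variationMap f (Finsupp.single σ 1) = variation f σ := by
  simp [variationMap]

theorem boundaryMap_one_single (σ : C(stdSimplex ℝ (Fin 3), X)) :
    boundaryMap 1 X (Finsupp.single σ 1) = Finsupp.single (face 0 σ) 1
      - Finsupp.single (face 1 σ) 1 + Finsupp.single (face 2 σ) 1 := by
  simp [boundaryMap, Fin.sum_univ_three, sub_eq_add_neg]

/-- A lift over a whole triangle restricts to lifts over its edges, so the three variations
telescope. -/
theorem variationMap_boundaryMap (f : C(X, UnitAddCircle)) (z : SingularChain 2 X) :
    variationMap f (boundaryMap 1 X z) = 0 := by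
  suffices h : (variationMap f).comp (boundaryMap 1 X) = 0 from LinearMap.congr_fun h z
  refine Finsupp.lhom_ext' fun σ => LinearMap.ext_ring ?_
  obtain ⟨G, hG⟩ := exists_circle_lift (f.comp σ)
  have hv (i : Fin 3) : variation f (face i σ) = G (stdSimplex.vertex (i.succAbove 1)) -
      G (stdSimplex.vertex (i.succAbove 0)) := by
    rw [variation_eq f (face i σ) (G := fun a => G (stdSimplex.map i.succAbove a))
      (G.continuous.comp (stdSimplex.continuous_map _)) (fun a => hG _)]
    simp only [stdSimplex.map_vertex]
  simp only [LinearMap.comp_apply, Finsupp.lsingle_apply, LinearMap.zero_apply]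
  rw [boundaryMap_one_single, map_add, map_sub]
  simp only [variationMap_single, hv]
  have e1 : (0 : Fin 3).succAbove (1 : Fin 2) = 2 := rfl
  have e2 : (0 : Fin 3).succAbove (0 : Fin 2) = 1 := rfl
  have e3 : (1 : Fin 3).succAbove (1 : Fin 2) = 2 := rfl
  have e4 : (1 : Fin 3).succAbove (0 : Fin 2) = 0 := rfl
  have e5 : (2 : Fin 3).succAbove (1 : Fin 2) = 1 := rfl
  have e6 : (2 : Fin 3).succAbove (0 : Fin 2) = 0 := rfl
  rw [e1, e2, e3, e4, e5, e6]
  ring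

/-- The winding number of a circle-valued map, as a homomorphism on `H₁`. -/
def windingHom (f : C(X, UnitAddCircle)) : H1 X →ₗ[ℤ] ℝ :=
  Submodule.liftQ _ ((variationMap f).comp (LinearMap.ker (boundaryMap 0 X)).subtype) (by
    rintro z ⟨w, hw⟩
    rw [LinearMap.mem_ker, LinearMap.comp_apply, ← hw, variationMap_boundaryMap])

theorem windingHom_loopClass (f : C(X, UnitAddCircle)) (c : C(UnitAddCircle, X)) {d : ℤ}
    (h : IsWinding (f ∘ c) d) : windingHom f (loopClass c) = d := by
  obtain ⟨F, hF, hFc, hd⟩ := h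
  change variationMap f (Finsupp.single (loopSimplex c) 1) = d
  rw [variationMap_single, variation_eq f _ (G := fun a => F (a.1 1))
    (hF.comp ((continuous_apply 1).comp continuous_subtype_val)) (fun a => hFc _)]
  have := hd 0
  rw [zero_add] at this
  simp [this]

/-! ### Homologies between loops -/

/-- The singular `1`-simplex given by a path. -/
def edge (γ : C(ℝ, X)) : C(stdSimplex ℝ (Fin 2), X) :=
  γ.comp ⟨fun x => x.1 1, (continuous_apply 1).comp continuous_subtype_val⟩

/-- The affine singular triangle with vertices `(0, 0)`, `(1, 0)`, `(1, 1)` in a plane. -/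
def triangle (K : C(ℝ × ℝ, X)) : C(stdSimplex ℝ (Fin 3), X) :=
  K.comp ⟨fun x => (x.1 1 + x.1 2, x.1 2), by
    have h (i : Fin 3) : Continuous fun x : stdSimplex ℝ (Fin 3) => x.1 i :=
      (continuous_apply i).comp continuous_subtype_val
    exact ((h 1).add (h 2)).prodMk (h 2)⟩

theorem stdSimplex_map_apply {m n : ℕ} (f : Fin m → Fin n) (x : stdSimplex ℝ (Fin m))
    (j : Fin n) : (stdSimplex.map f x).1 j = ∑ k, if f k = j then x.1 k else 0 := by
  change stdSimplex.map f x j = _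
  rw [stdSimplex.map_coe, FunOnFinite.linearMap_apply_apply, Finset.sum_filter]
  rfl

theorem face_triangle (K : C(ℝ × ℝ, X)) (i : Fin 3) (γ : C(ℝ, X))
    (h : ∀ x : stdSimplex ℝ (Fin 2), γ (x.1 1) =
      K ((if i.succAbove 0 = 1 then x.1 0 else 0) + (if i.succAbove 1 = 1 then x.1 1 else 0)
        + ((if i.succAbove 0 = 2 then x.1 0 else 0) + (if i.succAbove 1 = 2 then x.1 1 else 0)),
        (if i.succAbove 0 = 2 then x.1 0 else 0) + (if i.succAbove 1 = 2 then x.1 1 else 0))) :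
    face i (triangle K) = edge γ := by
  ext x
  change K ((stdSimplex.map i.succAbove x).1 1 + (stdSimplex.map i.succAbove x).1 2,
    (stdSimplex.map i.succAbove x).1 2) = γ (x.1 1)
  simp only [stdSimplex_map_apply, Fin.sum_univ_two]
  exact (h x).symm

theorem boundaryMap_triangle (K : C(ℝ × ℝ, X)) :
    boundaryMap 1 X (Finsupp.single (triangle K) 1) =
      Finsupp.single (edge (K.comp ⟨fun t => (1, t), by fun_prop⟩)) 1
      - Finsupp.single (edge (K.comp ⟨fun t => (t, t), by fun_prop⟩)) 1
      + Finsupp.single (edge (K.comp ⟨fun t => (t, 0), by fun_prop⟩)) 1 := by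
  have hs (x : stdSimplex ℝ (Fin 2)) : x.1 0 + x.1 1 = 1 := stdSimplex.add_eq_one x
  rw [boundaryMap_one_single, face_triangle K 0 (K.comp ⟨fun t => (1, t), by fun_prop⟩),
    face_triangle K 1 (K.comp ⟨fun t => (t, t), by fun_prop⟩),
    face_triangle K 2 (K.comp ⟨fun t => (t, 0), by fun_prop⟩)]
  · intro x
    simp [Fin.succAbove, Fin.ext_iff]
  · intro x
    simp [Fin.succAbove, Fin.ext_iff]
  · intro x
    simp [Fin.succAbove, Fin.ext_iff, hs x]

theorem loopClass_eq_of_boundary {c c' : C(UnitAddCircle, X)} (z : SingularChain 2 X)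
    (h : boundaryMap 1 X z =
      Finsupp.single (loopSimplex c) 1 - Finsupp.single (loopSimplex c') 1) :
    loopClass c = loopClass c' :=
  (Submodule.Quotient.eq _).2 ⟨z, h⟩

/-- Freely homotopic loops are homologous. -/
theorem loopClass_eq_of_homotopy {c c' : C(UnitAddCircle, X)} (K : C(ℝ × ℝ, X))
    (h0 : ∀ s, K (0, s) = c (s : ℝ)) (h1 : ∀ s, K (1, s) = c' (s : ℝ))
    (hK : ∀ t, K (t, 1) = K (t, 0)) : loopClass c = loopClass c' := by
  -- The square is cut into two triangles along its diagonal. The diagonals cancel, and the two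
  -- sides traced by the endpoints cancel by `hK`.
  refine loopClass_eq_of_boundary (Finsupp.single (triangle (K.comp ⟨Prod.swap, by fun_prop⟩)) 1
    - Finsupp.single (triangle K) 1) ?_
  rw [map_sub, boundaryMap_triangle, boundaryMap_triangle]
  have e0 : edge ((K.comp ⟨Prod.swap, by fun_prop⟩).comp ⟨fun t => (t, 0), by fun_prop⟩) =
      loopSimplex c := by
    ext x; exact h0 _
  have e1 : edge (K.comp ⟨fun t => (1, t), by fun_prop⟩) = loopSimplex c' := by
    ext x; exact h1 _
  have e2 : edge ((K.comp ⟨Prod.swap, by fun_prop⟩).comp ⟨fun t => (1, t), by fun_prop⟩) =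
      edge (K.comp ⟨fun t => (t, 0), by fun_prop⟩) := by
    ext x; exact hK _
  have e3 : edge ((K.comp ⟨Prod.swap, by fun_prop⟩).comp ⟨fun t => (t, t), by fun_prop⟩) =
      edge (K.comp ⟨fun t => (t, t), by fun_prop⟩) := by
    ext x; rfl
  rw [e0, e1, e2, e3]
  abel

/-- The diagonal of a singular torus is homologous to the sum of its sides. -/
theorem loopClass_diagonal (K : C(UnitAddCircle × UnitAddCircle, X)) :
    loopClass (K.comp ⟨fun s => (s, s), by fun_prop⟩) =
      loopClass (K.comp ⟨fun s => (s, 0), by fun_prop⟩) +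
        loopClass (K.comp ⟨fun s => (0, s), by fun_prop⟩) := by
  let K' : C(ℝ × ℝ, X) := K.comp ⟨fun z => ((z.1 : UnitAddCircle), (z.2 : UnitAddCircle)),
    ((AddCircle.continuous_mk' (1 : ℝ)).comp continuous_fst).prodMk
      ((AddCircle.continuous_mk' (1 : ℝ)).comp continuous_snd)⟩
  have h1 : ((1 : ℝ) : UnitAddCircle) = 0 := AddCircle.coe_period 1
  -- The diagonal is the middle face and has sign -1 in the boundary, hence the minus sign.
  refine (Submodule.Quotient.eq _).2 ⟨-Finsupp.single (triangle K') 1, ?_⟩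
  have e0 : edge (K'.comp ⟨fun t => (1, t), by fun_prop⟩) =
      loopSimplex (K.comp ⟨fun s => (0, s), by fun_prop⟩) := by
    ext x
    change K (((1 : ℝ) : UnitAddCircle), _) = K (0, _)
    rw [h1]
    rfl
  rw [map_neg, boundaryMap_triangle, e0]
  change _ = (Finsupp.single (loopSimplex (K.comp ⟨fun s => (s, s), by fun_prop⟩)) 1 -
    (Finsupp.single (loopSimplex (K.comp ⟨fun s => (s, 0), by fun_prop⟩)) 1 +
      Finsupp.single (loopSimplex (K.comp ⟨fun s => (0, s), by fun_prop⟩)) 1) : SingularChain 1 X)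
  have e1 : edge (K'.comp ⟨fun t => (t, t), by fun_prop⟩) =
      loopSimplex (K.comp ⟨fun s => (s, s), by fun_prop⟩) := rfl
  have e2 : edge (K'.comp ⟨fun t => (t, 0), by fun_prop⟩) =
      loopSimplex (K.comp ⟨fun s => (s, 0), by fun_prop⟩) := rfl
  rw [e1, e2]
  abel

/-! ### Loops in a torus -/

variable (H : UnitAddCircle × UnitAddCircle ≃ₜ X)

/-- The loop `c` in the torus `X` winds `a` times in the first and `b` times in the second
direction. -/
def HasBidegree (c : C(UnitAddCircle, X)) (a b : ℤ) : Prop :=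
  ∃ ξ η : ℝ → ℝ, Continuous ξ ∧ Continuous η ∧ (∀ s : ℝ, c s = H (ξ s, η s)) ∧
    (∀ s, ξ (s + 1) = ξ s + a) ∧ ∀ s, η (s + 1) = η s + b

theorem exists_hasBidegree (c : C(UnitAddCircle, X)) : ∃ a b, HasBidegree H c a b := by
  obtain ⟨a, ξ, hξ, hξc, ha⟩ := exists_isWinding
    ((ContinuousMap.fst.comp (H.symm : C(X, UnitAddCircle × UnitAddCircle))).comp c)
  obtain ⟨b, η, hη, hηc, hb⟩ := exists_isWinding
    ((ContinuousMap.snd.comp (H.symm : C(X, UnitAddCircle × UnitAddCircle))).comp c)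
  refine ⟨a, b, ξ, η, hξ, hη, fun s => ?_, ha, hb⟩
  rw [hξc, hηc, ← H.symm_apply_eq]
  rfl

/-- The first coordinate on a torus. -/
def torusFst : C(X, UnitAddCircle) :=
  ContinuousMap.fst.comp (H.symm : C(X, UnitAddCircle × UnitAddCircle))

/-- The second coordinate on a torus. -/
def torusSnd : C(X, UnitAddCircle) :=
  ContinuousMap.snd.comp (H.symm : C(X, UnitAddCircle × UnitAddCircle))

variable {H}

theorem HasBidegree.windingHom_fst {c : C(UnitAddCircle, X)} {a b : ℤ} (h : HasBidegree H c a b) :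
    windingHom (torusFst H) (loopClass c) = a := by
  obtain ⟨ξ, η, hξ, hη, hc, ha, hb⟩ := h
  exact windingHom_loopClass _ _ ⟨ξ, hξ, fun s => by simp [torusFst, hc], ha⟩

theorem HasBidegree.windingHom_snd {c : C(UnitAddCircle, X)} {a b : ℤ} (h : HasBidegree H c a b) :
    windingHom (torusSnd H) (loopClass c) = b := by
  obtain ⟨ξ, η, hξ, hη, hc, ha, hb⟩ := h
  exact windingHom_loopClass _ _ ⟨η, hη, fun s => by simp [torusSnd, hc], hb⟩

theorem HasBidegree.unique {c : C(UnitAddCircle, X)} {a b a' b' : ℤ} (h : HasBidegree H c a b)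
    (h' : HasBidegree H c a' b') : a = a' ∧ b = b' :=
  ⟨by exact_mod_cast h.windingHom_fst.symm.trans h'.windingHom_fst,
    by exact_mod_cast h.windingHom_snd.symm.trans h'.windingHom_snd⟩

/-- Linear interpolation between the lifts is a free homotopy: since the increments agree, every
intermediate curve closes up. -/
theorem HasBidegree.loopClass_eq {c c' : C(UnitAddCircle, X)} {a b : ℤ} (h : HasBidegree H c a b)
    (h' : HasBidegree H c' a b) : loopClass c = loopClass c' := by
  obtain ⟨ξ, η, hξ, hη, hc, ha, hb⟩ := h
  obtain ⟨ξ', η', hξ', hη', hc', ha', hb'⟩ := h'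
  have hmk := AddCircle.continuous_mk' (1 : ℝ)
  refine loopClass_eq_of_homotopy ⟨fun z : ℝ × ℝ =>
    H (((ξ z.2 + z.1 * (ξ' z.2 - ξ z.2) : ℝ) : UnitAddCircle),
      ((η z.2 + z.1 * (η' z.2 - η z.2) : ℝ) : UnitAddCircle)),
    H.continuous.comp ((hmk.comp (by fun_prop)).prodMk (hmk.comp (by fun_prop)))⟩ ?_ ?_ ?_
  · intro s
    simp [hc]
  · intro s
    simp [hc']
  · intro t
    have e1 := ha 0
    have e2 := ha' 0
    have e3 := hb 0
    have e4 := hb' 0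
    rw [zero_add] at e1 e2 e3 e4
    simp only [ContinuousMap.coe_mk]
    congr 2
    · rw [coe_eq_coe_iff_exists]
      exact ⟨a, by rw [e1, e2]; ring⟩
    · rw [coe_eq_coe_iff_exists]
      exact ⟨b, by rw [e3, e4]; ring⟩

variable (H) in
/-- The linear loop of given bidegree. -/
def linearLoop (a b : ℤ) : C(UnitAddCircle, X) :=
  (H : C(UnitAddCircle × UnitAddCircle, X)).comp ⟨fun s => (a • s, b • s), by fun_prop⟩

variable (H) in
theorem hasBidegree_linearLoop (a b : ℤ) : HasBidegree H (linearLoop H a b) a b := by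
  refine ⟨fun s => a * s, fun s => b * s, by fun_prop, by fun_prop, fun s => ?_, fun s => by ring,
    fun s => by ring⟩
  simp only [← zsmul_eq_mul]
  rfl

/-- The map `K` is a singular torus whose two sides are the given linear loops and whose diagonal is
the loop of the summed bidegree. -/
theorem loopClass_linearLoop_add (a b a' b' : ℤ) : loopClass (linearLoop H (a + a') (b + b')) =
    loopClass (linearLoop H a b) + loopClass (linearLoop H a' b') := by
  let K : C(UnitAddCircle × UnitAddCircle, X) := (H : C(UnitAddCircle × UnitAddCircle, X)).comp
    ⟨fun z : UnitAddCircle × UnitAddCircle => (a • z.1 + a' • z.2, b • z.1 + b' • z.2),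
      by fun_prop⟩
  have e0 : linearLoop H (a + a') (b + b') = K.comp ⟨fun s => (s, s), by fun_prop⟩ := by
    ext s
    simp [linearLoop, K, add_zsmul]
  have e1 : linearLoop H a b = K.comp ⟨fun s => (s, 0), by fun_prop⟩ := by
    ext s
    simp [linearLoop, K]
  have e2 : linearLoop H a' b' = K.comp ⟨fun s => (0, s), by fun_prop⟩ := by
    ext s
    simp [linearLoop, K]
  rw [e0, e1, e2]
  exact loopClass_diagonal K

variable (H) in
/-- The homology class of the linear loop, as a homomorphism from `ℤ × ℤ`. -/
def linearLoopHom : ℤ × ℤ →+ H1 X :=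
  AddMonoidHom.mk' (fun z => loopClass (linearLoop H z.1 z.2)) fun z w =>
    loopClass_linearLoop_add z.1 z.2 w.1 w.2

/-- In a torus, homology classes of loops are classified by the bidegree. -/
theorem loopClass_eq_iff {c l m : C(UnitAddCircle, X)} {a b a₁ b₁ a₂ b₂ : ℤ}
    (hc : HasBidegree H c a b) (hl : HasBidegree H l a₁ b₁) (hm : HasBidegree H m a₂ b₂)
    (x y : ℤ) : loopClass c = x • loopClass l + y • loopClass m ↔
      a = x * a₁ + y * a₂ ∧ b = x * b₁ + y * b₂ := by
  constructor
  · intro h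
    -- The winding numbers of the two coordinates recover the bidegree from the homology class.
    have h1 := congrArg (windingHom (torusFst H)) h
    have h2 := congrArg (windingHom (torusSnd H)) h
    rw [map_add, map_zsmul, map_zsmul, hc.windingHom_fst, hl.windingHom_fst, hm.windingHom_fst,
      zsmul_eq_mul, zsmul_eq_mul] at h1
    rw [map_add, map_zsmul, map_zsmul, hc.windingHom_snd, hl.windingHom_snd, hm.windingHom_snd,
      zsmul_eq_mul, zsmul_eq_mul] at h2
    exact ⟨by exact_mod_cast h1, by exact_mod_cast h2⟩
  · rintro ⟨rfl, rfl⟩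
    -- Each loop may be replaced by the linear one of its bidegree, and on linear loops the class is
    -- additive.
    rw [hc.loopClass_eq (hasBidegree_linearLoop H _ _),
      hl.loopClass_eq (hasBidegree_linearLoop H _ _),
      hm.loopClass_eq (hasBidegree_linearLoop H _ _)]
    change linearLoopHom H (_, _) = x • linearLoopHom H (a₁, b₁) + y • linearLoopHom H (a₂, b₂)
    rw [← map_zsmul, ← map_zsmul, ← map_add]
    simp

end Winding

theorem map_add_int_mul {F : ℝ → ℝ} {d : ℝ} (h : ∀ s, F (s + 1) = F s + d) (s : ℝ) (n : ℤ) :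
    F (s + n) = F s + n * d := by
  induction n with
  | zero => simp
  | succ n ih =>
    have := h (s + n)
    push_cast at ih ⊢
    rw [← add_assoc, this, ih]; ring
  | pred n ih =>
    have := h (s + (-n - 1))
    push_cast at ih ⊢
    rw [show s + (-(n : ℝ) - 1) + 1 = s + -n by ring, ih] at this
    linarith

/-- Injective loops with the same image have the same bidegree up to sign. -/
theorem HasBidegree.of_range_eq {X : Type*} [TopologicalSpace X] [T2Space X]
    {H : UnitAddCircle × UnitAddCircle ≃ₜ X} {c c' : C(UnitAddCircle, X)}
    (hc : Function.Injective c) (hc' : Function.Injective c') (hr : range c = range c') {a b : ℤ}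
    (h : HasBidegree H c a b) : HasBidegree H c' a b ∨ HasBidegree H c' (-a) (-b) := by
  -- An injective loop embeds the compact circle, so each loop is the other one composed with a
  -- circle map. The degrees of these two maps multiply to 1, hence are both 1 or both -1.
  have key : ∀ c c' : C(UnitAddCircle, X), Function.Injective c → range c = range c' →
      ∃ f : C(UnitAddCircle, UnitAddCircle), ∀ s, c (f s) = c' s := by
    intro c c' hc hr
    let e := (c.continuous.isClosedEmbedding hc).isEmbedding.toHomeomorph
    have hm : ∀ s, c' s ∈ range c := fun s => hr ▸ mem_range_self s
    refine ⟨⟨fun s => e.symm ⟨c' s, hm s⟩, e.symm.continuous.comp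
      (c'.continuous.subtype_mk hm)⟩, fun s => ?_⟩
    exact congrArg Subtype.val (e.apply_symm_apply ⟨c' s, hm s⟩)
  obtain ⟨f, hf⟩ := key c c' hc hr
  obtain ⟨g, hg⟩ := key c' c hc' hr.symm
  have hgf : ∀ s, g (f s) = s := fun s => hc' (by rw [hg, hf])
  obtain ⟨d, F, hF, hFf, hd⟩ := exists_isWinding f
  obtain ⟨e, G, hG, hGg, he⟩ := exists_isWinding g
  have h1 := sub_eq_sub_of_circle_lift (hG.comp hF) continuous_id (fun s => by
    simp only [Function.comp, id]
    rw [hGg, hFf, hgf]) 1 0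
  have h2 := hd 0
  rw [zero_add] at h2
  simp only [Function.comp, h2, id, map_add_int_mul he] at h1
  have h3 : d * e = 1 := by
    have : (d : ℝ) * e = 1 := by linarith
    exact_mod_cast this
  obtain ⟨ξ, η, hξ, hη, hcs, ha, hb⟩ := h
  have h4 : HasBidegree H c' (d * a) (d * b) := by
    refine ⟨ξ ∘ F, η ∘ F, hξ.comp hF, hη.comp hF, fun s => ?_, fun s => ?_, fun s => ?_⟩
    · rw [← hf, ← hFf, hcs]; rfl
    · simp only [Function.comp, hd, map_add_int_mul ha]; push_cast; ring
    · simp only [Function.comp, hd, map_add_int_mul hb]; push_cast; ring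
  rcases Int.eq_one_or_neg_one_of_mul_eq_one h3 with rfl | rfl
  · left; simpa using h4
  · right; simpa using h4

/-! ### Periods and degrees -/

section Period

variable {N : Type*} [TopologicalSpace N] {ψ : Flow ℝ N} {p : N} {P : ℝ}

theorem IsMinimalPeriod.map_int_mul (h : IsMinimalPeriod ψ p P) (n : ℤ) : ψ (n * P) p = p := by
  have h1 : ∀ t, ψ (t + P) p = ψ t p := fun t => by rw [ψ.map_add, h.2.1]
  induction n with
  | zero => simp [ψ.map_zero_apply]
  | succ n ih =>
    push_cast at ih ⊢
    rw [add_mul, one_mul, h1, ih]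
  | pred n ih =>
    push_cast at ih ⊢
    rw [← h1, ← ih]
    congr 1
    ring_nf

theorem IsMinimalPeriod.apply_eq_self_iff (h : IsMinimalPeriod ψ p P) {t : ℝ} :
    ψ t p = p ↔ ∃ n : ℤ, t = n * P := by
  constructor
  · intro ht
    refine ⟨⌊t / P⌋, ?_⟩
    have h0 := h.1
    have h1 : ψ (t - ⌊t / P⌋ * P) p = p := by
      have e : t - ⌊t / P⌋ * P = t + ((-⌊t / P⌋ : ℤ) : ℝ) * P := by push_cast; ring
      rw [e, ψ.map_add, h.map_int_mul, ht]
    have h2 : 0 ≤ t - ⌊t / P⌋ * P := by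
      have := Int.floor_le (t / P)
      rw [le_div_iff₀ h0] at this
      linarith
    have h3 : t - ⌊t / P⌋ * P < P := by
      have := Int.lt_floor_add_one (t / P)
      rw [div_lt_iff₀ h0] at this
      linarith
    by_contra hne
    exact h.2.2 _ (lt_of_le_of_ne h2 (fun h' => hne (by linarith))) h3 h1
  · rintro ⟨n, rfl⟩
    exact h.map_int_mul n

theorem IsMinimalPeriod.apply_eq_apply_iff (h : IsMinimalPeriod ψ p P) {s t : ℝ} :
    ψ s p = ψ t p ↔ ∃ n : ℤ, s = t + n * P := by
  have e : ψ s p = ψ t p ↔ ψ (s - t) p = p := by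
    constructor
    · intro h
      rw [sub_eq_neg_add, ψ.map_add, h, ← ψ.map_add, neg_add_cancel, ψ.map_zero_apply]
    · intro h
      have := congrArg (ψ t) h
      rwa [← ψ.map_add, add_sub_cancel] at this
  rw [e, h.apply_eq_self_iff]
  exact exists_congr fun n => sub_eq_iff_eq_add'

theorem IsMinimalPeriod.le_of_pos (h : IsMinimalPeriod ψ p P) {t : ℝ} (ht : 0 < t)
    (h' : ψ t p = p) : P ≤ t := not_lt.1 fun hlt => h.2.2 t ht hlt h'

theorem IsMinimalPeriod.unique (h : IsMinimalPeriod ψ p P) {P' : ℝ}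
    (h' : IsMinimalPeriod ψ p P') : P = P' :=
  le_antisymm (h.le_of_pos h'.1 h'.2.1) (h'.le_of_pos h.1 h.2.1)

theorem IsMinimalPeriod.apply (h : IsMinimalPeriod ψ p P) (a : ℝ) :
    IsMinimalPeriod ψ (ψ a p) P := by
  have e : ∀ t, ψ t (ψ a p) = ψ a (ψ t p) := fun t => by
    rw [← ψ.map_add, ← ψ.map_add, add_comm]
  refine ⟨h.1, by rw [e, h.2.1], fun t ht htP h' => h.2.2 t ht htP ?_⟩
  rw [e] at h'
  have := congrArg (ψ (-a)) h'
  rwa [← ψ.map_add, ← ψ.map_add, neg_add_cancel, zero_add, ← ψ.map_add, neg_add_cancel,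
    ψ.map_zero_apply] at this

/-- Both parametrizations belong to the same orbit, so they have equal periods and differ by a shift
of the base point. The remaining difference of the lifts is an integer number of periods, constant
by continuity. -/
theorem IsDegree.unique {f : UnitAddCircle → N} {m n : ℤ} (hm : IsDegree ψ f m)
    (hn : IsDegree ψ f n) : m = n := by
  obtain ⟨p, P, hP, θ, hθ, hf, hd⟩ := hm
  obtain ⟨p', P', hP', θ', hθ', hf', hd'⟩ := hn
  have h0 : p' = ψ (θ 0 - θ' 0) p := by
    have := congrArg (ψ (-θ' 0)) ((hf' 0).symm.trans (hf 0))
    rw [← ψ.map_add, ← ψ.map_add, neg_add_cancel, ψ.map_zero_apply] at this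
    rw [this, sub_eq_neg_add]
  subst h0
  obtain rfl := hP'.unique (hP.apply _)
  have hne : P' ≠ 0 := hP.1.ne'
  have h1 : ∀ s, ∃ k : ℤ, (θ s - θ' s - (θ 0 - θ' 0)) / P' = k := fun s => by
    have := (hf s).symm.trans (hf' s)
    rw [← ψ.map_add, hP.apply_eq_apply_iff] at this
    obtain ⟨k, hk⟩ := this
    exact ⟨k, by rw [hk]; field_simp; ring⟩
  have h2 := eq_of_forall_exists_int (by fun_prop) h1 1 0
  have h3 := hd 0
  have h4 := hd' 0
  rw [zero_add] at h3 h4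
  rw [h3, h4, div_left_inj' hne] at h2
  have : (m : ℝ) = n := mul_right_cancel₀ hne (by linarith)
  exact_mod_cast this

end Period

/-! ### One-parameter groups of circle homeomorphisms -/

/-- The lift to the line of a one-parameter group of circle homeomorphisms with a fixed point. -/
structure CircleFlow where
  /-- The action on the line. -/
  act : ℝ → ℝ → ℝ
  continuous_act : Continuous fun z : ℝ × ℝ => act z.1 z.2
  act_zero : ∀ u, act 0 u = u
  act_add : ∀ s t u, act (s + t) u = act s (act t u)
  act_add_one : ∀ t u, act t (u + 1) = act t u + 1
  act_fix : ∀ t, act t 0 = 0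

namespace CircleFlow

variable (W : CircleFlow)

theorem continuous_comp {A : Type*} [TopologicalSpace A] {f g : A → ℝ} (hf : Continuous f)
    (hg : Continuous g) : Continuous fun a => W.act (f a) (g a) :=
  W.continuous_act.comp (hf.prodMk hg)

theorem act_neg_act (t u : ℝ) : W.act (-t) (W.act t u) = u := by
  rw [← W.act_add, neg_add_cancel, W.act_zero]

theorem act_act_neg (t u : ℝ) : W.act t (W.act (-t) u) = u := by
  rw [← W.act_add, add_neg_cancel, W.act_zero]

theorem act_add_int (t u : ℝ) (n : ℤ) : W.act t (u + n) = W.act t u + n := by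
  rw [map_add_int_mul (F := W.act t) (d := 1) (W.act_add_one t), mul_one]

theorem act_int (t : ℝ) (n : ℤ) : W.act t n = n := by
  have := W.act_add_int t 0 n
  rwa [zero_add, W.act_fix, zero_add] at this

/-- A continuous injection of the line is monotone, and fixing 0 and 1 excludes the decreasing case.
-/
theorem strictMono_act (t : ℝ) : StrictMono (W.act t) := by
  have hinj : Function.Injective (W.act t) := fun u v h => by
    rw [← W.act_neg_act t u, h, W.act_neg_act]
  rcases (W.continuous_comp continuous_const continuous_id).strictMono_of_inj hinj with h | h
  · exact h
  · have h1 := h (zero_lt_one' ℝ)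
    have h2 := W.act_int t 1
    have h3 := W.act_fix t
    simp only [id] at h1
    push_cast at h2
    linarith

/-- Integers are fixed and order is preserved, so no point moves across an integer. The floor thus
measures turns in the second coordinate, unaffected by the holonomy. -/
theorem floor_act (t u : ℝ) : ⌊W.act t u⌋ = ⌊u⌋ := by
  rw [Int.floor_eq_iff]
  constructor
  · rw [← W.act_int t]
    exact (W.strictMono_act t).monotone (Int.floor_le u)
  · have : ((⌊u⌋ : ℝ) + 1) = W.act t ((⌊u⌋ + 1 : ℤ) : ℝ) := by rw [W.act_int]; push_cast; rfl
    rw [this]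
    apply W.strictMono_act t
    push_cast
    exact Int.lt_floor_add_one u

theorem eq_zero_of_act_eq_add {s t u : ℝ} {j : ℤ} (h : W.act s u = W.act t u + j) : j = 0 := by
  have := congrArg Int.floor h
  rw [Int.floor_add_intCast, W.floor_act, W.floor_act] at this
  linarith

/-- Under an increasing map the iterates of a point that is not fixed move strictly in one direction
and never return. -/
theorem act_one_of_act_nat {n : ℕ} (hn : n ≠ 0) {u : ℝ} (h : W.act n u = u) : W.act 1 u = u := by
  have h1 : ∀ n : ℕ, W.act n u = (W.act 1)^[n] u := by
    intro n
    induction n with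
    | zero => simp [W.act_zero]
    | succ n ih => rw [Function.iterate_succ_apply', ← ih, ← W.act_add]; congr 1; push_cast; ring
  rw [h1] at h
  rcases lt_trichotomy (W.act 1 u) u with hlt | heq | hlt
  · have := (W.strictMono_act 1).strictAnti_iterate_of_map_lt hlt (Nat.pos_of_ne_zero hn)
    simp only [Function.iterate_zero, id] at this
    linarith
  · exact heq
  · have := (W.strictMono_act 1).strictMono_iterate_of_lt_map hlt (Nat.pos_of_ne_zero hn)
    simp only [Function.iterate_zero, id] at this
    linarith

end CircleFlow

/-! ### Auxiliary facts on real functions -/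

/-- The maximum on [a, b] can only be attained at `b`, because every earlier point has a larger
value somewhere to its right. -/
theorem strictMono_of_eventually_right {f : ℝ → ℝ} (hf : Continuous f)
    (h : ∀ a, ∀ᶠ s in 𝓝[>] a, f a < f s) : StrictMono f := by
  intro a b hab
  obtain ⟨m, hm, hmax⟩ := isCompact_Icc.exists_isMaxOn (nonempty_Icc.2 hab.le) hf.continuousOn
  have key : ∀ x ∈ Ico a b, ∃ y ∈ Icc a b, f x < f y := fun x hx => by
    obtain ⟨y, hy1, hy2⟩ := ((h x).and (Ioo_mem_nhdsGT hx.2)).exists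
    exact ⟨y, ⟨hx.1.trans hy2.1.le, hy2.2.le⟩, hy1⟩
  have hmb : m = b := by
    by_contra hne
    obtain ⟨y, hy, hlt⟩ := key m ⟨hm.1, lt_of_le_of_ne hm.2 hne⟩
    exact absurd (hmax hy) (not_le.2 hlt)
  obtain ⟨y, hy, hlt⟩ := key a ⟨le_rfl, hab⟩
  exact hlt.trans_le (hmb ▸ hmax hy)

theorem lt_of_forall_ne {f g : ℝ → ℝ} (hf : Continuous f) (hg : Continuous g)
    (h : ∀ v, f v ≠ g v) {a : ℝ} (ha : f a < g a) (b : ℝ) : f b < g b := by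
  by_contra hb
  rw [not_lt] at hb
  obtain ⟨v, -, hv⟩ := isPreconnected_univ.intermediate_value₂ (mem_univ a) (mem_univ b)
    hf.continuousOn hg.continuousOn ha.le hb
  exact h v hv

/-- An order isomorphism of ℤ commutes with the successor. -/
theorem int_eq_self_of_strictMono {e : ℤ → ℤ} (he : StrictMono e) (hs : Function.Surjective e)
    (h0 : e 0 = 0) (n : ℤ) : e n = n := by
  have h1 : ∀ n, e (n + 1) = e n + 1 := fun n =>
    (he.orderIsoOfSurjective e hs).map_succ n
  induction n with
  | zero => exact h0
  | succ n ih => rw [h1, ih]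
  | pred n ih =>
    have := h1 (-n - 1)
    rw [sub_add_cancel, ih] at this
    linarith

/-- Preimages of open rays are given by strict inequalities between `X a b` and `x a` at a fixed
`b`, so continuity in the parameter at each fixed time is enough. -/
theorem continuous_of_orderIso {A : Type*} [TopologicalSpace A] (X : A → ℝ ≃o ℝ)
    (hX : ∀ t, Continuous fun a => X a t) {x : A → ℝ} (hx : Continuous x) :
    Continuous fun a => (X a).symm (x a) := by
  rw [OrderTopology.topology_eq_generate_intervals (α := ℝ), continuous_generateFrom_iff]
  rintro s ⟨b, rfl | rfl⟩
  · convert isOpen_lt (hX b) hx using 1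
    ext a
    exact (X a).lt_symm_apply
  · convert isOpen_lt hx (hX b) using 1
    ext a
    exact (X a).symm_apply_lt

/-! ### Coordinates on the boundary torus and the straightened universal cover -/

section Manifold

variable {M : Type*} [TopologicalSpace M] [ChartedSpace (EuclideanSpace ℝ (Fin 3)) M]
  [IsManifold (𝓡 3) ∞ M]

/-- Coordinates on the boundary torus of the orbit of `p`, in which the flow moves the first
coordinate with constant speed and acts on the second one by a one-parameter group. -/
structure TorusChart (o : ∀ x : M, Orientation ℝ (TangentSpace (𝓡 3) x) (Fin 3))
    (φ : SmoothFlow M) (Es : ∀ x : M, Submodule ℝ (TangentSpace (𝓡 3) x)) (p : M) where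
  /-- The period of the orbit. -/
  period : ℝ
  isMinimalPeriod : IsMinimalPeriod φ.toFlow p period
  /-- The action of the flow on directions. -/
  W : CircleFlow
  /-- The coordinates. -/
  H : UnitAddCircle × UnitAddCircle ≃ₜ BoundaryTorus φ p
  base_apply : ∀ x u : ℝ, (H (x, u)).base = φ.toFlow (x * period) p
  rayFlow_apply : ∀ t x u : ℝ, rayFlow φ p (t * period) (H (x, u)) =
    H ((x + t : ℝ), (W.act t u : ℝ))
  positivelyOriented_iff : ∀ x u u' : ℝ,
    PositivelyOriented o (H (x, (W.act x u : ℝ))) (H (x, (W.act x u' : ℝ))) ↔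
      0 < Real.sin (2 * Real.pi * (u' - u))
  stable : ∀ x : ℝ, ∃ v : NormalVector φ p, H (x, (0 : ℝ)) = ray v ∧ v.1.snd ∈ Es v.1.proj

theorem PositivelyOriented.base_eq
    {o : ∀ x : M, Orientation ℝ (TangentSpace (𝓡 3) x) (Fin 3)} {φ : SmoothFlow M} {p : M}
    {r r' : BoundaryTorus φ p} (h : PositivelyOriented o r r') : r.base = r'.base := by
  obtain ⟨v, w, rfl, rfl, q, a, a', hv, hw, -⟩ := h
  change v.1.proj = w.1.proj
  rw [hv, hw]

/-- This identifies the parallels of the surgered flow with closed orbits of the lift of φ. -/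
theorem isClosedOrbit_iff_of_reparametrization {φ : SmoothFlow M} {p : M}
    {F G : ℝ → Blowup φ p → Blowup φ p}
    (h : ∀ y, ∃ τ : ℝ ≃o ℝ, τ 0 = 0 ∧ ∀ t, F (τ t) y = G t y)
    (c : C(UnitAddCircle, BoundaryTorus φ p)) : IsClosedOrbit F c ↔ IsClosedOrbit G c := by
  constructor
  · rintro ⟨hc, y, τ, hτ, hm, hy⟩
    obtain ⟨σ, -, hσ⟩ := h y
    refine ⟨hc, y, fun s => σ.symm (τ s), σ.symm.continuous.comp hτ,
      σ.symm.strictMono.comp hm, fun s => ?_⟩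
    rw [← hσ, σ.apply_symm_apply, hy]
  · rintro ⟨hc, y, τ, hτ, hm, hy⟩
    obtain ⟨σ, -, hσ⟩ := h y
    exact ⟨hc, y, fun s => σ (τ s), σ.continuous.comp hτ, σ.strictMono.comp hm,
      fun s => by rw [hσ, hy]⟩

namespace TorusChart

variable {o : ∀ x : M, Orientation ℝ (TangentSpace (𝓡 3) x) (Fin 3)}
  {φ : SmoothFlow M} {Es Eu : ∀ x : M, Submodule ℝ (TangentSpace (𝓡 3) x)} {p : M}
  (C : TorusChart o φ Es p)

/-- The coordinates on the universal cover of the torus in which the flow lines are the lines on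
which the second coordinate is constant. -/
def straight (x u : ℝ) : BoundaryTorus φ p := C.H (x, (C.W.act x u : ℝ))

theorem period_pos : 0 < C.period := C.isMinimalPeriod.1

theorem straight_surjective (r : BoundaryTorus φ p) : ∃ x u, C.straight x u = r := by
  obtain ⟨⟨a, b⟩, rfl⟩ := C.H.surjective r
  obtain ⟨x, rfl⟩ := QuotientAddGroup.mk_surjective a
  obtain ⟨y, rfl⟩ := QuotientAddGroup.mk_surjective b
  exact ⟨x, C.W.act (-x) y, by rw [straight, C.W.act_act_neg]⟩

/-- The pairs (i, j) are the deck transformations. The price of straight flow lines is that a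
translation by i along the orbit acts on the other coordinate by the holonomy. -/
theorem straight_eq_iff {x u x' u' : ℝ} : C.straight x u = C.straight x' u' ↔
    ∃ i j : ℤ, x' = x + i ∧ u' = C.W.act (-i) u + j := by
  rw [straight, straight, C.H.injective.eq_iff, Prod.mk.injEq, eq_comm, coe_eq_coe_iff_exists,
    eq_comm, coe_eq_coe_iff_exists]
  constructor
  · rintro ⟨⟨i, hi⟩, j, hj⟩
    refine ⟨i, j, hi, ?_⟩
    rw [← C.W.act_neg_act x' u', hj, C.W.act_add_int, ← C.W.act_add]
    congr 2
    rw [hi]; ring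
  · rintro ⟨i, j, hi, hj⟩
    refine ⟨⟨i, hi⟩, j, ?_⟩
    rw [hj, C.W.act_add_int, ← C.W.act_add]
    congr 2
    rw [hi]; ring

theorem base_straight (x u : ℝ) : (C.straight x u).base = φ.toFlow (x * C.period) p :=
  C.base_apply _ _

theorem rayFlow_straight (t x u : ℝ) :
    rayFlow φ p t (C.straight x u) = C.straight (x + t / C.period) u := by
  have := C.rayFlow_apply (t / C.period) x (C.W.act x u)
  rw [div_mul_cancel₀ _ C.period_pos.ne', ← C.W.act_add, add_comm (t / _)] at this
  exact this

/-- A lift of a closed curve to the straightened universal cover. -/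
def IsStraightLift (c : C(UnitAddCircle, BoundaryTorus φ p)) (a b : ℤ) (x v : ℝ → ℝ) : Prop :=
  Continuous x ∧ Continuous v ∧ (∀ s : ℝ, c s = C.straight (x s) (v s)) ∧
    (∀ s, x (s + 1) = x s + a) ∧ ∀ s, v (s + 1) = C.W.act (-a) (v s) + b

theorem hasBidegree_iff {c : C(UnitAddCircle, BoundaryTorus φ p)} {a b : ℤ} :
    HasBidegree C.H c a b ↔ ∃ x v, C.IsStraightLift c a b x v := by
  constructor
  · rintro ⟨ξ, η, hξ, hη, hc, ha, hb⟩
    refine ⟨ξ, fun s => C.W.act (-ξ s) (η s), hξ, C.W.continuous_comp hξ.neg hη, fun s => ?_,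
      ha, fun s => ?_⟩
    · rw [straight, C.W.act_act_neg, hc]
    · simp only
      rw [ha, hb, C.W.act_add_int, ← C.W.act_add]
      congr 2
      ring
  · rintro ⟨x, v, hx, hv, hc, ha, hb⟩
    refine ⟨x, fun s => C.W.act (x s) (v s), hx, C.W.continuous_comp hx hv, hc, ha, fun s => ?_⟩
    simp only
    rw [ha, hb, C.W.act_add_int, ← C.W.act_add]
    congr 2
    ring

variable {C} in
theorem IsStraightLift.reverse {c : C(UnitAddCircle, BoundaryTorus φ p)} {a b : ℤ} {x v : ℝ → ℝ}
    (h : C.IsStraightLift c a b x v) :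
    C.IsStraightLift (reverseCurve c) (-a) (-b) (fun s => x (-s)) (fun s => v (-s)) := by
  obtain ⟨hx, hv, hc, ha, hb⟩ := h
  refine ⟨hx.comp continuous_neg, hv.comp continuous_neg, fun s => hc (-s), fun s => ?_,
    fun s => ?_⟩
  · have := ha (-(s + 1))
    rw [show -(s + 1) + 1 = -s by ring] at this
    push_cast
    linarith
  · have := hb (-(s + 1))
    rw [show -(s + 1) + 1 = -s by ring] at this
    simp only
    rw [this, C.W.act_add_int, ← C.W.act_add]
    push_cast
    rw [neg_neg, add_neg_cancel, C.W.act_zero]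
    ring

variable {C} in
/-- Along a curve crossing the flow positively, the straightened coordinate is increasing. -/
theorem IsStraightLift.strictMono {c : C(UnitAddCircle, BoundaryTorus φ p)} {a b : ℤ}
    {x v : ℝ → ℝ} (h : C.IsStraightLift c a b x v) (hc : CrossesPositively o c) :
    StrictMono v := by
  obtain ⟨hx, hv, hcs, -, -⟩ := h
  have hP := C.period_pos
  refine strictMono_of_eventually_right hv fun s₀ => ?_
  -- Moving by less than 1/4 along the curve and sliding by less than a quarter period cannot add up
  -- to a full period, so the slid point lies over `x s₀` in the cover itself. The bound 1/2 on the
  -- other coordinate makes the sign of the sine that of `v s - v s₀`.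
  have h1 : ∀ᶠ s in 𝓝[>] s₀, |x s - x s₀| < 1 / 4 :=
    nhdsWithin_le_nhds ((Metric.continuous_iff'.1 hx s₀ (1 / 4) (by norm_num)))
  have h2 : ∀ᶠ s in 𝓝[>] s₀, |v s - v s₀| < 1 / 2 :=
    nhdsWithin_le_nhds ((Metric.continuous_iff'.1 hv s₀ (1 / 2) (by norm_num)))
  filter_upwards [h1, h2, (hc s₀ (C.period / 4) (by positivity)).1] with s hs1 hs2 hs3
  obtain ⟨t, ht, hpos⟩ := hs3
  rw [hcs, hcs, C.rayFlow_straight] at hpos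
  have hb := hpos.base_eq
  rw [C.base_straight, C.base_straight, C.isMinimalPeriod.apply_eq_apply_iff] at hb
  obtain ⟨n, hn⟩ := hb
  have hn' : x s₀ = x s + t / C.period + n := by
    apply mul_right_cancel₀ hP.ne'
    rw [hn]; ring
  have ht' : |t / C.period| < 1 / 4 := by
    rw [abs_div, abs_of_pos hP, div_lt_iff₀ hP]
    linarith
  have hn0 : n = 0 := by
    have : |(n : ℝ)| < 1 := by
      rw [abs_lt] at *
      constructor <;> linarith
    rw [← Int.abs_lt_one_iff]
    exact_mod_cast this
  rw [hn0, Int.cast_zero, add_zero] at hn'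
  rw [← hn'] at hpos
  have hsin := (C.positivelyOriented_iff _ _ _).1 hpos
  by_contra hle
  rw [not_lt] at hle
  rw [abs_lt] at hs2
  have : Real.sin (2 * Real.pi * (v s - v s₀)) ≤ 0 := by
    apply Real.sin_nonpos_of_nonpos_of_neg_pi_le
    · nlinarith [Real.pi_pos]
    · nlinarith [Real.pi_pos]
  linarith

/-- The lifted coordinate increases, while one turn changes its floor by exactly `b`. -/
theorem crossesPositively_nonneg {c : C(UnitAddCircle, BoundaryTorus φ p)} {a b : ℤ}
    (h : HasBidegree C.H c a b) (hc : CrossesPositively o c) : 0 ≤ b := by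
  obtain ⟨x, v, hl⟩ := C.hasBidegree_iff.1 h
  have h1 := Int.floor_mono (hl.strictMono hc (lt_add_one (0 : ℝ))).le
  rw [hl.2.2.2.2, Int.floor_add_intCast, C.W.floor_act] at h1
  linarith

theorem reverseCurve_crossesPositively_nonpos {c : C(UnitAddCircle, BoundaryTorus φ p)} {a b : ℤ}
    (h : HasBidegree C.H c a b) (hc : CrossesPositively o (reverseCurve c)) : b ≤ 0 := by
  obtain ⟨x, v, hl⟩ := C.hasBidegree_iff.1 h
  have := C.crossesPositively_nonneg (C.hasBidegree_iff.2 ⟨_, _, hl.reverse⟩) hc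
  linarith

theorem t2Space (C : TorusChart o φ Es p) : T2Space (BoundaryTorus φ p) := C.H.symm.isEmbedding.t2Space

/-- A positive curve with the same image as a curve of bidegree `(a, 1)` has this bidegree. -/
theorem hasBidegree_of_range_eq {c m : C(UnitAddCircle, BoundaryTorus φ p)} {a : ℤ}
    (hc : Function.Injective c) (hm : Function.Injective m) (hr : range c = range m)
    (h : HasBidegree C.H c a 1) (hpos : CrossesPositively o m) : HasBidegree C.H m a 1 := by
  have := C.t2Space
  rcases h.of_range_eq hc hm hr with h' | h'
  · exact h'
  · have := C.crossesPositively_nonneg h' hpos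
    omega

/-! ### Meridians and parallels of the original flow -/

/-- The fibre of the torus over a point of the orbit. -/
def fibre (x : UnitAddCircle) : C(UnitAddCircle, BoundaryTorus φ p) :=
  (C.H : C(UnitAddCircle × UnitAddCircle, BoundaryTorus φ p)).comp ⟨fun s => (x, s), by fun_prop⟩

theorem hasBidegree_fibre (x : ℝ) : HasBidegree C.H (C.fibre x) 0 1 :=
  ⟨fun _ => x, id, continuous_const, continuous_id, fun s => rfl, by simp, by simp⟩

theorem fibre_injective (x : UnitAddCircle) : Function.Injective (C.fibre x) := fun s t h => by
  have := C.H.injective h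
  exact (Prod.mk.inj this).2

theorem range_fibre (x : ℝ) {r : BoundaryTorus φ p}
    (hr : r.base = φ.toFlow (x * C.period) p) :
    range (C.fibre x) = {r' | Blowup.blowDown (.boundary r') = Blowup.blowDown (.boundary r)} := by
  ext r'
  change _ ↔ r'.base = r.base
  constructor
  · rintro ⟨s, rfl⟩
    obtain ⟨y, rfl⟩ := QuotientAddGroup.mk_surjective s
    exact (C.base_apply x y).trans hr.symm
  · obtain ⟨⟨a, b⟩, rfl⟩ := C.H.surjective r'
    obtain ⟨y, rfl⟩ := QuotientAddGroup.mk_surjective a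
    obtain ⟨z, rfl⟩ := QuotientAddGroup.mk_surjective b
    intro h
    have h1 := (C.base_apply y z).symm.trans (h.trans hr)
    rw [C.isMinimalPeriod.apply_eq_apply_iff] at h1
    obtain ⟨n, hn⟩ := h1
    refine ⟨z, ?_⟩
    have e : (x : UnitAddCircle) = y := by
      rw [eq_comm, coe_eq_coe_iff_exists]
      exact ⟨n, mul_right_cancel₀ C.period_pos.ne' (by rw [hn]; ring)⟩
    change C.H (_, _) = _
    rw [e]

theorem crossesPositively_fibre : CrossesPositively o (C.fibre (0 : ℝ)) := by
  have h1 : ∀ s : ℝ, C.fibre (0 : ℝ) s = C.straight 0 s := fun s => by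
    rw [straight, C.W.act_zero]; rfl
  have h2 : ∀ s : ℝ, rayFlow φ p 0 (C.fibre (0 : ℝ) s) = C.straight 0 s := fun s => by
    rw [h1, C.rayFlow_straight, zero_div, add_zero]
  have key : ∀ s t : ℝ, s < t → t < s + 1 / 2 →
      PositivelyOriented o (C.straight 0 s) (C.straight 0 t) := fun s t h h' => by
    refine (C.positivelyOriented_iff _ _ _).2 (Real.sin_pos_of_pos_of_lt_pi ?_ ?_)
    · have := Real.pi_pos
      have : 0 < t - s := by linarith
      positivity
    · nlinarith [Real.pi_pos]
  refine fun s₀ δ hδ => ⟨?_, ?_⟩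
  · filter_upwards [Ioo_mem_nhdsGT (show s₀ < s₀ + 1 / 2 by linarith)] with s hs
    exact ⟨0, by simpa using hδ, by rw [h2, h1]; exact key _ _ hs.1 hs.2⟩
  · filter_upwards [Ioo_mem_nhdsLT (show s₀ - 1 / 2 < s₀ by linarith)] with s hs
    exact ⟨0, by simpa using hδ, by rw [h2, h1]; exact key _ _ hs.2 (by linarith [hs.1])⟩

theorem isMeridian_fibre :
    IsMeridian o (Blowup.blowDown (φ := φ) (p := p)) (C.fibre (0 : ℝ)) :=
  ⟨C.fibre_injective _, C.range_fibre 0 (C.base_apply 0 0), C.crossesPositively_fibre⟩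

theorem hasBidegree_of_isMeridian {m : C(UnitAddCircle, BoundaryTorus φ p)}
    (hm : IsMeridian o (Blowup.blowDown (φ := φ) (p := p)) m) : HasBidegree C.H m 0 1 := by
  obtain ⟨hinj, hr, hpos⟩ := hm
  obtain ⟨x, u, h⟩ := C.straight_surjective (m 0)
  refine C.hasBidegree_of_range_eq (C.fibre_injective x) hinj ?_ (C.hasBidegree_fibre x) hpos
  rw [hr, C.range_fibre x (r := m 0)]
  rw [← h, C.base_straight]

theorem blowupFlow_straight (t x u : ℝ) : blowupFlow φ p t (.boundary (C.straight x u)) =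
    .boundary (C.straight (x + t / C.period) u) :=
  congrArg Blowup.boundary (C.rayFlow_straight t x u)

/-- The orbit lifts to a line v = v₀ that closes up after i > 0 periods. Floors exclude a
translation in the second coordinate, so v₀ is fixed by W_i, hence by W_1. The orbit then closes up
after a single period, and injectivity gives i = 1. The orbit may lie in any direction, so the lemma
also serves the parallels of the surgered flow. -/
theorem hasBidegree_of_isClosedOrbit {c : C(UnitAddCircle, BoundaryTorus φ p)}
    (h : IsClosedOrbit (blowupFlow φ p) c) : HasBidegree C.H c 1 0 := by
  obtain ⟨hinj, y, τ, hτ, hmono, hy⟩ := h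
  have hP := C.period_pos
  have hy' : ∃ x₀ v₀, y = .boundary (C.straight x₀ v₀) := by
    cases y with
    | interior x hx => exact absurd (hy 0) (by simp [blowupFlow])
    | boundary r =>
      obtain ⟨x, u, rfl⟩ := C.straight_surjective r
      exact ⟨x, u, rfl⟩
  obtain ⟨x₀, v₀, rfl⟩ := hy'
  let x : ℝ → ℝ := fun s => x₀ + τ s / C.period
  have hx : Continuous x := by fun_prop
  have hxm : StrictMono x := fun s t hst => by
    have := hmono hst
    simp only [x]
    gcongr
  have hcs : ∀ s : ℝ, c s = C.straight (x s) v₀ := fun s => by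
    have := (hy s).trans (C.blowupFlow_straight _ _ _)
    exact Blowup.boundary.inj this
  have hper : ∀ s : ℝ, C.straight (x s) v₀ = C.straight (x (s + 1)) v₀ := fun s => by
    rw [← hcs, ← hcs]
    congr 1
    exact (AddCircle.coe_add_period 1 s).symm
  obtain ⟨i, j, hi, hj⟩ := C.straight_eq_iff.1 (hper 0)
  have hi' : ∀ s, x (s + 1) = x s + i := fun s => by
    have := eq_of_forall_exists_int (f := fun s => x (s + 1) - x s) (by fun_prop) (fun s => by
      obtain ⟨i, j, hi, hj⟩ := C.straight_eq_iff.1 (hper s)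
      exact ⟨i, by rw [hi]; ring⟩) s 0
    linarith
  have hipos : 0 < i := by
    have := hxm (lt_add_one (0 : ℝ))
    rw [hi] at this
    have : (0 : ℝ) < i := by linarith
    exact_mod_cast this
  have hj0 : j = 0 := C.W.eq_zero_of_act_eq_add (s := 0) (t := -i) (u := v₀)
    (by rw [C.W.act_zero]; exact hj)
  have hW : C.W.act i v₀ = v₀ := by
    rw [hj0, Int.cast_zero, add_zero] at hj
    conv_lhs => rw [hj]
    exact C.W.act_act_neg _ _
  have hW1 : C.W.act 1 v₀ = v₀ := by
    refine C.W.act_one_of_act_nat (n := i.toNat) (by omega) ?_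
    have : ((i.toNat : ℕ) : ℝ) = (i : ℝ) := by
      exact_mod_cast congrArg (Int.cast (R := ℝ)) (Int.toNat_of_nonneg hipos.le)
    rw [this, hW]
  have hWm : C.W.act (-1) v₀ = v₀ := by
    conv_lhs => rw [← hW1]
    exact C.W.act_neg_act _ _
  have hi1 : i = 1 := by
    by_contra hne
    have h2 : (2 : ℝ) ≤ i := by exact_mod_cast (show 2 ≤ i by omega)
    have h1 := hi' 0
    rw [zero_add] at h1
    -- For i ≥ 2 the curve is back at its starting point when `x` has advanced by 1, at a parameter
    -- strictly between 0 and 1.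
    obtain ⟨s, hs, hs'⟩ := intermediate_value_Ioo (zero_le_one' ℝ) hx.continuousOn
      (show x 0 + 1 ∈ Ioo (x 0) (x 1) by constructor <;> linarith)
    have : c s = c (0 : ℝ) := by
      rw [hcs, hcs, hs', eq_comm, C.straight_eq_iff]
      exact ⟨1, 0, by simp, by simp [hWm]⟩
    obtain ⟨n, hn⟩ := coe_eq_coe_iff_exists.1 (hinj this)
    rw [zero_add] at hn
    rw [hn] at hs
    have h3 : (0 : ℤ) < n := by exact_mod_cast hs.1
    have h4 : n < (1 : ℤ) := by exact_mod_cast hs.2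
    omega
  rw [C.hasBidegree_iff]
  refine ⟨x, fun _ => v₀, hx, continuous_const, hcs, fun s => ?_, fun s => ?_⟩
  · rw [hi', hi1]
  · simp [hWm]

/-- The stable parallel. -/
def parallel : C(UnitAddCircle, BoundaryTorus φ p) :=
  (C.H : C(UnitAddCircle × UnitAddCircle, BoundaryTorus φ p)).comp
    ⟨fun s => (s, ((0 : ℝ) : UnitAddCircle)), by fun_prop⟩

theorem isParallel_parallel : IsParallel φ Es Eu p C.parallel := by
  refine ⟨⟨fun s t h => (Prod.mk.inj (C.H.injective h)).1, .boundary (C.straight 0 0),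
    fun s => s * C.period, by fun_prop, fun s t h => mul_lt_mul_of_pos_right h C.period_pos,
    fun s => ?_⟩, fun s => ?_⟩
  · rw [C.blowupFlow_straight, mul_div_cancel_right₀ _ C.period_pos.ne', straight, C.W.act_fix,
      zero_add]
    rfl
  · obtain ⟨x, rfl⟩ := QuotientAddGroup.mk_surjective s
    obtain ⟨v, hv, hs⟩ := C.stable x
    exact ⟨v, hv, Or.inl hs⟩

theorem isMultiplicity {c : C(UnitAddCircle, BoundaryTorus φ p)} {a b : ℤ}
    (h : HasBidegree C.H c a b) : IsMultiplicity Blowup.blowDown φ.toFlow c a := by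
  obtain ⟨ξ, η, hξ, hη, hc, ha, hb⟩ := h
  refine ⟨p, C.period, C.isMinimalPeriod, fun s => ξ s * C.period, by fun_prop, fun s => ?_,
    fun s => by simp only; rw [ha]; ring⟩
  simp only
  rw [hc]
  exact C.base_apply _ _

theorem isMultiplicity_iff {c : C(UnitAddCircle, BoundaryTorus φ p)} {a b : ℤ}
    (h : HasBidegree C.H c a b) (n : ℤ) :
    IsMultiplicity Blowup.blowDown φ.toFlow c n ↔ n = a :=
  ⟨fun h' => IsDegree.unique h' (C.isMultiplicity h), fun h' => h' ▸ C.isMultiplicity h⟩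

theorem hasCoordinates_iff {c : C(UnitAddCircle, BoundaryTorus φ p)} {a b : ℤ}
    (h : HasBidegree C.H c a b) (x y : ℤ) :
    HasCoordinates (IsParallel φ Es Eu p) (IsMeridian o (Blowup.blowDown (φ := φ) (p := p))) c x y
      ↔ x = a ∧ y = b := by
  constructor
  · rintro ⟨l, m, hl, hm, hc⟩
    have := (loopClass_eq_iff h (C.hasBidegree_of_isClosedOrbit hl.1)
      (C.hasBidegree_of_isMeridian hm) x y).1 hc
    omega
  · rintro ⟨rfl, rfl⟩
    refine ⟨C.parallel, C.fibre (0 : ℝ), C.isParallel_parallel, C.isMeridian_fibre, ?_⟩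
    exact (loopClass_eq_iff h (C.hasBidegree_of_isClosedOrbit
      (C.isParallel_parallel (Eu := Eu)).1) (C.hasBidegree_fibre 0) x y).2 (by simp)

theorem isLinkingNumber_iff {c : C(UnitAddCircle, BoundaryTorus φ p)} {a b : ℤ}
    (h : HasBidegree C.H c a b) (n : ℤ) :
    IsLinkingNumber o Blowup.blowDown φ.toFlow (IsParallel φ Es Eu p) c n ↔ n = b := by
  constructor
  · rintro ⟨m, -, h'⟩
    exact ((C.hasCoordinates_iff h m n).1 h').2
  · rintro rfl
    exact ⟨a, C.isMultiplicity h, (C.hasCoordinates_iff h a n).2 ⟨rfl, rfl⟩⟩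

end TorusChart

theorem surgeryProj_boundary_eq_iff {φ : SmoothFlow M} {p : M} {leaf : Setoid (BoundaryTorus φ p)}
    {r s : BoundaryTorus φ p} :
    surgeryProj leaf (.boundary r) = surgeryProj leaf (.boundary s) ↔ leaf r s := by
  rw [surgeryProj, Quotient.eq]
  constructor
  · rintro (h | ⟨r', s', h, h', hrs⟩)
    · rw [Blowup.boundary.inj h]
    · rwa [Blowup.boundary.inj h, Blowup.boundary.inj h']
  · exact fun h => Or.inr ⟨r, s, rfl, rfl, h⟩

namespace TorusChart

variable {o : ∀ x : M, Orientation ℝ (TangentSpace (𝓡 3) x) (Fin 3)}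
  {φ : SmoothFlow M} {Es Eu : ∀ x : M, Submodule ℝ (TangentSpace (𝓡 3) x)} {p : M}
  (C : TorusChart o φ Es p)

/-! ### Leaves of the surgery foliation as graphs -/

/-- The image of a graph over the second straightened coordinate under a deck transformation. -/
def shift (g : ℝ → ℝ) (n : ℤ) (v : ℝ) : ℝ := g (C.W.act n v) + n

theorem shift_zero (g : ℝ → ℝ) (v : ℝ) : C.shift g 0 v = g v := by
  simp [shift, C.W.act_zero]

/-- On the flow line of the stable direction the holonomy is invisible and the lifts are integer
translates of one another. Their order is read off there. -/
theorem shift_apply_zero (g : ℝ → ℝ) (n : ℤ) : C.shift g n 0 = g 0 + n := by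
  simp [shift, C.W.act_fix]

theorem continuous_shift {g : ℝ → ℝ} (hg : Continuous g) (n : ℤ) : Continuous (C.shift g n) :=
  (hg.comp (C.W.continuous_comp continuous_const continuous_id)).add continuous_const

/-- The leaf through `r` is the graph of `g` in the straightened universal cover. -/
structure IsLeafGraph (leaf : Setoid (BoundaryTorus φ p)) (k : ℤ) (r : BoundaryTorus φ p)
    (g : ℝ → ℝ) : Prop where
  continuous : Continuous g
  -- The deck transformation (k, 1), given by the class of the leaf, preserves the graph.
  equivariant : ∀ v, g (C.W.act (-k) v + 1) = g v + k
  leaf_iff : ∀ x v, leaf (C.straight x v) r ↔ ∃ n : ℤ, x = C.shift g n v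
  eq_zero : ∀ (n : ℤ) (v : ℝ), C.shift g n v = g v → n = 0

/-- The parametrization of class k[λ] + [μ] winds once positively in the second direction, which
excludes that its reverse crosses the flow positively. -/
theorem exists_leaf_curve {k : ℤ} {leaf : Setoid (BoundaryTorus φ p)}
    (hleaf : IsSurgeryFoliation o φ Es Eu p k leaf) (r : BoundaryTorus φ p) :
    ∃ c : C(UnitAddCircle, BoundaryTorus φ p), Function.Injective c ∧
      range c = {r' | leaf r' r} ∧ CrossesPositively o c ∧ HasBidegree C.H c k 1 := by
  obtain ⟨c, hinj, hr, hpos, hcoord⟩ := hleaf.leaf_curve r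
  obtain ⟨a, b, hab⟩ := exists_hasBidegree C.H c
  obtain ⟨rfl, rfl⟩ := (C.hasCoordinates_iff hab k 1).1 hcoord
  refine ⟨c, hinj, hr, hpos.resolve_right fun h => ?_, hab⟩
  have := C.reverseCurve_crossesPositively_nonpos hab h
  omega

-- The floor of `v` grows by one with every turn, so `v` is unbounded in both directions.
variable {C} in
theorem IsStraightLift.surjective {c : C(UnitAddCircle, BoundaryTorus φ p)} {a : ℤ}
    {x v : ℝ → ℝ} (h : C.IsStraightLift c a 1 x v) : Function.Surjective v := by
  obtain ⟨hx, hv, hc, ha, hb⟩ := h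
  have hfl : ∀ n : ℤ, ⌊v n⌋ = ⌊v 0⌋ + n := by
    have h1 : ∀ s, ⌊v (s + 1)⌋ = ⌊v s⌋ + 1 := fun s => by
      rw [hb, Int.floor_add_intCast, C.W.floor_act]
    intro n
    induction n with
    | zero => simp
    | succ n ih => push_cast at ih ⊢; rw [h1, ih]; ring
    | pred n ih =>
      have := h1 (-n - 1)
      rw [sub_add_cancel] at this
      push_cast at ih ⊢
      linarith
  intro y
  have h1 := hfl (⌊y⌋ - ⌊v 0⌋ - 1)
  have h2 := hfl (⌊y⌋ - ⌊v 0⌋ + 1)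
  have hy1 : v ((⌊y⌋ - ⌊v 0⌋ - 1 : ℤ) : ℝ) ≤ y := by
    refine (lt_of_not_ge fun h => ?_).le
    have := Int.floor_mono h
    omega
  have hy2 : y ≤ v ((⌊y⌋ - ⌊v 0⌋ + 1 : ℤ) : ℝ) := by
    refine (lt_of_not_ge fun h => ?_).le
    have := Int.floor_mono h
    omega
  obtain ⟨s, -, hs⟩ := isPreconnected_univ.intermediate_value (mem_univ _) (mem_univ _)
    hv.continuousOn ⟨hy1, hy2⟩
  exact ⟨s, hs⟩

/-- Along the lifted leaf `v` is an increasing bijection of the line, so it can serve as parameter,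
with g = x ∘ v⁻¹. -/
theorem exists_isLeafGraph {k : ℤ} {leaf : Setoid (BoundaryTorus φ p)}
    (hleaf : IsSurgeryFoliation o φ Es Eu p k leaf) (r : BoundaryTorus φ p) :
    ∃ g, C.IsLeafGraph leaf k r g := by
  obtain ⟨c, hinj, hr, hpos, hdeg⟩ := C.exists_leaf_curve hleaf r
  obtain ⟨x, v, hl⟩ := C.hasBidegree_iff.1 hdeg
  have hmono := hl.strictMono hpos
  let e : ℝ ≃o ℝ := hmono.orderIsoOfSurjective v hl.surjective
  have he : ∀ s, e s = v s := fun s => rfl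
  obtain ⟨hx, hv, hc, ha, hb⟩ := hl
  have hsymm : ∀ w, v (e.symm w) = w := fun w => e.apply_symm_apply w
  have hsymm_succ : ∀ w, e.symm (C.W.act (-k) w + 1) = e.symm w + 1 := fun w => by
    rw [e.symm_apply_eq, he, hb, hsymm]
    simp
  have hcg : ∀ w, c (e.symm w : ℝ) = C.straight (x (e.symm w)) w := fun w => by
    rw [hc, hsymm]
  refine ⟨fun w => x (e.symm w), hx.comp e.symm.continuous, fun w => ?_, fun y w => ?_,
    fun n w h => ?_⟩
  · rw [hsymm_succ, ha]
  · have h1 : leaf (C.straight y w) r ↔ C.straight y w ∈ range c := by rw [hr]; rfl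
    rw [h1]
    constructor
    · rintro ⟨s, hs⟩
      obtain ⟨s, rfl⟩ := QuotientAddGroup.mk_surjective s
      obtain ⟨i, j, hi, hj⟩ := C.straight_eq_iff.1 ((hc s).symm.trans hs)
      have hxs : x (s + j) = x s + j * k := map_add_int_mul ha s j
      have hvs : ∀ (j : ℤ) (s : ℝ), v (s + j) = C.W.act (-(j * k)) (v s) + j := by
        intro j
        induction j with
        | zero => simp [C.W.act_zero]
        | succ j ih =>
          intro s
          push_cast at ih ⊢
          rw [← add_assoc, hb, ih, Int.cast_one, ← Int.cast_natCast, C.W.act_add_int,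
            ← C.W.act_add, add_assoc]
          congr 2
          ring
        | pred j ih =>
          intro s
          have h1 := ih (s - 1)
          have h2 := hb (s - 1)
          rw [sub_add_cancel] at h2
          push_cast at h1 h2 ⊢
          rw [show s + (-(j : ℝ) - 1) = s - 1 + -j by ring, h1, h2,
            show (1 : ℝ) = ((1 : ℤ) : ℝ) by simp, C.W.act_add_int, ← C.W.act_add]
          push_cast
          rw [show -((-(j : ℝ) - 1) * k) + -(k : ℝ) = -(-(j : ℝ) * k) by ring]
          ring
      -- The deck transformation (i, j) consists of j turns along the leaf, which contribute (jk,
      -- j), and of i - jk further periods of the base; the latter number is the index of the lift.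
      have hew : C.W.act ((i - j * k : ℤ) : ℝ) w = v (s + j) := by
        rw [hj, C.W.act_add_int, ← C.W.act_add, hvs]
        congr 2
        push_cast
        ring
      refine ⟨i - j * k, ?_⟩
      rw [shift, hew, ← he, e.symm_apply_apply, hxs, hi]
      push_cast
      ring
    · rintro ⟨n, rfl⟩
      refine ⟨(e.symm (C.W.act n w) : ℝ), ?_⟩
      rw [hcg, C.straight_eq_iff]
      exact ⟨n, 0, rfl, by rw [C.W.act_neg_act]; simp⟩
  · have h1 : c (e.symm (C.W.act n w) : ℝ) = c (e.symm w : ℝ) := by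
      rw [hcg, hcg, C.straight_eq_iff]
      exact ⟨n, 0, h.symm, by rw [C.W.act_neg_act]; simp⟩
    -- The leaf is embedded, so the two parameters differ by an integer j. Each turn raises the
    -- floor of `v` by one while `W` preserves it, so j = 0.
    obtain ⟨j, hj⟩ := coe_eq_coe_iff_exists.1 (hinj h1)
    have h2 : x (e.symm (C.W.act n w)) = x (e.symm w) + j * k := by
      rw [hj]; exact map_add_int_mul ha _ j
    have h3 : ⌊v (e.symm w + j)⌋ = ⌊v (e.symm w)⌋ := by
      rw [← hj, hsymm, hsymm, C.W.floor_act]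
    have h4 : ∀ (s : ℝ) (j : ℤ), ⌊v (s + j)⌋ = ⌊v s⌋ + j := by
      intro s j
      have h1 : ∀ s, ⌊v (s + 1)⌋ = ⌊v s⌋ + 1 := fun s => by
        rw [hb, Int.floor_add_intCast, C.W.floor_act]
      induction j with
      | zero => simp
      | succ n ih => push_cast at ih ⊢; rw [← add_assoc, h1, ih]; ring
      | pred n ih =>
        have := h1 (s + (-n - 1))
        rw [show s + (-(n : ℝ) - 1) + 1 = s + -n by ring] at this
        push_cast at ih ⊢
        linarith
    have hj0 : j = 0 := by
      rw [h4] at h3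
      omega
    rw [hj0] at h2
    have h5 : C.shift (fun w => x (e.symm w)) n w = x (e.symm w) + n := by
      rw [shift, h2]; simp
    have h6 := h5.symm.trans h
    simpa using h6

namespace IsLeafGraph

variable {C} {leaf : Setoid (BoundaryTorus φ p)} {k : ℤ} {r r' : BoundaryTorus φ p} {g g' : ℝ → ℝ}

theorem shift_ne (hg : C.IsLeafGraph leaf k r g) {m n : ℤ} (hmn : m ≠ n) (v : ℝ) :
    C.shift g m v ≠ C.shift g n v := by
  intro h
  have : n - m = 0 := hg.eq_zero (n - m) (C.W.act m v) (by
    rw [shift, ← C.W.act_add]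
    push_cast
    rw [sub_add_cancel]
    simp only [shift] at h
    linarith)
  omega

/-- Disjoint graphs of continuous functions keep their order, which is known at v = 0. -/
theorem strictMono_shift (hg : C.IsLeafGraph leaf k r g) (v : ℝ) :
    StrictMono fun n => C.shift g n v := fun m n hmn =>
  lt_of_forall_ne (C.continuous_shift hg.continuous m) (C.continuous_shift hg.continuous n)
    (hg.shift_ne hmn.ne) (a := 0) (by
      rw [C.shift_apply_zero, C.shift_apply_zero]
      have : (m : ℝ) < n := by exact_mod_cast hmn
      linarith) v

theorem shift_ne_shift (hg : C.IsLeafGraph leaf k r g) (hg' : C.IsLeafGraph leaf k r' g')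
    (h : ¬ leaf r r') (m n : ℤ) (v : ℝ) : C.shift g m v ≠ C.shift g' n v := fun heq =>
  h (leaf.trans (leaf.symm ((hg.leaf_iff _ _).2 ⟨m, rfl⟩)) ((hg'.leaf_iff _ v).2 ⟨n, heq⟩))

theorem shift_lt_shift (hg : C.IsLeafGraph leaf k r g) (hg' : C.IsLeafGraph leaf k r' g')
    (h : ¬ leaf r r') {m n : ℤ} (h0 : C.shift g m 0 < C.shift g' n 0) (v : ℝ) :
    C.shift g m v < C.shift g' n v :=
  lt_of_forall_ne (C.continuous_shift hg.continuous m) (C.continuous_shift hg'.continuous n)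
    (hg.shift_ne_shift hg' h m n) h0 v

theorem apply_add_int (hg : C.IsLeafGraph leaf k r g) (j : ℤ) (w : ℝ) :
    g (w + j) = g (C.W.act ((k * j : ℤ) : ℝ) w) + ((k * j : ℤ) : ℝ) := by
  have h1 : ∀ w, g (w + 1) = g (C.W.act k w) + k := fun w => by
    rw [← hg.equivariant, C.W.act_neg_act]
  induction j generalizing w with
  | zero => simp [C.W.act_zero]
  | succ j ih =>
    have h2 := ih (C.W.act k w)
    push_cast at h2 ⊢
    rw [← add_assoc, h1, ← Int.cast_natCast, C.W.act_add_int, Int.cast_natCast, h2, ← C.W.act_add,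
      mul_add, mul_one, add_assoc]
  | pred j ih =>
    have h2 := ih (C.W.act (-k) w)
    have h3 := h1 (w - j - 1)
    have e : C.W.act k (w - j - 1) = C.W.act k w + (((-j - 1 : ℤ)) : ℝ) := by
      rw [← C.W.act_add_int]
      push_cast
      congr 1
      ring
    have h4 := h1 (C.W.act (-k) w + (((-j - 1 : ℤ)) : ℝ))
    rw [C.W.act_add_int, C.W.act_act_neg] at h4
    push_cast at h2 h4 ⊢
    rw [show C.W.act (-k) w + (-(j : ℝ) - 1) + 1 = C.W.act (-k) w + -j by ring, h2,
      ← C.W.act_add] at h4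
    rw [show (k : ℝ) * (-j - 1) = k * -j + -k by ring]
    linarith

/-- The source of a − kb: the deck transformation (a, b) is the b-th power of (k, 1), which
preserves every lift, combined with a − kb periods of the base, each raising the index by one. -/
theorem shift_apply_deck (hg : C.IsLeafGraph leaf k r g) (n a b : ℤ) (v : ℝ) :
    C.shift g (n + (a - k * b)) (C.W.act (-a) v + b) = C.shift g n v + a := by
  rw [shift, C.W.act_add_int, ← C.W.act_add, hg.apply_add_int, ← C.W.act_add, shift]
  push_cast
  rw [show (k : ℝ) * b + (n + (a - k * b) + -a) = n by ring]
  ring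

end IsLeafGraph

/-! ### The surgered flow on the collapsed torus -/

/-- The parametrization is obtained for each flow line separately; its continuity across flow lines
is proved in `surgery_isMultiplicity`. -/
theorem exists_orbit_parametrization {leaf : Setoid (BoundaryTorus φ p)}
    {Ψ : Flow ℝ (Blowup φ p)} {φ' : Flow ℝ (Surgered leaf)} (h : IsSurgeryFlow leaf Ψ φ')
    (x v : ℝ) : ∃ X : ℝ ≃o ℝ, X 0 = x ∧
      ∀ t, Ψ t (.boundary (C.straight x v)) = .boundary (C.straight (X t) v) := by
  obtain ⟨τ, hτ0, hτ⟩ := h.reparametrization (.boundary (C.straight x v))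
  refine ⟨(τ.symm.trans (OrderIso.mulRight₀ C.period⁻¹ (inv_pos.2 C.period_pos))).trans
    (OrderIso.addLeft x), ?_, fun t => ?_⟩
  · have : τ.symm 0 = 0 := by rw [τ.symm_apply_eq, hτ0]
    simp [this]
  · have := hτ (τ.symm t)
    rw [τ.apply_symm_apply, C.blowupFlow_straight] at this
    rw [this]
    simp [div_eq_mul_inv]

/-- Starting all flow lines at time 0 on one lift `g` of a leaf makes them project to the same
motion of the point `p'`. The time at which a point is reached is then a function on the cover equal
to n periods on the n-th lift, and its increment along `c` is read off from the lifts. -/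
theorem surgery_isMultiplicity {k : ℤ} {leaf : Setoid (BoundaryTorus φ p)}
    (hleaf : IsSurgeryFoliation o φ Es Eu p k leaf)
    {Ψ : Flow ℝ (Blowup φ p)} {φ' : Flow ℝ (Surgered leaf)} (h : IsSurgeryFlow leaf Ψ φ')
    {c : C(UnitAddCircle, BoundaryTorus φ p)} {a b : ℤ} (hc : HasBidegree C.H c a b) :
    IsMultiplicity (surgeryProj leaf) φ' c (a - k * b) := by
  let r₀ := C.straight 0 0
  obtain ⟨g, hg⟩ := C.exists_isLeafGraph hleaf r₀
  choose X hX0 hX using fun v => C.exists_orbit_parametrization h (g v) v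
  let p' : Surgered leaf := surgeryProj leaf (.boundary r₀)
  have hstart : ∀ v, surgeryProj leaf (.boundary (C.straight (g v) v)) = p' := fun v =>
    surgeryProj_boundary_eq_iff.2 ((hg.leaf_iff _ _).2 ⟨0, (C.shift_zero g v).symm⟩)
  have hflow : ∀ t v, φ' t p' = surgeryProj leaf (.boundary (C.straight (X v t) v)) := fun t v => by
    rw [← hX, h.semiconj, hstart]
  have hret : ∀ t v, φ' t p' = p' ↔ ∃ n : ℤ, X v t = C.shift g n v := fun t v => by
    rw [hflow t v, surgeryProj_boundary_eq_iff, hg.leaf_iff]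
  -- On the flow line v = 0 the lifts sit at `g 0 + n`, so the first return to the leaf is at `g 0 +
  -- 1`.
  let P' := (X 0).symm (g 0 + 1)
  have hXP : X 0 P' = g 0 + 1 := (X 0).apply_symm_apply _
  have hP' : IsMinimalPeriod φ' p' P' := by
    refine ⟨?_, ?_, ?_⟩
    · rw [← (X 0).lt_iff_lt, hX0, hXP]
      linarith
    · rw [hret P' 0, hXP]
      exact ⟨1, by rw [C.shift_apply_zero]; simp⟩
    · intro t h0 h1 ht
      obtain ⟨n, hn⟩ := (hret t 0).1 ht
      rw [C.shift_apply_zero] at hn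
      rw [← (X 0).lt_iff_lt, hX0, hn] at h0
      rw [← (X 0).lt_iff_lt, hXP, hn] at h1
      have h2 : (0 : ℝ) < n := by linarith
      have h3 : (n : ℝ) < 1 := by linarith
      have h2' : (0 : ℤ) < n := by exact_mod_cast h2
      have h3' : n < (1 : ℤ) := by exact_mod_cast h3
      omega
  have hXn : ∀ (n : ℤ) v, X v (n * P') = C.shift g n v := by
    intro n v
    -- Returns happen exactly at multiples of `P'`, and a flow line meets every lift in order. So
    -- the index `e` is an increasing bijection of ℤ fixing 0.
    choose e he using fun n : ℤ => (hret _ v).1 (hP'.map_int_mul n)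
    have hmono : StrictMono e := fun m n hmn => by
      rw [← (hg.strictMono_shift v).lt_iff_lt]
      simp only [← he]
      apply (X v).strictMono
      have : (m : ℝ) < n := by exact_mod_cast hmn
      exact mul_lt_mul_of_pos_right this hP'.1
    have hsurj : Function.Surjective e := fun m => by
      have h1 : φ' ((X v).symm (C.shift g m v)) p' = p' :=
        (hret _ v).2 ⟨m, (X v).apply_symm_apply _⟩
      obtain ⟨n, hn⟩ := hP'.apply_eq_self_iff.1 h1
      refine ⟨n, (hg.strictMono_shift v).injective ?_⟩
      rw [← he, ← hn, (X v).apply_symm_apply]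
    have h0 : e 0 = 0 := (hg.strictMono_shift v).injective (by
      rw [← he, C.shift_zero]
      simp [hX0])
    rw [he, int_eq_self_of_strictMono hmono hsurj h0]
  -- At time `t` all flow lines lie on lifts of one leaf. Off the starting leaf they lie strictly
  -- between lifts n and n + 1 of `g`, where only one lift of the other leaf fits. Its index is
  -- therefore constant in `v`, and the lift is a continuous graph.
  have hcont : ∀ t, Continuous fun v => X v t := by
    intro t
    by_cases ht : ∃ n : ℤ, t = n * P'
    · obtain ⟨n, rfl⟩ := ht
      simp only [hXn]
      exact C.continuous_shift hg.continuous n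
    · obtain ⟨g₁, hg₁⟩ := C.exists_isLeafGraph hleaf (C.straight (X 0 t) 0)
      have hne : ¬ leaf (C.straight (X 0 t) 0) r₀ := fun hl =>
        ht (hP'.apply_eq_self_iff.1 (by
          rw [hflow t 0]; exact surgeryProj_boundary_eq_iff.2 hl))
      have hne' : ¬ leaf r₀ (C.straight (X 0 t) 0) := fun hl => hne (leaf.symm hl)
      have hmem : ∀ v, ∃ m : ℤ, X v t = C.shift g₁ m v := fun v =>
        (hg₁.leaf_iff _ _).1 (surgeryProj_boundary_eq_iff.1 ((hflow t v).symm.trans (hflow t 0)))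
      obtain ⟨m, hm⟩ := hmem 0
      let n := ⌊t / P'⌋
      have hn1 : n * P' < t := by
        have := Int.floor_le (t / P')
        rw [le_div_iff₀ hP'.1] at this
        exact lt_of_le_of_ne this fun h' => ht ⟨n, h'.symm⟩
      have hn2 : t < ((n + 1 : ℤ) : ℝ) * P' := by
        have := Int.lt_floor_add_one (t / P')
        rw [div_lt_iff₀ hP'.1] at this
        push_cast
        exact this
      have hb1 : ∀ v, C.shift g n v < X v t := fun v => by
        rw [← hXn]; exact (X v).strictMono hn1
      have hb2 : ∀ v, X v t < C.shift g (n + 1) v := fun v => by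
        rw [← hXn]; exact (X v).strictMono hn2
      have hup : ∀ v, C.shift g (n + 1) v < C.shift g₁ (m + 1) v := by
        refine hg.shift_lt_shift hg₁ hne' ?_
        have := hb1 0
        rw [hm] at this
        simp only [C.shift_apply_zero] at this ⊢
        push_cast
        linarith
      have hlow : ∀ v, C.shift g₁ (m - 1) v < C.shift g n v := by
        refine hg₁.shift_lt_shift hg hne ?_
        have := hb2 0
        rw [hm] at this
        simp only [C.shift_apply_zero] at this ⊢
        push_cast at this ⊢
        linarith
      have heq : ∀ v, X v t = C.shift g₁ m v := fun v => by
        obtain ⟨m', hm'⟩ := hmem v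
        have h1 : m' < m + 1 := (hg₁.strictMono_shift v).lt_iff_lt.1 (by
          rw [← hm']; exact (hb2 v).trans (hup v))
        have h2 : m - 1 < m' := (hg₁.strictMono_shift v).lt_iff_lt.1 (by
          rw [← hm']; exact (hlow v).trans (hb1 v))
        rw [hm', show m' = m by omega]
      simp only [heq]
      exact C.continuous_shift hg₁.continuous m
  obtain ⟨x, v, hx, hv, hcs, ha, hb⟩ := C.hasBidegree_iff.1 hc
  -- The time needed from `g` to the lifted curve point along its flow line.
  let θ : ℝ → ℝ := fun s => (X (v s)).symm (x s)
  have hθX : ∀ s, X (v s) (θ s) = x s := fun s => (X (v s)).apply_symm_apply _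
  have hθ : ∀ s : ℝ, surgeryProj leaf (.boundary (c s)) = φ' (θ s) p' := fun s => by
    rw [hflow _ (v s), hθX, hcs]
  refine ⟨p', P', hP', θ, continuous_of_orderIso (fun s => X (v s))
    (fun t => (hcont t).comp hv) hx, hθ, fun s => ?_⟩
  have h1 : φ' (θ (s + 1)) p' = φ' (θ s) p' := by
    rw [← hθ, ← hθ]
    congr 3
    exact AddCircle.coe_add_period 1 s
  obtain ⟨n, hn⟩ := hP'.apply_eq_apply_iff.1 h1
  let N := ⌊θ s / P'⌋
  have hlevel : ∀ (N : ℤ) s, N * P' ≤ θ s ↔ C.shift g N (v s) ≤ x s := fun N s => by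
    rw [← hXn, ← hθX s, (X (v s)).le_iff_le]
  have hN1 : N * P' ≤ θ s := by
    have := Int.floor_le (θ s / P')
    rwa [le_div_iff₀ hP'.1] at this
  have hN2 : θ s < ((N + 1 : ℤ) : ℝ) * P' := by
    have := Int.lt_floor_add_one (θ s / P')
    rw [div_lt_iff₀ hP'.1] at this
    push_cast
    exact this
  -- One turn applies the deck transformation (a, b), which carries the strip between lifts N and N
  -- + 1 to the strip a − kb further on. This determines the integer `n`.
  have hN3 : ((N + (a - k * b) : ℤ) : ℝ) * P' ≤ θ (s + 1) := by
    rw [hlevel, hb, hg.shift_apply_deck, ha]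
    have := (hlevel N s).1 hN1
    linarith
  have hN4 : θ (s + 1) < ((N + 1 + (a - k * b) : ℤ) : ℝ) * P' := by
    rw [← not_le] at hN2 ⊢
    rw [hlevel] at hN2 ⊢
    rw [hb, hg.shift_apply_deck, ha]
    rw [not_le] at hN2 ⊢
    linarith
  have hpos := hP'.1
  have h2 : n = a - k * b := by
    rw [hn] at hN3 hN4
    have e1 : ((a - k * b : ℤ) : ℝ) - 1 < n := by
      rw [← mul_lt_mul_iff_left₀ hpos]
      push_cast at *
      linarith
    have e2 : (n : ℝ) < ((a - k * b : ℤ) : ℝ) + 1 := by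
      rw [← mul_lt_mul_iff_left₀ hpos]
      push_cast at *
      linarith
    have e1' : a - k * b - 1 < n := by exact_mod_cast e1
    have e2' : n < a - k * b + 1 := by exact_mod_cast e2
    omega
  rw [hn, h2]

theorem surgery_isMultiplicity_iff {k : ℤ} {leaf : Setoid (BoundaryTorus φ p)}
    (hleaf : IsSurgeryFoliation o φ Es Eu p k leaf)
    {Ψ : Flow ℝ (Blowup φ p)} {φ' : Flow ℝ (Surgered leaf)} (h : IsSurgeryFlow leaf Ψ φ')
    {c : C(UnitAddCircle, BoundaryTorus φ p)} {a b : ℤ} (hc : HasBidegree C.H c a b) (n : ℤ) :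
    IsMultiplicity (surgeryProj leaf) φ' c n ↔ n = a - k * b :=
  ⟨fun h' => IsDegree.unique h' (C.surgery_isMultiplicity hleaf h hc),
    fun h' => h' ▸ C.surgery_isMultiplicity hleaf h hc⟩

theorem surgery_range_eq {leaf : Setoid (BoundaryTorus φ p)} {r r' : BoundaryTorus φ p}
    (h : leaf r' r) : {s | surgeryProj leaf (.boundary s) = surgeryProj leaf (.boundary r')} =
      {s | leaf s r} := by
  ext s
  simp only [mem_ofPred_eq, surgeryProj_boundary_eq_iff]
  exact ⟨fun h' => leaf.trans h' h, fun h' => leaf.trans h' (leaf.symm h)⟩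

theorem exists_surgery_isMeridian {k : ℤ} {leaf : Setoid (BoundaryTorus φ p)}
    (hleaf : IsSurgeryFoliation o φ Es Eu p k leaf) :
    ∃ m, IsMeridian o (surgeryProj leaf) m ∧ HasBidegree C.H m k 1 := by
  obtain ⟨c, hinj, hr, hpos, hdeg⟩ := C.exists_leaf_curve hleaf (C.straight 0 0)
  have h0 : c 0 ∈ range c := mem_range_self _
  refine ⟨c, ⟨hinj, ?_, hpos⟩, hdeg⟩
  rw [hr] at h0 ⊢
  exact (surgery_range_eq h0).symm

theorem hasBidegree_of_surgery_isMeridian {k : ℤ} {leaf : Setoid (BoundaryTorus φ p)}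
    (hleaf : IsSurgeryFoliation o φ Es Eu p k leaf) {m : C(UnitAddCircle, BoundaryTorus φ p)}
    (hm : IsMeridian o (surgeryProj leaf) m) : HasBidegree C.H m k 1 := by
  obtain ⟨c, hinj, hr, hpos, hdeg⟩ := C.exists_leaf_curve hleaf (m 0)
  refine C.hasBidegree_of_range_eq hinj hm.1 ?_ hdeg hm.2.2
  rw [hr, hm.2.1, surgery_range_eq (leaf.refl (m 0))]

/-- Parallels have bidegree (1, 0) and the new meridians (k, 1), and (a, b) = (a − kb)(1, 0) + b(k,
1). -/
theorem surgery_isLinkingNumber_iff {k : ℤ} {leaf : Setoid (BoundaryTorus φ p)}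
    (hleaf : IsSurgeryFoliation o φ Es Eu p k leaf)
    {Ψ : Flow ℝ (Blowup φ p)} {φ' : Flow ℝ (Surgered leaf)} (h : IsSurgeryFlow leaf Ψ φ')
    {c : C(UnitAddCircle, BoundaryTorus φ p)} {a b : ℤ} (hc : HasBidegree C.H c a b) (n : ℤ) :
    IsLinkingNumber o (surgeryProj leaf) φ' (IsClosedOrbit Ψ) c n ↔ n = b := by
  have horb := isClosedOrbit_iff_of_reparametrization h.reparametrization
  constructor
  · rintro ⟨m, -, l, μ, hl, hμ, hcl⟩
    have := (loopClass_eq_iff hc (C.hasBidegree_of_isClosedOrbit ((horb l).1 hl))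
      (C.hasBidegree_of_surgery_isMeridian hleaf hμ) m n).1 hcl
    omega
  · rintro rfl
    obtain ⟨μ, hμ, hdeg⟩ := C.exists_surgery_isMeridian hleaf
    have hpar := (C.isParallel_parallel (Eu := Eu)).1
    refine ⟨a - k * n, C.surgery_isMultiplicity hleaf h hc, C.parallel, μ, (horb _).2 hpar, hμ,
      (loopClass_eq_iff hc (C.hasBidegree_of_isClosedOrbit hpar) hdeg _ _).2 ?_⟩
    constructor <;> ring

end TorusChart

end Manifold

/-! ### The action of diagonal matrices on directions of the plane -/

/-- Two angles whose directions are positive multiples of the same vector differ by an integer. -/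
theorem exists_int_of_direction_eq {u v x y a b : ℝ} (ha : 0 < a) (hb : 0 < b)
    (h1 : Real.cos (2 * Real.pi * u) = a * x) (h2 : Real.sin (2 * Real.pi * u) = a * y)
    (h3 : Real.cos (2 * Real.pi * v) = b * x) (h4 : Real.sin (2 * Real.pi * v) = b * y) :
    ∃ n : ℤ, u = v + n := by
  have e1 := Real.sin_sq_add_cos_sq (2 * Real.pi * u)
  have e2 := Real.sin_sq_add_cos_sq (2 * Real.pi * v)
  rw [h1, h2] at e1
  rw [h3, h4] at e2
  have hpos : 0 < y ^ 2 + x ^ 2 := by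
    by_contra hle
    have : y ^ 2 + x ^ 2 = 0 := le_antisymm (not_lt.1 hle) (by positivity)
    have : a ^ 2 * (y ^ 2 + x ^ 2) = 1 := by linarith
    simp_all
  have hab : a = b := by
    have : a ^ 2 = b ^ 2 := mul_right_cancel₀ hpos.ne' (by linarith)
    exact (pow_left_inj₀ ha.le hb.le two_ne_zero).1 this
  subst hab
  obtain ⟨n, hn⟩ := Real.Angle.angle_eq_iff_two_pi_dvd_sub.1
    (Real.Angle.cos_sin_inj (h1.trans h3.symm) (h2.trans h4.symm))
  refine ⟨n, ?_⟩
  have hpi := Real.pi_pos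
  have : 2 * Real.pi * (u - (v + n)) = 0 := by linarith
  have := (mul_eq_zero.1 this).resolve_left (by positivity)
  linarith

/-- The quotient of the image of a direction under `diag (1, r)` by the direction. -/
def turnNumber (r u : ℝ) : ℂ :=
  ⟨Real.cos (2 * Real.pi * u) ^ 2 + r * Real.sin (2 * Real.pi * u) ^ 2,
    (r - 1) * (Real.sin (2 * Real.pi * u) * Real.cos (2 * Real.pi * u))⟩

/-- A direction is turned by less than a right angle, so the principal argument is continuous here
and gives a canonical lift. -/
theorem turnNumber_re_pos {r : ℝ} (hr : 0 < r) (u : ℝ) : 0 < (turnNumber r u).re := by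
  have h := Real.sin_sq_add_cos_sq (2 * Real.pi * u)
  change 0 < Real.cos (2 * Real.pi * u) ^ 2 + r * Real.sin (2 * Real.pi * u) ^ 2
  rcases eq_or_ne (Real.cos (2 * Real.pi * u)) 0 with h0 | h0
  · rw [h0] at h ⊢
    have : Real.sin (2 * Real.pi * u) ^ 2 = 1 := by linarith
    rw [this]
    linarith
  · positivity

theorem turnNumber_ne_zero {r : ℝ} (hr : 0 < r) (u : ℝ) : turnNumber r u ≠ 0 := fun h => by
  have := turnNumber_re_pos hr u
  rw [h, Complex.zero_re] at this
  exact lt_irrefl _ this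

/-- The lift to the line of the action of `diag (1, r)` on directions of the plane. -/
def turn (r u : ℝ) : ℝ := u + (turnNumber r u).arg / (2 * Real.pi)

theorem turn_direction {r : ℝ} (hr : 0 < r) (u : ℝ) : ∃ a : ℝ, 0 < a ∧
    Real.cos (2 * Real.pi * turn r u) = a * Real.cos (2 * Real.pi * u) ∧
    Real.sin (2 * Real.pi * turn r u) = a * (r * Real.sin (2 * Real.pi * u)) := by
  have hz := turnNumber_ne_zero hr u
  have h := Real.sin_sq_add_cos_sq (2 * Real.pi * u)
  have hpi := Real.pi_pos
  have hn : 0 < ‖turnNumber r u‖ := norm_pos_iff.2 hz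
  have e : 2 * Real.pi * turn r u = 2 * Real.pi * u + (turnNumber r u).arg := by
    rw [turn]; field_simp
  refine ⟨‖turnNumber r u‖⁻¹, inv_pos.2 hn, ?_, ?_⟩
  · rw [e, Real.cos_add, Complex.cos_arg hz, Complex.sin_arg, inv_mul_eq_div, ← mul_div_assoc,
      ← mul_div_assoc, ← sub_div]
    congr 1
    simp only [turnNumber]
    linear_combination Real.cos (2 * Real.pi * u) * h
  · rw [e, Real.sin_add, Complex.cos_arg hz, Complex.sin_arg, inv_mul_eq_div, ← mul_div_assoc,
      ← mul_div_assoc, ← add_div]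
    congr 1
    simp only [turnNumber]
    linear_combination r * Real.sin (2 * Real.pi * u) * h

theorem continuous_turn {A : Type*} [TopologicalSpace A] {r u : A → ℝ} (hr : Continuous r)
    (hpos : ∀ a, 0 < r a) (hu : Continuous u) : Continuous fun a => turn (r a) (u a) := by
  have h1 : Continuous fun a => turnNumber (r a) (u a) := by
    have : (fun a => turnNumber (r a) (u a)) = fun a =>
        (((turnNumber (r a) (u a)).re : ℝ) : ℂ) + ((turnNumber (r a) (u a)).im : ℝ) * Complex.I := by
      funext a
      exact (Complex.re_add_im _).symm
    rw [this]
    simp only [turnNumber]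
    fun_prop
  have h2 : Continuous fun a => (turnNumber (r a) (u a)).arg := continuous_iff_continuousAt.2
    fun a => ContinuousAt.comp (f := fun a => turnNumber (r a) (u a))
      (Complex.continuousAt_arg (Or.inl (turnNumber_re_pos (hpos a) (u a)))) h1.continuousAt
  exact hu.add (h2.div_const _)

theorem turn_one (u : ℝ) : turn 1 u = u := by
  have : turnNumber 1 u = 1 := by
    apply Complex.ext <;> simp [turnNumber]
  simp [turn, this]

theorem turn_zero (r : ℝ) : turn r 0 = 0 := by
  have : turnNumber r 0 = 1 := by
    apply Complex.ext <;> simp [turnNumber]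
  simp [turn, this]

theorem turn_add_one (r u : ℝ) : turn r (u + 1) = turn r u + 1 := by
  have : turnNumber r (u + 1) = turnNumber r u := by
    simp only [turnNumber, mul_add, mul_one, Real.cos_add_two_pi, Real.sin_add_two_pi]
  rw [turn, this, turn]
  ring

/-- The one-parameter group of circle homeomorphisms given by `diag (1, r ^ t)`. -/
def diagonalFlow (r : ℝ) (hr : 0 < r) : CircleFlow where
  act t u := turn (r ^ t) u
  continuous_act := continuous_turn (continuous_const.rpow continuous_fst fun _ => Or.inl hr.ne')
    (fun _ => Real.rpow_pos_of_pos hr _) continuous_snd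
  act_zero u := by rw [Real.rpow_zero, turn_one]
  act_add s t u := by
    have hc : ∀ {f g : ℝ × ℝ × ℝ → ℝ}, Continuous f → Continuous g →
        Continuous fun z => turn (r ^ f z) (g z) := fun hf hg =>
      continuous_turn (continuous_const.rpow hf fun _ => Or.inl hr.ne')
        (fun _ => Real.rpow_pos_of_pos hr _) hg
    -- Both sides lift the same direction, so they differ by an integer; it is constant on the
    -- connected parameter space and vanishes at s = t = 0.
    have := eq_of_forall_exists_int (A := ℝ × ℝ × ℝ)
      (f := fun z => turn (r ^ (z.1 + z.2.1)) z.2.2 - turn (r ^ z.1) (turn (r ^ z.2.1) z.2.2))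
      ((hc (by fun_prop) (by fun_prop)).sub (hc (by fun_prop) (hc (by fun_prop) (by fun_prop))))
      (fun z => by
        obtain ⟨a, ha, ha1, ha2⟩ := turn_direction (Real.rpow_pos_of_pos hr (z.1 + z.2.1)) z.2.2
        obtain ⟨b, hb, hb1, hb2⟩ := turn_direction (Real.rpow_pos_of_pos hr z.2.1) z.2.2
        obtain ⟨d, hd, hd1, hd2⟩ := turn_direction (Real.rpow_pos_of_pos hr z.1)
          (turn (r ^ z.2.1) z.2.2)
        rw [hb1, ← mul_assoc] at hd1
        rw [hb2, show d * (r ^ z.1 * (b * (r ^ z.2.1 * Real.sin (2 * Real.pi * z.2.2)))) =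
          d * b * (r ^ z.1 * r ^ z.2.1 * Real.sin (2 * Real.pi * z.2.2)) by ring,
          ← Real.rpow_add hr] at hd2
        obtain ⟨n, hn⟩ := exists_int_of_direction_eq ha (mul_pos hd hb) ha1 ha2 hd1 hd2
        exact ⟨n, by rw [hn]; ring⟩) (s, t, u) (0, 0, u)
    simp only [add_zero, Real.rpow_zero, turn_one, sub_self] at this
    linarith
  act_add_one t u := turn_add_one _ _
  act_fix t := turn_zero _

/-! ### The action of the flow on the tangent bundle -/

section Manifold

variable {M : Type*} [TopologicalSpace M] [ChartedSpace (EuclideanSpace ℝ (Fin 3)) M]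
  [IsManifold (𝓡 3) ∞ M]

/-- The action of `dφ_t` on the tangent bundle. -/
def tangentFlow (φ : SmoothFlow M) (t : ℝ) (v : TangentBundle (𝓡 3) M) : TangentBundle (𝓡 3) M :=
  ⟨φ.toFlow t v.proj, φ.diff t v.proj v.snd⟩

theorem tangentFlow_eq (φ : SmoothFlow M) (t : ℝ) :
    tangentFlow φ t = tangentMap (𝓡 3) (𝓡 3) (φ.toFlow t) := rfl

theorem tangentFlow_zero (φ : SmoothFlow M) (v : TangentBundle (𝓡 3) M) :
    tangentFlow φ 0 v = v := by
  rw [tangentFlow_eq, φ.toFlow.map_zero, tangentMap_id]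
  rfl

theorem tangentFlow_add (φ : SmoothFlow M) (s t : ℝ) (v : TangentBundle (𝓡 3) M) :
    tangentFlow φ (s + t) v = tangentFlow φ s (tangentFlow φ t v) := by
  have e : φ.toFlow (s + t) = φ.toFlow s ∘ φ.toFlow t := funext fun x => φ.toFlow.map_add s t x
  rw [tangentFlow_eq, tangentFlow_eq, tangentFlow_eq, e,
    tangentMap_comp_at v (φ.mdifferentiable s _) (φ.mdifferentiable t _)]

theorem tangentFlow_neg_tangentFlow (φ : SmoothFlow M) (t : ℝ) (v : TangentBundle (𝓡 3) M) :
    tangentFlow φ (-t) (tangentFlow φ t v) = v := by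
  rw [← tangentFlow_add, neg_add_cancel, tangentFlow_zero]

/-- The vector dφ_t v is the derivative of the joint map (t, x) ↦ φ_t x applied to (0, v). -/
theorem continuous_tangentFlow (φ : SmoothFlow M) :
    Continuous fun z : ℝ × TangentBundle (𝓡 3) M => tangentFlow φ z.1 z.2 := by
  have : IsManifold (𝓡 3) 1 M := IsManifold.of_le (n := ∞) (by simp)
  have h1 := φ.smooth.continuous_tangentMap (by simp)
  have h2 : Continuous (equivTangentBundleProd 𝓘(ℝ, ℝ) ℝ (𝓡 3) M).symm :=
    (contMDiff_equivTangentBundleProd_symm (n := 0)).continuous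
  have h3 : Continuous (Bundle.zeroSection ℝ (TangentSpace 𝓘(ℝ, ℝ) : ℝ → Type _)) :=
    (Bundle.contMDiff_zeroSection (n := 0) (IB := 𝓘(ℝ, ℝ)) ℝ
      (TangentSpace 𝓘(ℝ, ℝ) : ℝ → Type _)).continuous
  convert h1.comp (h2.comp ((h3.comp continuous_fst).prodMk continuous_snd)) using 1
  funext z
  have hm : MDifferentiableAt (𝓘(ℝ, ℝ).prod (𝓡 3)) (𝓡 3)
      (fun z : ℝ × M => φ.toFlow z.1 z.2) (z.1, z.2.proj) :=
    (φ.smooth.mdifferentiable (by simp)) _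
  let w : TangentSpace (𝓘(ℝ, ℝ).prod (𝓡 3)) (z.1, z.2.proj) := ((0 : ℝ), z.2.snd)
  have key := mfderiv_prod_eq_add_apply (v := w) hm
  refine congrArg (Bundle.TotalSpace.mk (F := EuclideanSpace ℝ (Fin 3))
    (E := (TangentSpace (𝓡 3) : M → Type _)) (φ.toFlow z.1 z.2.proj)) (Eq.symm (key.trans ?_))
  exact (congrArg₂ (· + ·) (map_zero _) rfl).trans (zero_add _)

instance finiteDimensional_tangentSpace (x : M) : FiniteDimensional ℝ (TangentSpace (𝓡 3) x) :=
  inferInstanceAs (FiniteDimensional ℝ (EuclideanSpace ℝ (Fin 3)))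

theorem finrank_tangentSpace (x : M) : Module.finrank ℝ (TangentSpace (𝓡 3) x) = 3 :=
  (finrank_euclideanSpace_fin : Module.finrank ℝ (EuclideanSpace ℝ (Fin 3)) = 3)

instance t2Space_tangentSpace (x : M) : T2Space (TangentSpace (𝓡 3) x) :=
  inferInstanceAs (T2Space (EuclideanSpace ℝ (Fin 3)))

/-- The differential of the flow as a linear equivalence. -/
def diffEquiv (φ : SmoothFlow M) (t : ℝ) (x : M) :
    TangentSpace (𝓡 3) x ≃ₗ[ℝ] TangentSpace (𝓡 3) (φ.toFlow t x) :=
  LinearMap.linearEquivOfInjective (φ.diff t x : _ →ₗ[ℝ] _)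
    (fun v w h => by
      rw [← φ.diff_neg_diff t x v, ← φ.diff_neg_diff t x w]
      exact congrArg _ h)
    ((finrank_tangentSpace _).trans (finrank_tangentSpace _).symm)

theorem tangentFlow_neg_mk (φ : SmoothFlow M) (t : ℝ) (x : M)
    (v : TangentSpace (𝓡 3) (φ.toFlow t x)) :
    tangentFlow φ (-t) ⟨φ.toFlow t x, v⟩ = ⟨x, (diffEquiv φ t x).symm v⟩ := by
  obtain ⟨w, rfl⟩ := (diffEquiv φ t x).surjective v
  rw [LinearEquiv.symm_apply_apply]
  exact tangentFlow_neg_tangentFlow φ t ⟨x, w⟩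

theorem tangentFlow_smul {φ : SmoothFlow M} {t : ℝ} {x y : M} {v : TangentSpace (𝓡 3) x}
    {w : TangentSpace (𝓡 3) y} (a : ℝ) (h : tangentFlow φ t ⟨x, v⟩ = ⟨y, w⟩) :
    tangentFlow φ t ⟨x, a • v⟩ = ⟨y, a • w⟩ := by
  obtain rfl : φ.toFlow t x = y := (Bundle.TotalSpace.mk.inj h).1
  obtain rfl : φ.diff t x v = w := eq_of_heq (Bundle.TotalSpace.mk.inj h).2
  rw [← map_smul]
  rfl

theorem tangentFlow_add_mk {φ : SmoothFlow M} {t : ℝ} {x y : M} {v v' : TangentSpace (𝓡 3) x}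
    {w w' : TangentSpace (𝓡 3) y} (h : tangentFlow φ t ⟨x, v⟩ = ⟨y, w⟩)
    (h' : tangentFlow φ t ⟨x, v'⟩ = ⟨y, w'⟩) :
    tangentFlow φ t ⟨x, v + v'⟩ = ⟨y, w + w'⟩ := by
  obtain rfl : φ.toFlow t x = y := (Bundle.TotalSpace.mk.inj h).1
  obtain rfl : φ.diff t x v = w := eq_of_heq (Bundle.TotalSpace.mk.inj h).2
  obtain rfl : φ.diff t x v' = w' := eq_of_heq (Bundle.TotalSpace.mk.inj h').2
  rw [← map_add]
  rfl

/-- Pulling back by the flow replaces sections along the orbit by curves in the single vector space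
T_pM. -/
theorem continuousOn_pullback (φ : SmoothFlow M) (p : M) {U : Set M}
    {s : ∀ x : M, TangentSpace (𝓡 3) x}
    (hs : ContinuousOn (fun x => (⟨x, s x⟩ : TangentBundle (𝓡 3) M)) U) {S : Set ℝ}
    (hS : MapsTo (fun t => φ.toFlow t p) S U) :
    ContinuousOn (fun t => (diffEquiv φ t p).symm (s (φ.toFlow t p))) S := by
  rw [(FiberBundle.totalSpaceMk_isInducing (EuclideanSpace ℝ (Fin 3))
    (TangentSpace (𝓡 3) : M → Type _) p).continuousOn_iff]
  have h1 : ContinuousOn (fun t : ℝ => ((-t, ⟨φ.toFlow t p, s (φ.toFlow t p)⟩) :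
      ℝ × TangentBundle (𝓡 3) M)) S :=
    continuousOn_id.neg.prodMk (hs.comp (φ.toFlow.continuous continuous_id
      continuous_const).continuousOn hS)
  refine ((continuous_tangentFlow φ).comp_continuousOn h1).congr fun t _ => ?_
  exact (tangentFlow_neg_mk φ t p _).symm

theorem continuous_basis_det {x : M} (B : Module.Basis (Fin 3) ℝ (TangentSpace (𝓡 3) x)) :
    Continuous fun v : Fin 3 → TangentSpace (𝓡 3) x => B.det v := by
  simp only [Module.Basis.det_apply]
  refine Continuous.matrix_det (continuous_matrix fun i j => ?_)
  exact (LinearMap.continuous_of_finiteDimensional (B.coord i)).comp (continuous_apply j)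

/-- A local oriented frame, pulled back to T_pM, has a continuous nonvanishing determinant against
`B`, whose sign is locally constant in time. -/
theorem orientation_transport {o : ∀ x : M, Orientation ℝ (TangentSpace (𝓡 3) x) (Fin 3)}
    (ho : IsOrientation o) (φ : SmoothFlow M) (p : M)
    (B : Module.Basis (Fin 3) ℝ (TangentSpace (𝓡 3) p)) (t t' : ℝ) :
    (B.map (diffEquiv φ t p)).orientation = o (φ.toFlow t p) ↔
      (B.map (diffEquiv φ t' p)).orientation = o (φ.toFlow t' p) := by
  suffices h : IsLocallyConstant fun t =>
      (B.map (diffEquiv φ t p)).orientation = o (φ.toFlow t p) from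
    iff_of_eq (h.apply_eq_of_preconnectedSpace t t')
  rw [IsLocallyConstant.iff_eventually_eq]
  intro t₀
  obtain ⟨U, hU, e, he, hb⟩ := ho (φ.toFlow t₀ p)
  let S : Set ℝ := {t | φ.toFlow t p ∈ U}
  have hS : S ∈ 𝓝 t₀ :=
    (φ.toFlow.continuous continuous_id continuous_const).continuousAt.preimage_mem_nhds hU
  let d : ℝ → ℝ := fun t => B.det fun i => (diffEquiv φ t p).symm (e i (φ.toFlow t p))
  have hd : ContinuousAt d t₀ :=
    (((continuous_basis_det B).comp_continuousOn (continuousOn_pi.2 fun i =>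
      continuousOn_pullback φ p (he i) (S := S) fun t ht => ht)).continuousAt hS)
  have key : ∀ t ∈ S, d t ≠ 0 ∧
      ((B.map (diffEquiv φ t p)).orientation = o (φ.toFlow t p) ↔ 0 < d t) := by
    intro t ht
    obtain ⟨b, hbe, hbo⟩ := hb _ ht
    have e1 : (B.map (diffEquiv φ t p)).det b = d t := by
      rw [Module.Basis.det_map]
      congr 1
      funext i
      exact congrArg _ (hbe i)
    rw [← e1, ← hbo]
    exact ⟨((B.map (diffEquiv φ t p)).isUnit_det b).ne_zero,
      Module.Basis.orientation_eq_iff_det_pos _ _⟩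
  have h0 := key t₀ (mem_of_mem_nhds hS)
  rcases lt_or_gt_of_ne h0.1 with hneg | hpos
  · filter_upwards [hS, hd.eventually_lt_const hneg] with t ht ht'
    rw [(key t ht).2, h0.2]
    exact propext ⟨fun h => absurd h ht'.not_gt, fun h => absurd h hneg.not_gt⟩
  · filter_upwards [hS, hd.eventually_const_lt hpos] with t ht ht'
    rw [(key t ht).2, h0.2]
    exact propext ⟨fun _ => hpos, fun _ => ht'⟩

/-- An invariant line field that is orientable along a closed orbit has positive holonomy. -/
theorem exists_multiplier (φ : SmoothFlow M) (p : M) {P : ℝ} (hP : φ.toFlow P p = p)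
    {L : ∀ x : M, Submodule ℝ (TangentSpace (𝓡 3) x)} (hL : IsLineBundle L)
    (hinv : ∀ t x, (L x).map (φ.diff t x : _ →ₗ[ℝ] _) = L (φ.toFlow t x))
    (hor : OrientableAlong L (φ.toFlow.orbit p)) :
    ∃ v ∈ L p, v ≠ 0 ∧ ∃ μ : ℝ, 0 < μ ∧ tangentFlow φ P ⟨p, v⟩ = ⟨p, μ • v⟩ := by
  obtain ⟨s, hs, hsL⟩ := hor
  have horb : ∀ t, φ.toFlow t p ∈ φ.toFlow.orbit p := fun t => ⟨t, rfl⟩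
  have hpo : p ∈ φ.toFlow.orbit p := ⟨0, φ.toFlow.map_zero_apply p⟩
  obtain ⟨hv0, hvL⟩ := hsL p hpo
  have hspan : ∀ w ∈ L p, ∃ a : ℝ, w = a • s p := by
    obtain ⟨U, hU, e, -, he⟩ := hL p
    obtain ⟨-, h2⟩ := he p (mem_of_mem_nhds hU)
    intro w hw
    rw [h2] at hvL hw
    obtain ⟨a, ha⟩ := Submodule.mem_span_singleton.1 hvL
    obtain ⟨b, hb⟩ := Submodule.mem_span_singleton.1 hw
    have ha0 : a ≠ 0 := fun h => hv0 (by rw [← ha, h, zero_smul])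
    exact ⟨b / a, by rw [← ha, smul_smul, div_mul_cancel₀ _ ha0, hb]⟩
  obtain ⟨ℓ, hℓ⟩ := Module.Projective.exists_dual_ne_zero ℝ hv0
  -- The pulled back section is `a t • s p` with `a` continuous, nowhere zero and 1 at time 0. So `a
  -- P` is positive, and its inverse is the multiplier.
  let w : ℝ → TangentSpace (𝓡 3) p := fun t => (diffEquiv φ t p).symm (s (φ.toFlow t p))
  have hwc : Continuous w := continuousOn_univ.1 (continuousOn_pullback φ p hs fun t _ => horb t)
  have hwL : ∀ t, ∃ a : ℝ, a ≠ 0 ∧ w t = a • s p := fun t => by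
    obtain ⟨h0, hm⟩ := hsL _ (horb t)
    rw [← hinv] at hm
    obtain ⟨y, hy, hy'⟩ := hm
    have e : w t = y := by
      rw [LinearEquiv.symm_apply_eq]; exact hy'.symm
    obtain ⟨a, ha⟩ := hspan y hy
    refine ⟨a, fun h => ?_, e.trans ha⟩
    rw [h, zero_smul] at ha
    rw [← hy', ha] at h0
    exact h0 (map_zero _)
  choose a ha0 ha using hwL
  have ha' : ∀ t, a t = ℓ (w t) / ℓ (s p) := fun t => by
    rw [ha, map_smul, smul_eq_mul, mul_div_cancel_right₀ _ hℓ]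
  have hac : Continuous a := by
    rw [funext ha']
    exact ((LinearMap.continuous_of_finiteDimensional ℓ).comp hwc).div_const _
  have hmk : ∀ t, (⟨p, w t⟩ : TangentBundle (𝓡 3) M) =
      tangentFlow φ (-t) ⟨φ.toFlow t p, s (φ.toFlow t p)⟩ := fun t =>
    (tangentFlow_neg_mk φ t p _).symm
  have h0 : a 0 = 1 := by
    have h1 := hmk 0
    rw [neg_zero, tangentFlow_zero, φ.toFlow.map_zero_apply] at h1
    have h2 : w 0 = s p := by
      have := (Bundle.TotalSpace.mk.inj h1).2
      exact eq_of_heq this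
    rw [ha', h2, div_self hℓ]
  have hpos : 0 < a P := by
    have := lt_of_forall_ne (continuous_const (y := (0 : ℝ))) hac (fun t => (ha0 t).symm) (a := 0)
      (by rw [h0]; exact one_pos) P
    exact this
  refine ⟨s p, hvL, hv0, (a P)⁻¹, inv_pos.2 hpos, ?_⟩
  have h1 := hmk P
  rw [hP, ha] at h1
  have h2 : tangentFlow φ P ⟨p, a P • s p⟩ = ⟨p, s p⟩ := by
    rw [h1, ← tangentFlow_add, add_neg_cancel, tangentFlow_zero]
  have h4 := tangentFlow_smul (a P)⁻¹ h2
  rwa [smul_smul, inv_mul_cancel₀ hpos.ne', one_smul] at h4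

/-- A frame at a point of a closed orbit consisting of the velocity and two eigenvectors of the
holonomy with positive eigenvalues, the first one stable, transported by the flow to positive
frames. -/
structure AdaptedFrame (o : ∀ x : M, Orientation ℝ (TangentSpace (𝓡 3) x) (Fin 3))
    (φ : SmoothFlow M) (Es : ∀ x : M, Submodule ℝ (TangentSpace (𝓡 3) x)) (p : M) where
  /-- The period of the orbit. -/
  period : ℝ
  isMinimalPeriod : IsMinimalPeriod φ.toFlow p period
  /-- The frame. -/
  B : Module.Basis (Fin 3) ℝ (TangentSpace (𝓡 3) p)
  B_zero : B 0 = φ.velocity p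
  /-- The stable multiplier. -/
  μ : ℝ
  /-- The unstable multiplier. -/
  ν : ℝ
  μ_pos : 0 < μ
  ν_pos : 0 < ν
  map_one : tangentFlow φ period ⟨p, B 1⟩ = ⟨p, μ • B 1⟩
  map_two : tangentFlow φ period ⟨p, B 2⟩ = ⟨p, ν • B 2⟩
  orientation_eq : ∀ t, (B.map (diffEquiv φ t p)).orientation = o (φ.toFlow t p)
  stable : ∀ t, φ.diff t p (B 1) ∈ Es (φ.toFlow t p)

theorem exists_adaptedFrame {o : ∀ x : M, Orientation ℝ (TangentSpace (𝓡 3) x) (Fin 3)}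
    (ho : IsOrientation o) {φ : SmoothFlow M}
    {Es Eu : ∀ x : M, Submodule ℝ (TangentSpace (𝓡 3) x)} (hφ : IsAnosov φ Es Eu) {p : M}
    {P : ℝ} (hp : IsMinimalPeriod φ.toFlow p P) (hEs : OrientableAlong Es (φ.toFlow.orbit p))
    (hEu : OrientableAlong Eu (φ.toFlow.orbit p)) : Nonempty (AdaptedFrame o φ Es p) := by
  obtain ⟨v, hv, hv0, μ, hμ, hvμ⟩ :=
    exists_multiplier φ p hp.2.1 hφ.lineBundle_stable hφ.invariant_stable hEs
  obtain ⟨w, hw, hw0, ν, hν, hwν⟩ :=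
    exists_multiplier φ p hp.2.1 hφ.lineBundle_unstable hφ.invariant_unstable hEu
  have hframe : ∀ w ∈ Eu p, w ≠ 0 → ∃ B : Module.Basis (Fin 3) ℝ (TangentSpace (𝓡 3) p),
      B 0 = φ.velocity p ∧ B 1 = v ∧ B 2 = w := by
    intro w hw hw0
    have h1 : LinearIndependent ℝ ![v, φ.velocity p, w] := by
      refine (hφ.splitting p).submodule_iSupIndep.linearIndependent _ ?_ ?_
      · intro i
        fin_cases i
        · exact hv
        · exact Submodule.mem_span_singleton_self _
        · exact hw
      · intro i
        fin_cases i
        · exact hv0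
        · exact hφ.velocity_ne_zero p
        · exact hw0
    -- The splitting lists the stable direction first, the frame starts with the velocity.
    have h2 := h1.comp (Equiv.swap (0 : Fin 3) 1) (Equiv.injective _)
    refine ⟨basisOfLinearIndependentOfCardEqFinrank h2 (by rw [finrank_tangentSpace]; rfl), ?_⟩
    rw [coe_basisOfLinearIndependentOfCardEqFinrank]
    refine ⟨rfl, rfl, rfl⟩
  have main : ∀ w ∈ Eu p, tangentFlow φ P ⟨p, w⟩ = ⟨p, ν • w⟩ →
      ∀ B : Module.Basis (Fin 3) ℝ (TangentSpace (𝓡 3) p), B 0 = φ.velocity p → B 1 = v →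
      B 2 = w → (B.map (diffEquiv φ 0 p)).orientation = o (φ.toFlow 0 p) →
      Nonempty (AdaptedFrame o φ Es p) := by
    rintro w hw hwν B hB0 rfl rfl hBo
    refine ⟨⟨P, hp, B, hB0, μ, ν, hμ, hν, hvμ, hwν,
      fun t => (orientation_transport ho φ p B 0 t).1 hBo, fun t => ?_⟩⟩
    rw [← hφ.invariant_stable]
    exact ⟨_, hv, rfl⟩
  obtain ⟨B, hB0, hB1, hB2⟩ := hframe w hw hw0
  by_cases hBo : (B.map (diffEquiv φ 0 p)).orientation = o (φ.toFlow 0 p)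
  · exact main w hw hwν B hB0 hB1 hB2 hBo
  -- Reversing the unstable vector corrects the orientation and keeps the multiplier.
  · obtain ⟨B', hB0', hB1', hB2'⟩ := hframe (-w) ((Eu p).neg_mem hw) (neg_ne_zero.2 hw0)
    refine main (-w) ((Eu p).neg_mem hw) ?_ B' hB0' hB1' hB2' ?_
    · have := tangentFlow_smul (-1) hwν
      rwa [smul_comm, neg_one_smul] at this
    · have h1 : o (φ.toFlow 0 p) = -(B.map (diffEquiv φ 0 p)).orientation :=
        (Module.Basis.orientation_ne_iff_eq_neg _ _).1 (Ne.symm hBo)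
      rw [h1, ← Module.Basis.orientation_ne_iff_eq_neg, Ne, eq_comm,
        Module.Basis.orientation_eq_iff_det_pos, Module.Basis.det_map]
      have h2 : (diffEquiv φ 0 p).symm ∘ B'.map (diffEquiv φ 0 p) = Function.update B 2 (-B 2) := by
        funext i
        simp only [Function.comp, Module.Basis.map_apply, LinearEquiv.symm_apply_apply]
        fin_cases i
        · exact hB0'.trans hB0.symm
        · exact hB1'.trans hB1.symm
        · simp [hB2', hB2]
      rw [h2, AlternatingMap.map_update_neg, Function.update_eq_self, Module.Basis.det_self]
      norm_num

/-! ### Rays transported along the orbit -/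

theorem diff_mem_span_iff (φ : SmoothFlow M) (t : ℝ) (x : M) (v : TangentSpace (𝓡 3) x) :
    φ.diff t x v ∈ Submodule.span ℝ {φ.velocity (φ.toFlow t x)} ↔
      v ∈ Submodule.span ℝ {φ.velocity x} :=
  ⟨fun h => by_contra fun h' => φ.diff_notMem_span t x v h' h, φ.diff_mem_span t x v⟩

/-- A normal vector at `p`, transported along the orbit. -/
def transport (φ : SmoothFlow M) (p : M) (t : ℝ) (w : TangentSpace (𝓡 3) p)
    (hw : w ∉ Submodule.span ℝ {φ.velocity p}) : NormalVector φ p :=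
  ⟨tangentFlow φ t ⟨p, w⟩, ⟨t, rfl⟩, φ.diff_notMem_span t p w hw⟩

theorem exists_transport {φ : SmoothFlow M} {p : M} (v : NormalVector φ p) :
    ∃ t w hw, v = transport φ p t w hw := by
  obtain ⟨⟨q, a⟩, ⟨t, ht⟩, ha⟩ := v
  obtain rfl : φ.toFlow t p = q := ht
  obtain ⟨w, rfl⟩ := (diffEquiv φ t p).surjective a
  exact ⟨t, w, fun h => ha (φ.diff_mem_span t p w h), rfl⟩

theorem ray_transport_eq_iff {φ : SmoothFlow M} {p : M} {t : ℝ} {w w' : TangentSpace (𝓡 3) p}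
    {hw : w ∉ Submodule.span ℝ {φ.velocity p}} {hw' : w' ∉ Submodule.span ℝ {φ.velocity p}} :
    ray (transport φ p t w hw) = ray (transport φ p t w' hw') ↔
      ∃ r : ℝ, 0 < r ∧ w - r • w' ∈ Submodule.span ℝ {φ.velocity p} := by
  refine Iff.trans (b := RayRel φ p _ _) ⟨fun h => Quotient.exact h,
    fun h => Quotient.sound (s := raySetoid φ p) h⟩ ?_
  constructor
  · rintro ⟨q, a, b, r, h, h', hr, hab⟩
    obtain rfl : φ.toFlow t p = q := (Bundle.TotalSpace.mk.inj h).1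
    obtain rfl : φ.diff t p w = a := eq_of_heq (Bundle.TotalSpace.mk.inj h).2
    obtain rfl : φ.diff t p w' = b := eq_of_heq (Bundle.TotalSpace.mk.inj h').2
    rw [← map_smul, ← map_sub, diff_mem_span_iff] at hab
    exact ⟨r, hr, hab⟩
  · rintro ⟨r, hr, h⟩
    refine ⟨φ.toFlow t p, φ.diff t p w, φ.diff t p w', r, rfl, rfl, hr, ?_⟩
    rwa [← map_smul, ← map_sub, diff_mem_span_iff]

theorem rayFlow_transport {φ : SmoothFlow M} {p : M} (s t : ℝ) {w : TangentSpace (𝓡 3) p}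
    (hw : w ∉ Submodule.span ℝ {φ.velocity p}) :
    rayFlow φ p s (ray (transport φ p t w hw)) = ray (transport φ p (s + t) w hw) := by
  have : normalFlow φ p s (transport φ p t w hw) = transport φ p (s + t) w hw :=
    Subtype.ext (tangentFlow_add φ s t _).symm
  rw [← this]
  rfl

/-! ### Construction of the torus coordinates from an adapted frame -/

namespace AdaptedFrame

variable {o : ∀ x : M, Orientation ℝ (TangentSpace (𝓡 3) x) (Fin 3)}
  {φ : SmoothFlow M} {Es : ∀ x : M, Submodule ℝ (TangentSpace (𝓡 3) x)} {p : M}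
  (F : AdaptedFrame o φ Es p)

theorem mem_span_iff (w : TangentSpace (𝓡 3) p) :
    w ∈ Submodule.span ℝ {φ.velocity p} ↔ F.B.repr w 1 = 0 ∧ F.B.repr w 2 = 0 := by
  rw [← F.B_zero, Submodule.mem_span_singleton]
  constructor
  · rintro ⟨a, rfl⟩
    simp
  · rintro ⟨h1, h2⟩
    refine ⟨F.B.repr w 0, ?_⟩
    conv_rhs => rw [← F.B.sum_repr w, Fin.sum_univ_three, h1, h2]
    simp

/-- The normal vector of given angle at `p`. -/
def direction (u : ℝ) : TangentSpace (𝓡 3) p :=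
  Real.cos (2 * Real.pi * u) • F.B 1 + Real.sin (2 * Real.pi * u) • F.B 2

theorem repr_direction_one (u : ℝ) : F.B.repr (F.direction u) 1 = Real.cos (2 * Real.pi * u) := by
  simp [direction]

theorem repr_direction_two (u : ℝ) : F.B.repr (F.direction u) 2 = Real.sin (2 * Real.pi * u) := by
  simp [direction]

theorem direction_notMem (u : ℝ) : F.direction u ∉ Submodule.span ℝ {φ.velocity p} := by
  rw [F.mem_span_iff, F.repr_direction_one, F.repr_direction_two]
  rintro ⟨h1, h2⟩
  have := Real.sin_sq_add_cos_sq (2 * Real.pi * u)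
  rw [h1, h2] at this
  norm_num at this

theorem sub_smul_direction_mem_iff (w : TangentSpace (𝓡 3) p) (r u : ℝ) :
    w - r • F.direction u ∈ Submodule.span ℝ {φ.velocity p} ↔
      F.B.repr w 1 = r * Real.cos (2 * Real.pi * u) ∧
        F.B.repr w 2 = r * Real.sin (2 * Real.pi * u) := by
  rw [F.mem_span_iff]
  simp only [map_sub, map_smul, Finsupp.sub_apply, Finsupp.smul_apply, F.repr_direction_one,
    F.repr_direction_two, smul_eq_mul, sub_eq_zero]

/-- The ray of given angle, transported along the orbit. -/
def dirRay (t u : ℝ) : BoundaryTorus φ p := ray (transport φ p t (F.direction u)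
  (F.direction_notMem u))

theorem dirRay_eq_iff {t u u' : ℝ} : F.dirRay t u = F.dirRay t u' ↔ ∃ n : ℤ, u = u' + n := by
  rw [dirRay, dirRay, ray_transport_eq_iff]
  simp only [F.sub_smul_direction_mem_iff, F.repr_direction_one, F.repr_direction_two]
  constructor
  · rintro ⟨r, hr, h1, h2⟩
    exact exists_int_of_direction_eq hr one_pos h1 h2 (one_mul _).symm (one_mul _).symm
  · rintro ⟨n, rfl⟩
    refine ⟨1, one_pos, ?_, ?_⟩
    · rw [mul_add, one_mul, mul_comm (2 * Real.pi) (n : ℝ), Real.cos_add_int_mul_two_pi]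
    · rw [mul_add, one_mul, mul_comm (2 * Real.pi) (n : ℝ), Real.sin_add_int_mul_two_pi]

theorem base_dirRay (t u : ℝ) : (F.dirRay t u).base = φ.toFlow t p := rfl

theorem rayFlow_dirRay (s t u : ℝ) : rayFlow φ p s (F.dirRay t u) = F.dirRay (s + t) u :=
  rayFlow_transport s t _

theorem exists_repr_eq {w : TangentSpace (𝓡 3) p} (hw : w ∉ Submodule.span ℝ {φ.velocity p}) :
    ∃ r u : ℝ, 0 < r ∧ F.B.repr w 1 = r * Real.cos (2 * Real.pi * u) ∧
        F.B.repr w 2 = r * Real.sin (2 * Real.pi * u) := by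
  let z : ℂ := ⟨F.B.repr w 1, F.B.repr w 2⟩
  have hz : z ≠ 0 := fun h => hw ((F.mem_span_iff w).2
    ⟨congrArg Complex.re h, congrArg Complex.im h⟩)
  have hpi := Real.pi_pos
  have hn : ‖z‖ ≠ 0 := norm_ne_zero_iff.2 hz
  have e : 2 * Real.pi * (z.arg / (2 * Real.pi)) = z.arg := by field_simp
  refine ⟨‖z‖, z.arg / (2 * Real.pi), norm_pos_iff.2 hz, ?_, ?_⟩
  · rw [e, Complex.cos_arg hz, mul_div_cancel₀ _ hn]
  · rw [e, Complex.sin_arg, mul_div_cancel₀ _ hn]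

theorem dirRay_surjective (r : BoundaryTorus φ p) : ∃ t u, F.dirRay t u = r := by
  obtain ⟨v, rfl⟩ := Quotient.exists_rep r
  obtain ⟨t, w, hw, rfl⟩ := exists_transport v
  obtain ⟨r, u, hr, h1, h2⟩ := F.exists_repr_eq hw
  refine ⟨t, u, Eq.symm (?_ : ray (transport φ p t w hw) = F.dirRay t u)⟩
  exact ray_transport_eq_iff.2 ⟨r, hr, (F.sub_smul_direction_mem_iff w r u).2 ⟨h1, h2⟩⟩

/-- The holonomy of the orbit on directions. -/
def holonomy : CircleFlow := diagonalFlow (F.ν / F.μ) (div_pos F.ν_pos F.μ_pos)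

/-- The return map sends (cos, sin) to (μ cos, ν sin), which spans the same ray as (cos, (ν/μ) sin).
-/
theorem dirRay_add_period (t u : ℝ) :
    F.dirRay (t + F.period) u = F.dirRay t (F.holonomy.act 1 u) := by
  have hμ := F.μ_pos
  obtain ⟨a, ha, h1, h2⟩ := turn_direction (div_pos F.ν_pos F.μ_pos) u
  let w : TangentSpace (𝓡 3) p := Real.cos (2 * Real.pi * u) • F.μ • F.B 1 +
    Real.sin (2 * Real.pi * u) • F.ν • F.B 2
  have hw : tangentFlow φ F.period ⟨p, F.direction u⟩ = ⟨p, w⟩ :=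
    tangentFlow_add_mk (tangentFlow_smul _ F.map_one) (tangentFlow_smul _ F.map_two)
  have hw1 : F.B.repr w 1 = Real.cos (2 * Real.pi * u) * F.μ := by simp [w]
  have hw2 : F.B.repr w 2 = Real.sin (2 * Real.pi * u) * F.ν := by simp [w]
  have hmem : w - (F.μ / a) • F.direction (F.holonomy.act 1 u) ∈
      Submodule.span ℝ {φ.velocity p} := by
    have e : F.holonomy.act 1 u = turn (F.ν / F.μ) u := by
      change turn ((F.ν / F.μ) ^ (1 : ℝ)) u = _
      rw [Real.rpow_one]
    rw [F.sub_smul_direction_mem_iff, e, h1, h2, hw1, hw2]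
    constructor <;> field_simp
  have hwn : w ∉ Submodule.span ℝ {φ.velocity p} := fun h => by
    have := Submodule.sub_mem _ h hmem
    rw [sub_sub_cancel] at this
    exact F.direction_notMem _ ((Submodule.smul_mem_iff _ (div_pos hμ ha).ne').1 this)
  have e : transport φ p (t + F.period) (F.direction u) (F.direction_notMem u) =
      transport φ p t w hwn := Subtype.ext (by
    change tangentFlow φ (t + F.period) _ = tangentFlow φ t _
    rw [tangentFlow_add, hw])
  rw [dirRay, e, dirRay]
  exact ray_transport_eq_iff.2 ⟨_, div_pos hμ ha, hmem⟩

theorem continuous_dirRay : Continuous fun z : ℝ × ℝ => F.dirRay z.1 z.2 := by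
  have h1 : Continuous fun z : ℝ × ℝ => (⟨p, F.direction z.2⟩ : TangentBundle (𝓡 3) M) := by
    refine (FiberBundle.totalSpaceMk_isInducing (EuclideanSpace ℝ (Fin 3))
      (TangentSpace (𝓡 3) : M → Type _) p).continuous.comp ?_
    unfold direction
    fun_prop
  have h2 : Continuous fun z : ℝ × ℝ =>
      transport φ p z.1 (F.direction z.2) (F.direction_notMem z.2) :=
    ((continuous_tangentFlow φ).comp (continuous_fst.prodMk h1)).subtype_mk _
  exact continuous_quotient_mk'.comp h2

/-- Equality of rays becomes a closed condition on the pulled back vector. The weak inequality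
suffices, since a normal vector has no zero projection to the normal plane. -/
theorem ray_eq_dirRay_iff (v : NormalVector φ p) (t u : ℝ) : ray v = F.dirRay t u ↔
    ∃ w : TangentSpace (𝓡 3) p, (F.B.repr w 1 * Real.sin (2 * Real.pi * u) =
      F.B.repr w 2 * Real.cos (2 * Real.pi * u) ∧
      0 ≤ F.B.repr w 1 * Real.cos (2 * Real.pi * u) + F.B.repr w 2 * Real.sin (2 * Real.pi * u)) ∧
      (⟨p, w⟩ : TangentBundle (𝓡 3) M) = tangentFlow φ (-t) v.1 := by
  have hsq := Real.sin_sq_add_cos_sq (2 * Real.pi * u)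
  constructor
  · intro h
    have hb : v.1.proj = φ.toFlow t p := congrArg BoundaryTorus.base h
    obtain ⟨⟨q, a⟩, ha1, ha2⟩ := v
    obtain rfl : q = φ.toFlow t p := hb
    obtain ⟨w, rfl⟩ := (diffEquiv φ t p).surjective a
    have hw : w ∉ Submodule.span ℝ {φ.velocity p} := fun h => ha2 (φ.diff_mem_span t p w h)
    obtain ⟨r, hr, hm⟩ := (ray_transport_eq_iff (hw := hw)).1 h
    rw [F.sub_smul_direction_mem_iff] at hm
    refine ⟨w, ?_, (tangentFlow_neg_tangentFlow φ t ⟨p, w⟩).symm⟩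
    rw [hm.1, hm.2]
    refine ⟨by ring, ?_⟩
    have : r * Real.cos (2 * Real.pi * u) * Real.cos (2 * Real.pi * u) +
      r * Real.sin (2 * Real.pi * u) * Real.sin (2 * Real.pi * u) = r := by
      linear_combination r * hsq
    rw [this]
    exact hr.le
  · rintro ⟨w, ⟨h1, h2⟩, hv⟩
    have hv' : v.1 = tangentFlow φ t ⟨p, w⟩ := by
      rw [hv, ← tangentFlow_add, add_neg_cancel, tangentFlow_zero]
    have hw : w ∉ Submodule.span ℝ {φ.velocity p} := fun h => by
      have h3 := φ.diff_mem_span t p w h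
      have h4 := v.2.2
      rw [hv'] at h4
      exact h4 h3
    obtain rfl : v = transport φ p t w hw := Subtype.ext hv'
    have e1 : F.B.repr w 1 = (F.B.repr w 1 * Real.cos (2 * Real.pi * u) +
        F.B.repr w 2 * Real.sin (2 * Real.pi * u)) * Real.cos (2 * Real.pi * u) := by
      linear_combination Real.sin (2 * Real.pi * u) * h1 - F.B.repr w 1 * hsq
    have e2 : F.B.repr w 2 = (F.B.repr w 1 * Real.cos (2 * Real.pi * u) +
        F.B.repr w 2 * Real.sin (2 * Real.pi * u)) * Real.sin (2 * Real.pi * u) := by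
      linear_combination -Real.cos (2 * Real.pi * u) * h1 - F.B.repr w 2 * hsq
    refine ray_transport_eq_iff.2 ⟨_, lt_of_le_of_ne h2 fun h0 => ?_,
      (F.sub_smul_direction_mem_iff w _ u).2 ⟨e1, e2⟩⟩
    rw [← h0, zero_mul] at e1 e2
    exact hw ((F.mem_span_iff w).2 ⟨e1, e2⟩)

theorem isClosedEmbedding_mk [T2Space M] (x : M) : IsClosedEmbedding
    (Bundle.TotalSpace.mk x : TangentSpace (𝓡 3) x → TangentBundle (𝓡 3) M) := by
  refine ⟨⟨FiberBundle.totalSpaceMk_isInducing (EuclideanSpace ℝ (Fin 3))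
      (TangentSpace (𝓡 3) : M → Type _) x, Bundle.TotalSpace.mk_injective x⟩, ?_⟩
  have : range (Bundle.TotalSpace.mk x : TangentSpace (𝓡 3) x → TangentBundle (𝓡 3) M) =
      Bundle.TotalSpace.proj ⁻¹' {x} := by
    ext ⟨y, v⟩
    constructor
    · rintro ⟨w, hw⟩
      exact (Bundle.TotalSpace.mk.inj hw).1.symm
    · rintro rfl
      exact ⟨v, rfl⟩
  rw [this]
  exact isClosed_singleton.preimage (FiberBundle.continuous_proj (EuclideanSpace ℝ (Fin 3))
    (TangentSpace (𝓡 3) : M → Type _))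

/-- The torus is a quotient space whose separation is not yet available, so closedness is checked on
normal vectors. There the set is the projection of a closed set along the compact `K`. -/
theorem isClosed_range_dirRay [T2Space M] {K : Type*} [TopologicalSpace K] [CompactSpace K]
    {t u : K → ℝ} (ht : Continuous t) (hu : Continuous u) :
    IsClosed (range fun k => F.dirRay (t k) (u k)) := by
  have hq : IsQuotientMap (ray : NormalVector φ p → BoundaryTorus φ p) := isQuotientMap_quotient_mk'
  rw [← hq.isClosed_preimage]
  let Z : Set (ℝ × TangentSpace (𝓡 3) p) := {z | F.B.repr z.2 1 * Real.sin (2 * Real.pi * z.1) =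
      F.B.repr z.2 2 * Real.cos (2 * Real.pi * z.1) ∧
      0 ≤ F.B.repr z.2 1 * Real.cos (2 * Real.pi * z.1) +
        F.B.repr z.2 2 * Real.sin (2 * Real.pi * z.1)}
  have hB (i : Fin 3) : Continuous fun z : ℝ × TangentSpace (𝓡 3) p => F.B.repr z.2 i :=
    (LinearMap.continuous_of_finiteDimensional (F.B.coord i)).comp continuous_snd
  have hZ : IsClosed Z := by
    have hs : Continuous fun z : ℝ × TangentSpace (𝓡 3) p => Real.sin (2 * Real.pi * z.1) :=
      Real.continuous_sin.comp (continuous_const.mul continuous_fst)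
    have hc : Continuous fun z : ℝ × TangentSpace (𝓡 3) p => Real.cos (2 * Real.pi * z.1) :=
      Real.continuous_cos.comp (continuous_const.mul continuous_fst)
    exact (isClosed_eq ((hB 1).mul hs) ((hB 2).mul hc)).inter
      (isClosed_le continuous_const (((hB 1).mul hc).add ((hB 2).mul hs)))
  have hZ' := ((IsClosedEmbedding.id (X := ℝ)).prodMap
    (isClosedEmbedding_mk p)).isClosedMap _ hZ
  have hG : Continuous fun z : K × NormalVector φ p =>
      ((u z.1, tangentFlow φ (-t z.1) z.2.1) : ℝ × TangentBundle (𝓡 3) M) :=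
    (hu.comp continuous_fst).prodMk ((continuous_tangentFlow φ).comp
      ((ht.comp continuous_fst).neg.prodMk (continuous_subtype_val.comp continuous_snd)))
  convert isClosedMap_snd_of_compactSpace _ (hZ'.preimage hG) using 1
  ext v
  constructor
  · rintro ⟨k, hk⟩
    obtain ⟨w, hw, hv⟩ := (F.ray_eq_dirRay_iff v _ _).1 hk.symm
    exact ⟨(k, v), ⟨(u k, w), hw, Prod.ext rfl hv⟩, rfl⟩
  · rintro ⟨⟨k, v⟩, ⟨⟨y, w⟩, hw, h⟩, rfl⟩
    obtain rfl : y = u k := congrArg Prod.fst h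
    exact ⟨k, ((F.ray_eq_dirRay_iff v _ _).2 ⟨w, hw, congrArg Prod.snd h⟩).symm⟩

/-- Periodic coordinates on the boundary torus. -/
def coord (x θ : ℝ) : BoundaryTorus φ p := F.dirRay (x * F.period) (F.holonomy.act (-x) θ)

theorem coord_act (x u : ℝ) : F.coord x (F.holonomy.act x u) = F.dirRay (x * F.period) u := by
  rw [coord, F.holonomy.act_neg_act]

/-- The holonomy gained over a period is cancelled by the factor `act (-x)`. -/
theorem coord_add_int (x θ : ℝ) (n : ℤ) : F.coord (x + n) θ = F.coord x θ := by
  have h1 : ∀ x, F.coord (x + 1) θ = F.coord x θ := fun x => by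
    rw [coord, add_mul, one_mul, F.dirRay_add_period, ← F.holonomy.act_add, coord]
    congr 2
    ring
  induction n with
  | zero => simp
  | succ n ih => push_cast at ih ⊢; rw [← add_assoc, h1, ih]
  | pred n ih =>
    have := h1 (x + (-n - 1))
    rw [show x + (-(n : ℝ) - 1) + 1 = x + -n by ring] at this
    push_cast at ih ⊢
    rw [← this, ih]

theorem coord_eq_iff {x θ x' θ' : ℝ} : F.coord x θ = F.coord x' θ' ↔
    (x : UnitAddCircle) = x' ∧ (θ : UnitAddCircle) = θ' := by
  have hP := F.isMinimalPeriod.1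
  have key : ∀ x, F.coord x θ = F.coord x θ' ↔ (θ : UnitAddCircle) = θ' := fun x => by
    rw [coord, coord, F.dirRay_eq_iff, coe_eq_coe_iff_exists]
    refine exists_congr fun n => ?_
    rw [← F.holonomy.act_add_int, (F.holonomy.strictMono_act _).injective.eq_iff]
  constructor
  · intro h
    have hb := congrArg BoundaryTorus.base h
    rw [coord, coord, F.base_dirRay, F.base_dirRay, F.isMinimalPeriod.apply_eq_apply_iff] at hb
    obtain ⟨n, hn⟩ := hb
    have hx : x = x' + n := mul_right_cancel₀ hP.ne' (by rw [hn]; ring)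
    rw [hx, F.coord_add_int, key] at h
    exact ⟨coe_eq_coe_iff_exists.2 ⟨n, hx⟩, h⟩
  · rintro ⟨hx, hθ⟩
    obtain ⟨n, rfl⟩ := coe_eq_coe_iff_exists.1 hx
    rw [F.coord_add_int, key]
    exact hθ

theorem coord_surjective (r : BoundaryTorus φ p) : ∃ x θ, F.coord x θ = r := by
  obtain ⟨t, u, rfl⟩ := F.dirRay_surjective r
  refine ⟨t / F.period, F.holonomy.act (t / F.period) u, ?_⟩
  rw [F.coord_act, div_mul_cancel₀ _ F.isMinimalPeriod.1.ne']

/-- The coordinates as a map on the standard torus. -/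
def torusMap (z : UnitAddCircle × UnitAddCircle) : BoundaryTorus φ p :=
  F.coord (Quotient.out z.1) (Quotient.out z.2)

theorem torusMap_coe (x θ : ℝ) : F.torusMap (x, θ) = F.coord x θ :=
  F.coord_eq_iff.2 ⟨QuotientAddGroup.out_eq' _, QuotientAddGroup.out_eq' _⟩

theorem torusMap_bijective : Function.Bijective F.torusMap := by
  constructor
  · rintro ⟨a, b⟩ ⟨a', b'⟩ h
    obtain ⟨x, rfl⟩ := QuotientAddGroup.mk_surjective a
    obtain ⟨y, rfl⟩ := QuotientAddGroup.mk_surjective b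
    obtain ⟨x', rfl⟩ := QuotientAddGroup.mk_surjective a'
    obtain ⟨y', rfl⟩ := QuotientAddGroup.mk_surjective b'
    have h' := (F.torusMap_coe x y).symm.trans (h.trans (F.torusMap_coe x' y'))
    obtain ⟨h1, h2⟩ := F.coord_eq_iff.1 h'
    exact Prod.ext h1 h2
  · intro r
    obtain ⟨x, θ, h⟩ := F.coord_surjective r
    exact ⟨(x, θ), (F.torusMap_coe x θ).trans h⟩

theorem continuous_coord : Continuous fun z : ℝ × ℝ => F.coord z.1 z.2 :=
  F.continuous_dirRay.comp ((continuous_fst.mul continuous_const).prodMk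
    (F.holonomy.continuous_comp continuous_fst.neg continuous_snd))

theorem continuous_torusMap : Continuous F.torusMap := by
  have hq : IsOpenQuotientMap (Prod.map ((↑) : ℝ → UnitAddCircle) ((↑) : ℝ → UnitAddCircle)) :=
    QuotientAddGroup.isOpenQuotientMap_mk.prodMap QuotientAddGroup.isOpenQuotientMap_mk
  rw [hq.isQuotientMap.continuous_iff]
  convert F.continuous_coord using 1
  funext z
  exact F.torusMap_coe z.1 z.2

/-- A closed subset of the torus is the image of a compact part of the unit square. -/
theorem isClosedMap_torusMap [T2Space M] : IsClosedMap F.torusMap := by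
  intro C hC
  have hmk := AddCircle.continuous_mk' (1 : ℝ)
  let K : Set (ℝ × ℝ) := Icc (0 : ℝ × ℝ) 1 ∩
    {z | ((z.1 : UnitAddCircle), (z.2 : UnitAddCircle)) ∈ C}
  have hK : IsCompact K := isCompact_Icc.inter_right
    (hC.preimage ((hmk.comp continuous_fst).prodMk (hmk.comp continuous_snd)))
  have : CompactSpace K := isCompact_iff_compactSpace.1 hK
  convert F.isClosed_range_dirRay (K := K) (t := fun z => z.1.1 * F.period)
    (u := fun z => F.holonomy.act (-z.1.1) z.1.2) (by fun_prop)
    (F.holonomy.continuous_comp (by fun_prop) (by fun_prop)) using 1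
  have hfr : ∀ a : UnitAddCircle, ∃ x ∈ Icc (0 : ℝ) 1, (x : UnitAddCircle) = a := fun a => by
    obtain ⟨x, rfl⟩ := QuotientAddGroup.mk_surjective a
    refine ⟨Int.fract x, ⟨Int.fract_nonneg x, (Int.fract_lt_one x).le⟩, ?_⟩
    exact coe_eq_coe_iff_exists.2 ⟨-⌊x⌋, by rw [Int.fract]; push_cast; ring⟩
  ext r
  constructor
  · rintro ⟨⟨a, b⟩, hab, rfl⟩
    obtain ⟨x, hx, rfl⟩ := hfr a
    obtain ⟨y, hy, rfl⟩ := hfr b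
    exact ⟨⟨(x, y), ⟨⟨hx.1, hy.1⟩, ⟨hx.2, hy.2⟩⟩, hab⟩, (F.torusMap_coe x y).symm⟩
  · rintro ⟨⟨⟨x, y⟩, -, hab⟩, rfl⟩
    exact ⟨_, hab, F.torusMap_coe x y⟩

theorem det_eq {v : Fin 3 → TangentSpace (𝓡 3) p} (h : v 0 = φ.velocity p) :
    F.B.det v = F.B.repr (v 1) 1 * F.B.repr (v 2) 2 - F.B.repr (v 1) 2 * F.B.repr (v 2) 1 := by
  rw [Module.Basis.det_apply, Matrix.det_fin_three]
  simp only [Module.Basis.toMatrix_apply, h, ← F.B_zero]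
  simp
  ring

/-- With the velocity as first vector the determinant in the frame reduces to a 2 × 2 minor, which
for two directions is the sine of the angle between them. Positive scalings of the rays do not
affect its sign. -/
theorem positivelyOriented_iff (t u u' : ℝ) :
    PositivelyOriented o (F.dirRay t u) (F.dirRay t u') ↔
      0 < Real.sin (2 * Real.pi * (u' - u)) := by
  have hsin : Real.sin (2 * Real.pi * (u' - u)) =
      Real.cos (2 * Real.pi * u) * Real.sin (2 * Real.pi * u') -
        Real.sin (2 * Real.pi * u) * Real.cos (2 * Real.pi * u') := by
    rw [mul_sub, Real.sin_sub]; ring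
  constructor
  · rintro ⟨v, w, hv, hw, q, a, a', hva, hwa, b, hb0, hb1, hb2, hbo⟩
    have hq : q = φ.toFlow t p := by
      have := congrArg BoundaryTorus.base hv
      rw [F.base_dirRay] at this
      rw [this]
      change q = v.1.proj
      rw [hva]
    subst hq
    have key : ∀ (v : NormalVector φ p) (a : TangentSpace (𝓡 3) (φ.toFlow t p)) (u : ℝ),
        F.dirRay t u = ray v → v.1 = ⟨φ.toFlow t p, a⟩ → ∃ r : ℝ, 0 < r ∧
          F.B.repr ((diffEquiv φ t p).symm a) 1 = r * Real.cos (2 * Real.pi * u) ∧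
          F.B.repr ((diffEquiv φ t p).symm a) 2 = r * Real.sin (2 * Real.pi * u) := by
      intro v a u hv hva
      obtain ⟨w, rfl⟩ := (diffEquiv φ t p).surjective a
      have hw : w ∉ Submodule.span ℝ {φ.velocity p} := fun h => by
        have h4 := v.2.2
        rw [hva] at h4
        exact h4 (φ.diff_mem_span t p w h)
      obtain rfl : v = transport φ p t w hw := Subtype.ext hva
      obtain ⟨r, hr, hm⟩ := ray_transport_eq_iff.1 hv.symm
      rw [LinearEquiv.symm_apply_apply]
      exact ⟨r, hr, (F.sub_smul_direction_mem_iff w r u).1 hm⟩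
    obtain ⟨r, hr, h1, h2⟩ := key v a u hv hva
    obtain ⟨r', hr', h1', h2'⟩ := key w a' u' hw hwa
    rw [← F.orientation_eq t, eq_comm, Module.Basis.orientation_eq_iff_det_pos,
      Module.Basis.det_map, F.det_eq (by
        change (diffEquiv φ t p).symm (b 0) = _
        rw [hb0, LinearEquiv.symm_apply_eq]
        exact (φ.diff_velocity t p).symm)] at hbo
    simp only [Function.comp, hb1, hb2, h1, h2, h1', h2'] at hbo
    have : 0 < r * r' * Real.sin (2 * Real.pi * (u' - u)) := by
      rw [hsin]
      linarith
    exact (pos_iff_pos_of_mul_pos this).1 (mul_pos hr hr')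
  · intro hpos
    let d : Fin 3 → TangentSpace (𝓡 3) p := ![φ.velocity p, F.direction u, F.direction u']
    have hd : F.B.det d = Real.sin (2 * Real.pi * (u' - u)) := by
      rw [F.det_eq rfl, hsin, ← F.repr_direction_one, ← F.repr_direction_one,
        ← F.repr_direction_two, ← F.repr_direction_two]
      rfl
    obtain ⟨h1, h2⟩ := (Module.Basis.is_basis_iff_det F.B (v := d)).2 (by
      rw [hd]; exact isUnit_iff_ne_zero.2 hpos.ne')
    let b := Module.Basis.mk h1 h2.ge
    have hb : ⇑b = d := Module.Basis.coe_mk h1 h2.ge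
    refine ⟨_, _, rfl, rfl, φ.toFlow t p, φ.diff t p (F.direction u),
      φ.diff t p (F.direction u'), rfl, rfl, b.map (diffEquiv φ t p), ?_, ?_, ?_, ?_⟩
    · rw [Module.Basis.map_apply, hb]
      exact φ.diff_velocity t p
    · rw [Module.Basis.map_apply, hb]
      rfl
    · rw [Module.Basis.map_apply, hb]
      rfl
    · rw [← F.orientation_eq t, eq_comm, Module.Basis.orientation_eq_iff_det_pos,
        Module.Basis.det_map]
      have : (diffEquiv φ t p).symm ∘ b.map (diffEquiv φ t p) = d := by
        rw [← hb]
        funext i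
        simp
      rw [this, hd]
      exact hpos

/-- The coordinates on the boundary torus given by an adapted frame. -/
def torusChart [T2Space M] : TorusChart o φ Es p where
  period := F.period
  isMinimalPeriod := F.isMinimalPeriod
  W := F.holonomy
  H := (Equiv.ofBijective _ F.torusMap_bijective).toHomeomorphOfContinuousClosed
    F.continuous_torusMap F.isClosedMap_torusMap
  base_apply x u := congrArg BoundaryTorus.base (F.torusMap_coe x u)
  rayFlow_apply t x u := by
    change rayFlow φ p (t * F.period) (F.torusMap _) = F.torusMap _
    rw [F.torusMap_coe, F.torusMap_coe, coord, F.rayFlow_dirRay, coord, ← F.holonomy.act_add]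
    congr 1
    · ring
    · congr 1
      ring
  positivelyOriented_iff x u u' := by
    change PositivelyOriented o (F.torusMap _) (F.torusMap _) ↔ _
    rw [F.torusMap_coe, F.torusMap_coe, F.coord_act, F.coord_act, F.positivelyOriented_iff]
  stable x := by
    refine ⟨transport φ p (x * F.period) (F.direction 0) (F.direction_notMem 0), ?_, ?_⟩
    · change F.torusMap _ = _
      rw [F.torusMap_coe, coord, F.holonomy.act_fix]
      rfl
    · have : F.direction 0 = F.B 1 := by simp [direction]
      change φ.diff (x * F.period) p (F.direction 0) ∈ Es (φ.toFlow (x * F.period) p)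
      rw [this]
      exact F.stable _

end AdaptedFrame

end Manifold

end FriedSurgery

end

theorem mainTheorem6 {M : Type*} [TopologicalSpace M] [T2Space M] [CompactSpace M]
    [ChartedSpace (EuclideanSpace ℝ (Fin 3)) M] [IsManifold (𝓡 3) ∞ M]
    (o : ∀ x : M, Orientation ℝ (TangentSpace (𝓡 3) x) (Fin 3))
    (ho : FriedSurgery.IsOrientation o)
    (φ : FriedSurgery.SmoothFlow M)
    (Es Eu : ∀ x : M, Submodule ℝ (TangentSpace (𝓡 3) x))
    (hφ : FriedSurgery.IsAnosov φ Es Eu)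
    (p : M) (hp : ∃ P : ℝ, FriedSurgery.IsMinimalPeriod φ.toFlow p P)
    (hEs : FriedSurgery.OrientableAlong Es (φ.toFlow.orbit p))
    (hEu : FriedSurgery.OrientableAlong Eu (φ.toFlow.orbit p))
    (k : ℤ) (leaf : Setoid (FriedSurgery.BoundaryTorus φ p))
    (hleaf : FriedSurgery.IsSurgeryFoliation o φ Es Eu p k leaf)
    (Ψ : Flow ℝ (FriedSurgery.Blowup φ p)) (φ' : Flow ℝ (FriedSurgery.Surgered leaf))
    (hφ' : FriedSurgery.IsSurgeryFlow leaf Ψ φ')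
    (c : C(UnitAddCircle, FriedSurgery.BoundaryTorus φ p)) :
    ∃ m l : ℤ,
      (∀ n : ℤ, FriedSurgery.IsMultiplicity FriedSurgery.Blowup.blowDown φ.toFlow c n ↔ n = m) ∧
      (∀ n : ℤ, FriedSurgery.IsLinkingNumber o FriedSurgery.Blowup.blowDown φ.toFlow
        (FriedSurgery.IsParallel φ Es Eu p) c n ↔ n = l) ∧
      (∀ n : ℤ, FriedSurgery.IsMultiplicity (FriedSurgery.surgeryProj leaf) φ' c n ↔
        n = m - k * l) ∧
      (∀ n : ℤ, FriedSurgery.IsLinkingNumber o (FriedSurgery.surgeryProj leaf) φ'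
        (FriedSurgery.IsClosedOrbit Ψ) c n ↔ n = l) := by
  obtain ⟨P, hP⟩ := hp
  obtain ⟨F⟩ := FriedSurgery.exists_adaptedFrame ho hφ hP hEs hEu
  let C := F.torusChart
  -- The bidegree of `c` yields all four integers: a and b before surgery, a − kb and b after it.
  obtain ⟨a, b, hab⟩ := FriedSurgery.exists_hasBidegree C.H c
  exact ⟨a, b, C.isMultiplicity_iff hab, C.isLinkingNumber_iff hab,
    C.surgery_isMultiplicity_iff hleaf hφ' hab, C.surgery_isLinkingNumber_iff hleaf hφ' hab⟩
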